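/- Let $W=W_1\oplus\cdots\oplus W_r$ be a finite-dimensional real vector space with a fixed direct sum decomposition, with dilations $h_t\big(\sum_j w_j\big)=\sum_j t^j w_j$ ($w_j\in W_j$, $t>0$). A smooth vector field $X$ on $W$ is homogeneous of degree $m$ if $X(f\circ h_t)=t^m (Xf)\circ h_t$ for all $f\in C^\infty(W)$ and $t>0$. Let $X_1,\dots,X_p$ be smooth real vector fields on $W$ that are homogeneous of degree $1$ and satisfy Hörmander's condition: the $X_\ell$ and their iterated commutators span the tangent space of $W$ at the origin. Let $\mathfrak g$ be the Lie algebra of vector fields generated by $X_1,\dots,X_p$, let $\mathfrak h=\{X\in\mathfrak g: X|_0=0\}$, and assume that the space of elements of $\mathfrak h$ that are homogeneous of degree $1$ has codimension at least $2$ in the space of elements of $\mathfrak g$ that are homogeneous of degree $1$. Let $\Omega\subset W$ be a nonempty open set, and let $L^2(\Omega)$ be the complex $L^2$-space with respect to Lebesgue measure. Let $S^1(\Omega)$ be the space of all $u\in L^2(\Omega)$ whose distributional derivatives $X_\ell u$, $\ell=1,\dots,p$, belong to $L^2(\Omega)$, with norm $\big(\|u\|_{L^2}^2+\sum_\ell\|X_\ell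 u\|_{L^2}^2\big)^{1/2}$, and let $S^1_0(\Omega)$ be the closure in $S^1(\Omega)$ of the functions in $S^1(\Omega)$ that vanish outside a compact subset of $\Omega$. Put $\mathcal L=\sum_{\ell=1}^p X_\ell^2$ and let $-\mathcal L^{\rm N}_\Omega$ and $-\mathcal L^{\rm D}_\Omega$ (the Neumann and Dirichlet realizations of $-\mathcal L$) be the nonnegative selfadjoint operators in $L^2(\Omega)$ associated with the quadratic form $\sum_\ell\|X_\ell u\|_{L^2}^2$ with form domains $S^1(\Omega)$ and $S^1_0(\Omega)$, respectively. Assume that $-\mathcal L^{\rm N}_\Omega$ has compact resolvent. Then each of the operators $-\mathcal L^{\rm D}_\Omega$ and $-\mathcal L^{\rm N}_\Omega$ has an infinite sequence of eigenvalues of finite multiplicities, accumulating only at infinity, and, if $\lambda_1\le\lambda_2\le\cdots$ denotes the eigenvalues in nondecreasing order, repeated according to multiplicity, $$\lambda_j(-\mathcal L^{\rm D}_\Omega)>\lambda_{j+1}(-\mathcal L^{\rm N}_\Omega)\qquad\text{for all } j\in\mathbb N=\{1,2,3,\dots\}.$$ -/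

import Mathlib

open MeasureTheory Filter Topology
open scoped ContDiff

noncomputable section

namespace SubLaplacian

/-! ### Smooth vector fields and their Lie algebra -/

section VectorFields

variable (W : Type*) [NormedAddCommGroup W] [NormedSpace ℝ W]

/-- Smooth real vector fields on the vector space `W`, as maps `W → W`. -/
def smoothFields : Submodule ℝ (W → W) where
  carrier := {Y | ContDiff ℝ ∞ Y}
  add_mem' {Y Z} hY hZ := by
    have hY : ContDiff ℝ ∞ Y := hY
    have hZ : ContDiff ℝ ∞ Z := hZ
    exact (hY.add hZ : ContDiff ℝ ∞ (Y + Z))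
  zero_mem' := (contDiff_const : ContDiff ℝ ∞ fun _ : W => (0 : W))
  smul_mem' c Y hY := by
    have hY : ContDiff ℝ ∞ Y := hY
    exact (hY.const_smul c : ContDiff ℝ ∞ (c • Y))

/-- The type of smooth real vector fields on `W`. -/
abbrev VField : Type _ := ↥(smoothFields W)

variable {W}

/-- The derivative `Y f` of a function `f` along the vector field `Y`. -/
def along {F : Type*} [NormedAddCommGroup F] [NormedSpace ℝ F]
    (Y : VField W) (f : W → F) (x : W) : F :=
  fderiv ℝ f x (Y.1 x)

/-- The divergence of a vector field (with respect to Lebesgue measure). -/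
def divergence (Y : VField W) (x : W) : ℝ :=
  LinearMap.trace ℝ W (fderiv ℝ Y.1 x : W →ₗ[ℝ] W)

theorem VField.contDiff (Y : VField W) : ContDiff ℝ ∞ Y.1 := Y.2

theorem VField.differentiableAt (Y : VField W) (x : W) : DifferentiableAt ℝ Y.1 x :=
  (Y.contDiff.differentiable (by simp)) x

/-- The Lie bracket of smooth vector fields is Mathlib's `VectorField.lieBracket`. -/
instance : Bracket (VField W) (VField W) where
  bracket Y Z := ⟨VectorField.lieBracket ℝ Y.1 Z.1,
    (Y.contDiff.lieBracket_vectorField Z.contDiff (by simp) :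
      ContDiff ℝ ∞ (VectorField.lieBracket ℝ Y.1 Z.1))⟩

theorem VField.bracket_apply (Y Z : VField W) (x : W) :
    (⁅Y, Z⁆ : VField W).1 x = VectorField.lieBracket ℝ Y.1 Z.1 x := rfl

instance : LieRing (VField W) where
  add_lie Y Z V := Subtype.ext <| funext fun x =>
    VectorField.lieBracket_add_left (Y.differentiableAt x) (Z.differentiableAt x)
  lie_add Y Z V := Subtype.ext <| funext fun x =>
    VectorField.lieBracket_add_right (Z.differentiableAt x) (V.differentiableAt x)
  lie_self Y := Subtype.ext VectorField.lieBracket_self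
  leibniz_lie Y Z V := Subtype.ext <| funext fun _ =>
    VectorField.leibniz_identity_lieBracket (n := ∞) (by simpa using ENat.LEInfty.out)
      Y.contDiff.contDiffAt Z.contDiff.contDiffAt V.contDiff.contDiffAt

instance : LieAlgebra ℝ (VField W) where
  lie_smul _ _ Z := Subtype.ext <| funext fun x =>
    VectorField.lieBracket_const_smul_right (Z.differentiableAt x)

/-- The Lie algebra `𝔤` of vector fields generated by `X₁, …, X_p`. -/
def generatedAlgebra {p : ℕ} (X : Fin p → VField W) : LieSubalgebra ℝ (VField W) :=
  LieSubalgebra.lieSpan ℝ (VField W) (Set.range X)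

/-- The isotropy subalgebra `𝔥` of those elements of `𝔤` that vanish at the origin. -/
def isotropyAlgebra {p : ℕ} (X : Fin p → VField W) : LieSubalgebra ℝ (VField W) where
  carrier := {Y | Y ∈ generatedAlgebra X ∧ Y.1 0 = 0}
  add_mem' hY hZ := ⟨add_mem hY.1 hZ.1, by simp [hY.2, hZ.2]⟩
  zero_mem' := ⟨zero_mem _, rfl⟩
  smul_mem' c _ hY := ⟨(generatedAlgebra X).smul_mem c hY.1, by simp [hY.2]⟩
  lie_mem' hY hZ := ⟨(generatedAlgebra X).lie_mem hY.1 hZ.1, by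
    simp [VField.bracket_apply, VectorField.lieBracket, hY.2, hZ.2]⟩

/-- Hörmander's condition at the origin: `X₁, …, X_p` and their iterated commutators span the
tangent space at `0`. -/
def HormanderCondition {p : ℕ} (X : Fin p → VField W) : Prop :=
  ∀ w : W, ∃ Y ∈ generatedAlgebra X, Y.1 0 = w

end VectorFields

/-! ### Dilations and homogeneity -/

section Homogeneity

variable {W : Type*} [NormedAddCommGroup W] [NormedSpace ℝ W]
  {r : ℕ} (𝒲 : Fin r → Submodule ℝ W) [DirectSum.Decomposition 𝒲]

/-- The dilation `h_t`, acting as multiplication by `t ^ j` on the `j`-th summand, `j = 1, …, r`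
(the summand with index `i : Fin r` is the `(i + 1)`-st one). -/
def dilation (t : ℝ) (w : W) : W :=
  ∑ i : Fin r, t ^ ((i : ℕ) + 1) • (DirectSum.decompose 𝒲 w i : W)

/-- `Y (f ∘ h_t) = t ^ m (Y f) ∘ h_t` for all smooth `f` and all `t > 0`. -/
def IsHomogeneous (m : ℕ) (Y : VField W) : Prop :=
  ∀ f : W → ℝ, ContDiff ℝ ∞ f → ∀ t : ℝ, 0 < t → ∀ x : W,
    along Y (f ∘ dilation 𝒲 t) x = t ^ m * along Y f (dilation 𝒲 t x)

/-- The space of smooth vector fields that are homogeneous of degree `m`. -/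
def homogeneousFields (m : ℕ) : Submodule ℝ (VField W) where
  carrier := {Y | IsHomogeneous 𝒲 m Y}
  add_mem' {Y Z} hY hZ f hf t ht x := by
    have h1 := hY f hf t ht x
    have h2 := hZ f hf t ht x
    simp only [along, Submodule.coe_add, Pi.add_apply, map_add] at h1 h2 ⊢
    rw [h1, h2]; ring
  zero_mem' f hf t ht x := by simp [along]
  smul_mem' c Y hY f hf t ht x := by
    have h1 := hY f hf t ht x
    simp only [along, Submodule.coe_smul, Pi.smul_apply, map_smul, smul_eq_mul] at h1 ⊢
    rw [h1]; ring

/-- The degree-one part of `𝔤`. -/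
def algebraDegOne {p : ℕ} (X : Fin p → VField W) : Submodule ℝ (VField W) :=
  (generatedAlgebra X).toSubmodule ⊓ homogeneousFields 𝒲 1

/-- The degree-one part of `𝔥`. -/
def isotropyDegOne {p : ℕ} (X : Fin p → VField W) : Submodule ℝ (VField W) :=
  (isotropyAlgebra X).toSubmodule ⊓ homogeneousFields 𝒲 1

/-- The codimension of the degree-one part of `𝔥` in the degree-one part of `𝔤`. -/
def degOneCodim {p : ℕ} (X : Fin p → VField W) : Cardinal :=
  Module.rank ℝ (algebraDegOne 𝒲 X ⧸ (isotropyDegOne 𝒲 X).submoduleOf (algebraDegOne 𝒲 X))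

end Homogeneity

/-! ### The Sobolev spaces and the Dirichlet and Neumann realizations -/

section Sobolev

variable {W : Type*} [NormedAddCommGroup W] [NormedSpace ℝ W] [FiniteDimensional ℝ W]
  [MeasurableSpace W] [BorelSpace W] (μ : Measure W) [μ.IsAddHaarMeasure] (Ω : Set W)

/-- The complex Hilbert space `L²(Ω)`. -/
abbrev L2 : Type _ := Lp ℂ 2 (μ.restrict Ω)

/-- Smooth complex-valued functions with compact support in `Ω`. -/
def IsTestFunction (φ : W → ℂ) : Prop :=
  ContDiff ℝ ∞ φ ∧ HasCompactSupport φ ∧ tsupport φ ⊆ Ω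

/-- `g` is the distributional derivative `Y u` in `Ω`, that is, `∫ g φ = ∫ u (Yᵗ φ)` for all test
functions, where `Yᵗ φ = -(Y φ + (div Y) φ)` is the formal transpose. -/
def HasWeakDeriv (Y : VField W) (u g : L2 μ Ω) : Prop :=
  ∀ φ : W → ℂ, IsTestFunction Ω φ →
    ∫ x in Ω, g x * φ x ∂μ = -∫ x in Ω, u x * (along Y φ x + (divergence Y x : ℂ) * φ x) ∂μ

theorem continuous_along (Y : VField W) {φ : W → ℂ} (hφ : ContDiff ℝ ∞ φ) :
    Continuous (along Y φ) :=
  (hφ.continuous_fderiv (by simp)).clm_apply Y.contDiff.continuous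

theorem continuous_divergence (Y : VField W) : Continuous (divergence Y) := by
  have h : Continuous fun x => fderiv ℝ Y.1 x := Y.contDiff.continuous_fderiv (by simp)
  exact (LinearMap.continuous_of_finiteDimensional
    ((LinearMap.trace ℝ W).comp (ContinuousLinearMap.coeLM ℝ))).comp h

theorem integrable_mul {ψ : W → ℂ} (hψ : Continuous ψ) (hc : HasCompactSupport ψ) (u : L2 μ Ω) :
    Integrable (fun x => u x * ψ x) (μ.restrict Ω) :=
  MemLp.integrable_mul (p := 2) (q := 2) (Lp.memLp u) (hψ.memLp_of_hasCompactSupport hc)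

theorem integrable_mul_transpose (Y : VField W) {φ : W → ℂ} (hφ : IsTestFunction Ω φ)
    (u : L2 μ Ω) :
    Integrable (fun x => u x * (along Y φ x + (divergence Y x : ℂ) * φ x)) (μ.restrict Ω) := by
  refine integrable_mul μ Ω ?_ ?_ u
  · exact (continuous_along Y hφ.1).add
      ((Complex.continuous_ofReal.comp (continuous_divergence Y)).mul hφ.1.continuous)
  · refine HasCompactSupport.add ?_ hφ.2.1.mul_left
    refine (hφ.2.1.fderiv (𝕜 := ℝ)).mono fun x hx h0 => hx ?_
    simp [along, h0]

variable {p : ℕ} (X : Fin p → VField W)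

/-- The Sobolev space `S¹(Ω) = {u ∈ L²(Ω) : X_ℓ u ∈ L²(Ω) for all ℓ}`, represented by the pairs
`(u, (X₁ u, …, X_p u))`; the norm of `L² × (L²)ᵖ` is equivalent on it to the norm of `S¹(Ω)`. -/
def sobolev : Submodule ℂ (L2 μ Ω × (Fin p → L2 μ Ω)) where
  carrier := {w | ∀ ℓ, HasWeakDeriv μ Ω (X ℓ) w.1 (w.2 ℓ)}
  add_mem' {v w} hv hw ℓ φ hφ := by
    have h1 : (fun x => (v.2 ℓ + w.2 ℓ : L2 μ Ω) x * φ x) =ᵐ[μ.restrict Ω]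
        fun x => v.2 ℓ x * φ x + w.2 ℓ x * φ x := by
      filter_upwards [Lp.coeFn_add (v.2 ℓ) (w.2 ℓ)] with x hx
      rw [hx, Pi.add_apply, add_mul]
    have h2 : (fun x => (v.1 + w.1 : L2 μ Ω) x *
          (along (X ℓ) φ x + (divergence (X ℓ) x : ℂ) * φ x)) =ᵐ[μ.restrict Ω]
        fun x => v.1 x * (along (X ℓ) φ x + (divergence (X ℓ) x : ℂ) * φ x) +
          w.1 x * (along (X ℓ) φ x + (divergence (X ℓ) x : ℂ) * φ x) := by
      filter_upwards [Lp.coeFn_add v.1 w.1] with x hx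
      rw [hx, Pi.add_apply, add_mul]
    change ∫ x in Ω, (v.2 ℓ + w.2 ℓ : L2 μ Ω) x * φ x ∂μ = -∫ x in Ω, (v.1 + w.1 : L2 μ Ω) x *
          (along (X ℓ) φ x + (divergence (X ℓ) x : ℂ) * φ x) ∂μ
    rw [integral_congr_ae h1, integral_congr_ae h2,
      integral_add (integrable_mul μ Ω hφ.1.continuous hφ.2.1 _)
        (integrable_mul μ Ω hφ.1.continuous hφ.2.1 _),
      integral_add (integrable_mul_transpose μ Ω _ hφ _) (integrable_mul_transpose μ Ω _ hφ _),
      hv ℓ φ hφ, hw ℓ φ hφ, neg_add]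
  zero_mem' ℓ φ hφ := by
    have h1 : ∀ ψ : W → ℂ, (fun x => (0 : L2 μ Ω) x * ψ x) =ᵐ[μ.restrict Ω] fun _ => 0 := by
      intro ψ
      filter_upwards [Lp.coeFn_zero ℂ 2 (μ.restrict Ω)] with x hx
      rw [hx, Pi.zero_apply, zero_mul]
    change ∫ x in Ω, (0 : L2 μ Ω) x * φ x ∂μ = -∫ x in Ω, (0 : L2 μ Ω) x *
          (along (X ℓ) φ x + (divergence (X ℓ) x : ℂ) * φ x) ∂μ
    rw [integral_congr_ae (h1 _), integral_congr_ae (h1 _)]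
    simp
  smul_mem' c w hw ℓ φ hφ := by
    have h1 : ∀ (u : L2 μ Ω) (ψ : W → ℂ), (fun x => (c • u : L2 μ Ω) x * ψ x) =ᵐ[μ.restrict Ω]
        fun x => c * (u x * ψ x) := by
      intro u ψ
      filter_upwards [Lp.coeFn_smul c u] with x hx
      rw [hx, Pi.smul_apply, smul_eq_mul, mul_assoc]
    change ∫ x in Ω, (c • w.2 ℓ : L2 μ Ω) x * φ x ∂μ = -∫ x in Ω, (c • w.1 : L2 μ Ω) x *
          (along (X ℓ) φ x + (divergence (X ℓ) x : ℂ) * φ x) ∂μ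
    rw [integral_congr_ae (h1 _ _), integral_congr_ae (h1 _ _), integral_const_mul,
      integral_const_mul, hw ℓ φ hφ, mul_neg]

/-- The elements of `S¹(Ω)` that vanish (almost everywhere) outside a compact subset of `Ω`. -/
def sobolevCompact : Submodule ℂ (L2 μ Ω × (Fin p → L2 μ Ω)) where
  carrier := {w | w ∈ sobolev μ Ω X ∧ ∃ K : Set W, IsCompact K ∧ K ⊆ Ω ∧
    ∀ᵐ x ∂μ.restrict Ω, x ∉ K → w.1 x = 0}
  add_mem' {v w} hv hw := by
    obtain ⟨hv, K, hK, hKΩ, hvK⟩ := hv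
    obtain ⟨hw, L, hL, hLΩ, hwL⟩ := hw
    refine ⟨add_mem hv hw, K ∪ L, hK.union hL, Set.union_subset hKΩ hLΩ, ?_⟩
    filter_upwards [hvK, hwL, Lp.coeFn_add v.1 w.1] with x h1 h2 h3 hx
    rw [Set.mem_union, not_or] at hx
    rw [Prod.fst_add, h3, Pi.add_apply, h1 hx.1, h2 hx.2, add_zero]
  zero_mem' := by
    refine ⟨zero_mem _, ∅, isCompact_empty, Set.empty_subset _, ?_⟩
    filter_upwards [Lp.coeFn_zero ℂ 2 (μ.restrict Ω)] with x hx _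
    simpa using hx
  smul_mem' c w hw := by
    obtain ⟨hw, K, hK, hKΩ, hwK⟩ := hw
    refine ⟨Submodule.smul_mem _ c hw, K, hK, hKΩ, ?_⟩
    filter_upwards [hwK, Lp.coeFn_smul c w.1] with x h1 h2 hx
    rw [Prod.smul_fst, h2, Pi.smul_apply, h1 hx, smul_zero]

/-- `S¹₀(Ω)`, the closure in `S¹(Ω)` of the elements that vanish outside a compact subset
of `Ω`. -/
def sobolevZero : Submodule ℂ (L2 μ Ω × (Fin p → L2 μ Ω)) :=
  (sobolevCompact μ Ω X).topologicalClosure ⊓ sobolev μ Ω X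

variable {μ Ω} in
/-- The graph of the operator associated with the quadratic form `∑ ℓ, ‖X_ℓ u‖²` on the form
domain `D`: it sends `u` to `f` if `u` lies in the form domain and
`∑ ℓ, ⟪X_ℓ v, X_ℓ u⟫ = ⟪v, f⟫` for all `v` in the form domain. -/
def formGraph (D : Submodule ℂ (L2 μ Ω × (Fin p → L2 μ Ω))) :
    Submodule ℂ (L2 μ Ω × L2 μ Ω) where
  carrier := {uf | ∃ g : Fin p → L2 μ Ω, (uf.1, g) ∈ D ∧
    ∀ w ∈ D, ∑ ℓ, inner ℂ (w.2 ℓ) (g ℓ) = inner ℂ w.1 uf.2}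
  add_mem' := by
    rintro a b ⟨g, hg, hag⟩ ⟨k, hk, hbk⟩
    refine ⟨g + k, add_mem hg hk, fun w hw => ?_⟩
    simp only [Pi.add_apply, inner_add_right, Finset.sum_add_distrib, hag w hw, hbk w hw,
      Prod.snd_add]
  zero_mem' := ⟨0, zero_mem _, fun w _ => by simp⟩
  smul_mem' := by
    rintro c a ⟨g, hg, hag⟩
    refine ⟨c • g, D.smul_mem c hg, fun w hw => ?_⟩
    simp only [Pi.smul_apply, inner_smul_right, ← Finset.mul_sum, hag w hw, Prod.smul_snd]

/-- The Neumann realization of `-∑ ℓ, X_ℓ²` in `L²(Ω)`, with form domain `S¹(Ω)`. -/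
def neumann : L2 μ Ω →ₗ.[ℂ] L2 μ Ω :=
  (formGraph (sobolev μ Ω X)).toLinearPMap

/-- The Dirichlet realization of `-∑ ℓ, X_ℓ²` in `L²(Ω)`, with form domain `S¹₀(Ω)`. -/
def dirichlet : L2 μ Ω →ₗ.[ℂ] L2 μ Ω :=
  (formGraph (sobolevZero μ Ω X)).toLinearPMap

end Sobolev

/-! ### Compact resolvent and enumeration of eigenvalues -/

section Spectral

variable {H : Type*} [NormedAddCommGroup H] [InnerProductSpace ℂ H]

/-- `R` is the resolvent `(A - z)⁻¹`, an everywhere defined bounded operator. -/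
def IsResolventAt (A : H →ₗ.[ℂ] H) (z : ℂ) (R : H →L[ℂ] H) : Prop :=
  (∀ f : H, ∃ h : R f ∈ A.domain, A ⟨R f, h⟩ - z • R f = f) ∧
    ∀ u : A.domain, R (A u - z • (u : H)) = u

/-- `A` has compact resolvent: `(A - z)⁻¹` exists and is compact for some `z`. -/
def HasCompactResolvent (A : H →ₗ.[ℂ] H) : Prop :=
  ∃ (z : ℂ) (R : H →L[ℂ] H), IsResolventAt A z R ∧ IsCompactOperator R

/-- The eigenspace `{u ∈ dom A : A u = z u}`. -/
def eigenspace (A : H →ₗ.[ℂ] H) (z : ℂ) : Submodule ℂ H :=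
  A.graph.comap (LinearMap.id.prod (z • LinearMap.id))

/-- `a 0 ≤ a 1 ≤ …` are all the eigenvalues of `A`, repeated according to their (finite)
multiplicities, and accumulating only at infinity. With the usual numbering from one,
`a j` is `λ_{j+1}(A)`. -/
structure IsEigenvalueSequence (A : H →ₗ.[ℂ] H) (a : ℕ → ℝ) : Prop where
  mono : Monotone a
  tendsto : Tendsto a atTop atTop
  finite : ∀ z : ℂ, FiniteDimensional ℂ (eigenspace A z)
  multiplicity : ∀ z : ℂ, Module.finrank ℂ (eigenspace A z) = {j : ℕ | (a j : ℂ) = z}.ncard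

end Spectral

end SubLaplacian

end

/-! Everything follows from one inequality between counting functions. Write `N_D(c)` and `N_N(c)`
for the number of Dirichlet and Neumann eigenvalues at most `c`. For `c > 0` one has `N_D(c) + dim
ker(N - c) + 1 ≤ N_N(c)` (`finrank_dirichlet_add_le`), so strictly below `c = λ_j(D)` there are at
least `j + 1` Neumann eigenvalues. By the variational principle
(`IsShiftedInverse.finrank_le_of_form_le`) it is enough to find a space of that dimension in `S¹(Ω)`
on which `Q(u) = ∑ ‖X_ℓ u‖² - c ‖u‖²` is nonpositive. The space is `F + M + ℂE`, where `F` is the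
Dirichlet spectral subspace of `(-∞, c]`, `M = ker(N - c)` and `E` is a plane wave.

`Q ≤ 0` on `F`, and `M` is `Q`-orthogonal to all of `S¹(Ω)`. The wave is `E = exp(iη)` with a linear
functional `η` of weight one. Since `η(X_ℓ)` is homogeneous of degree zero and continuous at the
origin, it is constant, so `X_ℓ E = iη(X_ℓ(0)) E`. If `∑ η(X_ℓ(0))² = c`, then `Q(E) = 0`;
integration by parts against `S¹₀(Ω)` makes `E` `Q`-orthogonal to `F`. Hence `Q ≤ 0` on the sum
(`exists_form_le_add`).

Three facts make the sum direct and the wave admissible. (a) The codimension hypothesis provides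
infinitely many such `η`, and distinct characters are linearly independent on an open set. Some wave
therefore avoids the finite-dimensional space `F + M` (`exists_wave_notMem`). (b) Waves are square
integrable on `Ω` because a compact Neumann resolvent forces `μ Ω < ∞`
(`measure_lt_top_of_isCompactOperator`). Cutoffs at growing homogeneous scales have uniformly
bounded derivatives, whereas a compact operator is small far out; together these limit the volume
growth of `Ω`. (c) `F ∩ M = 0`: a common element, extended by zero, would have pairwise orthogonal
dilates in `L²(W)`, which is separable (`eq_zero_of_mem_sobolevZero_of_neumann`).

The value `c = λ_j(D)` is positive because an element of `S¹₀(Ω)` killed by all `X_ℓ` is invariant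
under a nonzero translation direction, hence zero (`eq_zero_of_mem_sobolevZero`). The spectral
theory is carried out on the bounded operator `T = (A + 1)⁻¹ = J J*`, with `J` the embedding of the
form domain into `L²`. -/

noncomputable section

namespace SubLaplacian

/-! ### Operators with a compact shifted inverse -/

section ShiftedInverse

variable {H : Type*} [NormedAddCommGroup H] [InnerProductSpace ℂ H]

/-- `T = (A + 1)⁻¹` is an everywhere defined symmetric operator with `0 ≤ T ≤ 1`. -/
structure IsShiftedInverse (A : H →ₗ.[ℂ] H) (T : H →L[ℂ] H) : Prop where
  mem_graph_iff : ∀ u f : H, (u, f) ∈ A.graph ↔ T (u + f) = u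
  symm : ∀ x y : H, inner ℂ (T x) y = inner ℂ x (T y)
  nonneg : ∀ x : H, 0 ≤ (inner ℂ x (T x)).re
  le_one : ∀ x : H, (inner ℂ x (T x)).re ≤ ‖x‖ ^ 2

/-- The sum of the eigenspaces with real eigenvalues in `S`. -/
def spectralSubspace (A : H →ₗ.[ℂ] H) (S : Set ℝ) : Submodule ℂ H :=
  ⨆ c : S, eigenspace A ((c : ℝ) : ℂ)

variable {A : H →ₗ.[ℂ] H} {T : H →L[ℂ] H}

namespace IsShiftedInverse

/-- Avoiding division by `1 + z` keeps the criterion valid at `z = -1`, where it forces `u = 0`. -/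
theorem mem_eigenspace_iff (h : IsShiftedInverse A T) {z : ℂ} {u : H} :
    u ∈ eigenspace A z ↔ (1 + z) • T u = u := by
  have : u ∈ eigenspace A z ↔ (u, z • u) ∈ A.graph := Iff.rfl
  rw [this, h.mem_graph_iff, map_add, map_smul, add_smul, one_smul]

/-- `T x = 0` puts `(0, x)` in the graph of `A`, and the graph is single-valued. -/
theorem eq_zero_of_apply_eq_zero (h : IsShiftedInverse A T) {x : H} (hx : T x = 0) : x = 0 := by
  have : ((0 : H), x) ∈ A.graph := by rw [h.mem_graph_iff]; simpa using hx
  exact LinearPMap.graph_fst_eq_zero_snd A this rfl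

theorem apply_of_mem_eigenspace (h : IsShiftedInverse A T) {z : ℂ} (hz : 1 + z ≠ 0) {u : H}
    (hu : u ∈ eigenspace A z) : T u = (1 + z)⁻¹ • u := by
  rw [h.mem_eigenspace_iff] at hu
  rw [eq_inv_smul_iff₀ hz, hu]

theorem mem_eigenspace_of_apply (h : IsShiftedInverse A T) {k : ℂ} (hk : k ≠ 0) {u : H}
    (hu : T u = k • u) : u ∈ eigenspace A (k⁻¹ - 1) := by
  rw [h.mem_eigenspace_iff, hu, smul_smul]
  simp [hk]

/-- Symmetry of `T` makes `(1 + z)⁻¹` real, and `0 ≤ T ≤ 1` places it in `[0, 1]`. -/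
theorem eigenvalue_real_nonneg (h : IsShiftedInverse A T) {z : ℂ} {u : H}
    (hu : u ∈ eigenspace A z) (hu0 : u ≠ 0) : 0 ≤ z.re ∧ (z.re : ℂ) = z := by
  have h1 := (h.mem_eigenspace_iff).1 hu
  have hz : 1 + z ≠ 0 := by
    intro hz; rw [hz, zero_smul] at h1; exact hu0 h1.symm
  have h2 := h.apply_of_mem_eigenspace hz hu
  have hn : (0 : ℝ) < ‖u‖ ^ 2 := by positivity
  have h3 := h.symm u u
  rw [h2, inner_smul_left, inner_smul_right, inner_self_eq_norm_sq_to_K] at h3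
  have h4 : (starRingEnd ℂ) (1 + z)⁻¹ = (1 + z)⁻¹ := by
    refine mul_right_cancel₀ ?_ h3
    simpa using hu0
  have h5 : (starRingEnd ℂ) (1 + z) = 1 + z := by
    rw [map_inv₀] at h4; exact inv_injective h4
  have h6 : ((z.re : ℝ) : ℂ) = z := by
    rw [map_add, map_one] at h5
    exact Complex.conj_eq_iff_re.1 (add_left_cancel h5)
  refine ⟨?_, h6⟩
  have h7 := h.nonneg u
  have h8 := h.le_one u
  have h9 : (inner ℂ u (T u)).re = (1 + z.re)⁻¹ * ‖u‖ ^ 2 := by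
    have : (1 + z)⁻¹ * ((‖u‖ : ℂ)) ^ 2 = (((1 + z.re)⁻¹ * ‖u‖ ^ 2 : ℝ) : ℂ) := by
      push_cast; rw [h6]
    rw [h2, inner_smul_right, inner_self_eq_norm_sq_to_K]
    exact (congrArg Complex.re this).trans (Complex.ofReal_re _)
  rw [h9] at h7 h8
  have h10 : 0 ≤ (1 + z.re)⁻¹ := by
    by_contra hc; push Not at hc; nlinarith
  have h11 : (1 + z.re)⁻¹ ≤ 1 := by
    by_contra hc; push Not at hc; nlinarith
  have h12 : 0 ≤ 1 + z.re := inv_nonneg.1 h10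
  have h13 : 1 + z.re ≠ 0 := by
    intro h0; apply hz; rw [← h6]; exact_mod_cast h0
  have h14 : 0 < 1 + z.re := lt_of_le_of_ne h12 (Ne.symm h13)
  have := (inv_le_one₀ h14).1 h11
  linarith

theorem eigenspace_eq_bot_of_neg (h : IsShiftedInverse A T) {c : ℝ} (hc : c < 0) :
    eigenspace A (c : ℂ) = ⊥ := by
  rw [Submodule.eq_bot_iff]
  intro u hu
  by_contra h0
  have := (h.eigenvalue_real_nonneg hu h0).1
  simp at this; linarith

theorem orthogonalFamily (h : IsShiftedInverse A T) :
    OrthogonalFamily ℂ (fun c : ℝ => eigenspace A (c : ℂ))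
      fun c => (eigenspace A (c : ℂ)).subtypeₗᵢ := by
  intro c d hcd u v
  have hu := (h.mem_eigenspace_iff).1 u.2
  have hv := (h.mem_eigenspace_iff).1 v.2
  change inner ℂ (u : H) (v : H) = 0
  have h1 : (1 + (d : ℂ)) * inner ℂ (u : H) (v : H) = (1 + (c : ℂ)) * inner ℂ (u : H) (v : H) := by
    have e1 : inner ℂ (u : H) (v : H) = (1 + (c : ℂ)) * inner ℂ (T u) (v : H) := by
      conv_lhs => rw [← hu]
      rw [inner_smul_left]; simp
    have e2 : inner ℂ (u : H) (v : H) = (1 + (d : ℂ)) * inner ℂ (u : H) (T v) := by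
      conv_lhs => rw [← hv]
      rw [inner_smul_right]
    rw [h.symm] at e1
    conv_lhs => rw [e1]
    conv_rhs => rw [e2]
    ring
  have h2 : ((d : ℂ) - c) * inner ℂ (u : H) (v : H) = 0 := by linear_combination h1
  rcases mul_eq_zero.1 h2 with h3 | h3
  · exact absurd (by exact_mod_cast (sub_eq_zero.1 h3).symm) hcd
  · exact h3

theorem exists_sum_of_mem_spectralSubspace {S : Set ℝ} {u : H} (hu : u ∈ spectralSubspace A S) :
    ∃ (s : Finset ℝ) (f : ∀ c : ℝ, eigenspace A (c : ℂ)), ↑s ⊆ S ∧ u = ∑ c ∈ s, (f c : H) := by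
  classical
  induction hu using Submodule.iSup_induction' with
  | mem i x hx =>
    refine ⟨{(i : ℝ)}, Function.update 0 (i : ℝ) ⟨x, hx⟩, by simp, by simp⟩
  | zero => exact ⟨∅, 0, by simp, by simp⟩
  | add x y _ _ hx hy =>
    obtain ⟨s, f, hs, rfl⟩ := hx
    obtain ⟨t, g, ht, rfl⟩ := hy
    refine ⟨s ∪ t, fun c => (if c ∈ s then f c else 0) + (if c ∈ t then g c else 0), ?_, ?_⟩
    · rw [Finset.coe_union]; exact Set.union_subset hs ht
    · simp only [Submodule.coe_add, Finset.sum_add_distrib]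
      congr 1
      · rw [← Finset.sum_subset (Finset.subset_union_left (s₂ := t))]
        · exact Finset.sum_congr rfl fun c hc => by rw [if_pos hc]
        · intro c _ hc; rw [if_neg hc]; rfl
      · rw [← Finset.sum_subset (Finset.subset_union_right (s₁ := s))]
        · exact Finset.sum_congr rfl fun c hc => by rw [if_pos hc]
        · intro c _ hc; rw [if_neg hc]; rfl

theorem inner_sum_smul (h : IsShiftedInverse A T) (s : Finset ℝ)
    (f : ∀ c : ℝ, eigenspace A (c : ℂ)) (k : ℝ → ℝ) :
    inner ℂ (∑ c ∈ s, (f c : H)) (∑ c ∈ s, (k c : ℂ) • (f c : H)) =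
      ((∑ c ∈ s, k c * ‖(f c : H)‖ ^ 2 : ℝ) : ℂ) := by
  refine (h.orthogonalFamily.inner_sum f (fun c => (k c : ℂ) • f c) s).trans ?_
  push_cast
  refine Finset.sum_congr rfl fun c _ => ?_
  rw [inner_smul_right, inner_self_eq_norm_sq_to_K]
  rfl

theorem norm_sq_sum (h : IsShiftedInverse A T) (s : Finset ℝ)
    (f : ∀ c : ℝ, eigenspace A (c : ℂ)) :
    ‖∑ c ∈ s, (f c : H)‖ ^ 2 = ∑ c ∈ s, ‖(f c : H)‖ ^ 2 := by
  simpa using h.orthogonalFamily.norm_sum f s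

/-- On the spectral subspace of `[0, c]` one has `T ≥ (1 + c)⁻¹`. -/
theorem le_inner_of_mem_spectralSubspace (h : IsShiftedInverse A T) {c : ℝ} {u : H}
    (hu : u ∈ spectralSubspace A (Set.Icc 0 c)) :
    (1 + c)⁻¹ * ‖u‖ ^ 2 ≤ (inner ℂ u (T u)).re := by
  obtain ⟨s, f, hs, rfl⟩ := exists_sum_of_mem_spectralSubspace hu
  have h1 : T (∑ d ∈ s, (f d : H)) = ∑ d ∈ s, (((1 + d)⁻¹ : ℝ) : ℂ) • (f d : H) := by
    rw [map_sum]
    refine Finset.sum_congr rfl fun d hd => ?_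
    have hd' := (hs hd).1
    rw [h.apply_of_mem_eigenspace _ (f d).2]
    · push_cast; rfl
    · exact_mod_cast (by linarith : (0 : ℝ) < 1 + d).ne'
  rw [h1, h.inner_sum_smul, h.norm_sq_sum, Complex.ofReal_re, Finset.mul_sum]
  refine Finset.sum_le_sum fun d hd => ?_
  have hd' := hs hd
  gcongr
  · linarith [hd'.1]
  · exact hd'.2

/-- Negative numbers contribute nothing; on `[0, c]` the factors `1 + d` are positive and can be
inverted. -/
theorem spectralSubspace_Iic (h : IsShiftedInverse A T) (c : ℝ) :
    spectralSubspace A (Set.Iic c) = spectralSubspace A (Set.Icc 0 c) := by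
  apply le_antisymm
  · refine iSup_le fun d => ?_
    by_cases hd : (d : ℝ) < 0
    · rw [h.eigenspace_eq_bot_of_neg hd]; exact bot_le
    · exact le_iSup (fun e : Set.Icc 0 c => eigenspace A ((e : ℝ) : ℂ)) ⟨d, not_lt.1 hd, d.2⟩
  · refine iSup_le fun d => ?_
    exact le_iSup (fun e : Set.Iic c => eigenspace A ((e : ℝ) : ℂ)) ⟨d, d.2.2⟩

theorem eigenspace_le_spectralSubspace {S : Set ℝ} {c : ℝ} (hc : c ∈ S) :
    eigenspace A (c : ℂ) ≤ spectralSubspace A S :=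
  le_iSup (fun e : S => eigenspace A ((e : ℝ) : ℂ)) ⟨c, hc⟩

theorem apply_mem_spectralSubspace (h : IsShiftedInverse A T) {S : Set ℝ} (hS : S ⊆ Set.Ici 0)
    {u : H} (hu : u ∈ spectralSubspace A S) : T u ∈ spectralSubspace A S := by
  obtain ⟨s, f, hs, rfl⟩ := exists_sum_of_mem_spectralSubspace hu
  rw [map_sum]
  refine Submodule.sum_mem _ fun d hd => eigenspace_le_spectralSubspace (hs hd) ?_
  rw [h.apply_of_mem_eigenspace _ (f d).2]
  · exact Submodule.smul_mem _ _ (f d).2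
  · have : (0 : ℝ) ≤ d := hS (hs hd)
    exact_mod_cast (by linarith : (0 : ℝ) < 1 + d).ne'

/-- An eigenvector of `T` for `k` is one of `A` for `k⁻¹ - 1`. Orthogonality to every eigenspace up
to `c` forces `k⁻¹ - 1 > c`. -/
theorem norm_eigenvalue_lt (h : IsShiftedInverse A T) {c : ℝ} (hc : 0 ≤ c) {k : ℂ} (hk : k ≠ 0)
    {v : H} (hv : T v = k • v) (hv0 : v ≠ 0) (hv' : v ∈ (spectralSubspace A (Set.Iic c))ᗮ) :
    ‖k‖ < (1 + c)⁻¹ := by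
  have hmem := h.mem_eigenspace_of_apply hk hv
  obtain ⟨h1, h2⟩ := h.eigenvalue_real_nonneg hmem hv0
  generalize (k⁻¹ - 1).re = d at h1 h2
  have hk3 : k = ((1 + d : ℝ) : ℂ)⁻¹ := by
    push_cast; rw [h2]; simp
  have hd : c < d := by
    by_contra hcd
    push Not at hcd
    rw [← h2] at hmem
    have := hv' _ (eigenspace_le_spectralSubspace (S := Set.Iic c) hcd hmem)
    rw [inner_self_eq_zero] at this
    exact hv0 this
  rw [hk3, norm_inv, Complex.norm_real, Real.norm_of_nonneg (by linarith)]
  gcongr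

variable [CompleteSpace H]

/-- On the closure of the spectral subspace the compact operator `T` is still bounded below by `(1 +
c)⁻¹`. The unit ball is thus uniformly equivalent to a totally bounded image, and Riesz's theorem
applies. The closure is taken only to have completeness. -/
theorem finiteDimensional_spectralSubspace (h : IsShiftedInverse A T) (hT : IsCompactOperator T)
    (c : ℝ) : FiniteDimensional ℂ (spectralSubspace A (Set.Iic c)) := by
  rw [h.spectralSubspace_Iic]
  rcases lt_or_ge c 0 with hc | hc
  · have : spectralSubspace A (Set.Icc 0 c) = ⊥ := by
      have : IsEmpty (Set.Icc 0 c) := Set.isEmpty_coe_sort.2 (Set.Icc_eq_empty (not_le.2 hc))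
      simp [spectralSubspace]
    rw [this]; infer_instance
  set E := spectralSubspace A (Set.Icc 0 c) with hE
  set K := E.topologicalClosure with hK
  have hpos : 0 < (1 + c)⁻¹ := by positivity
  have hle : ∀ x ∈ K, (1 + c)⁻¹ * ‖x‖ ^ 2 ≤ (inner ℂ x (T x)).re := by
    have hcl : IsClosed {x : H | (1 + c)⁻¹ * ‖x‖ ^ 2 ≤ (inner ℂ x (T x)).re} := by
      apply isClosed_le <;> fun_prop
    exact fun x hx => (closure_minimal (s := (E : Set H))
      (fun x hx => h.le_inner_of_mem_spectralSubspace hx) hcl) hx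
  have hle' : ∀ x ∈ K, ‖x‖ ≤ (1 + c) * ‖T x‖ := by
    intro x hx
    have h1 := hle x hx
    have h2 : (inner ℂ x (T x)).re ≤ ‖x‖ * ‖T x‖ := re_inner_le_norm (𝕜 := ℂ) x (T x)
    rcases eq_or_ne x 0 with rfl | hx0
    · simp
    have h3 : 0 < ‖x‖ := norm_pos_iff.2 hx0
    have h4 : (1 + c)⁻¹ * ‖x‖ ≤ ‖T x‖ := by
      refine le_of_mul_le_mul_right ?_ h3
      nlinarith
    rwa [inv_mul_le_iff₀ (by positivity)] at h4
  have hKc : CompleteSpace K := (Submodule.isClosed_topologicalClosure E).completeSpace_coe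
  have hanti : AntilipschitzWith (⟨1 + c, by positivity⟩) (T ∘L K.subtypeL) := by
    refine AddMonoidHomClass.antilipschitz_of_bound _ fun x => ?_
    exact hle' x x.2
  have hfin : FiniteDimensional ℂ K := by
    refine FiniteDimensional.of_isCompact_closedBall₀ ℂ (zero_lt_one' ℝ) ?_
    refine TotallyBounded.isCompact_of_isClosed ?_ Metric.isClosed_closedBall
    have hind : IsUniformInducing (T ∘L K.subtypeL) :=
      hanti.isUniformInducing (T ∘L K.subtypeL).uniformContinuous
    rw [← totallyBounded_image_iff hind]
    have hcomp : IsCompactOperator (T ∘L K.subtypeL) := hT.comp_clm K.subtypeL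
    obtain ⟨C, hC, hC'⟩ := hcomp.image_closedBall_subset_compact (𝕜₁ := ℂ)
      (f := ((T ∘L K.subtypeL : K →L[ℂ] H) : K →ₗ[ℂ] H)) 1
    exact hC.totallyBounded.subset hC'
  exact Submodule.finiteDimensional_of_le (Submodule.le_topologicalClosure E)

/-- The norm of a compact symmetric operator is controlled by its eigenvalues. -/
theorem norm_lt_of_hasEigenvalue {S : H →L[ℂ] H} (hS : IsCompactOperator S)
    (hsymm : (S : H →ₗ[ℂ] H).IsSymmetric) {c : ℝ} (hc : 0 < c)
    (h : ∀ k : ℂ, k ≠ 0 → Module.End.HasEigenvalue (S : H →ₗ[ℂ] H) k → ‖k‖ < c) : ‖S‖ < c := by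
  rcases subsingleton_or_nontrivial H with hH | hH
  · rw [Subsingleton.elim S 0, norm_zero]; exact hc
  -- The norm of a selfadjoint operator is its spectral radius, attained at some `k`. Attainment
  -- gives the strict inequality, and by compactness `k ≠ 0` is an eigenvalue.
  obtain ⟨k, hk, hk'⟩ := spectrum.exists_nnnorm_eq_spectralRadius S
  rw [S.spectralRadius_eq_nnnorm hsymm.isSelfAdjoint] at hk'
  have hk2 : ‖k‖ = ‖S‖ := by
    have : ‖k‖₊ = ‖S‖₊ := by exact_mod_cast hk'
    exact congrArg NNReal.toReal this
  rw [← hk2]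
  by_cases hk0 : k = 0
  · rwa [hk0, norm_zero]
  exact h k hk0 ((hS.hasEigenvalue_iff_mem_spectrum hk0).2 hk)

/-- Orthogonally to the spectral subspace of `(-∞, c]` one has `T < (1 + c)⁻¹`. -/
theorem inner_lt_of_mem_orthogonal (h : IsShiftedInverse A T) (hT : IsCompactOperator T)
    {c : ℝ} (hc : 0 ≤ c) {u : H} (hu : u ∈ (spectralSubspace A (Set.Iic c))ᗮ) (hu0 : u ≠ 0) :
    (inner ℂ u (T u)).re < (1 + c)⁻¹ * ‖u‖ ^ 2 := by
  set E := spectralSubspace A (Set.Iic c) with hE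
  have hinv : ∀ v ∈ Eᗮ, T v ∈ Eᗮ := by
    intro v hv w hw
    rw [← h.symm]
    refine hv _ ?_
    rw [hE, h.spectralSubspace_Iic] at hw ⊢
    exact h.apply_mem_spectralSubspace Set.Icc_subset_Ici_self hw
  let S : Eᗮ →L[ℂ] Eᗮ := T.restrict hinv
  have hScomp : IsCompactOperator S := hT.restrict' hinv
  have hSsymm : (S : Eᗮ →ₗ[ℂ] Eᗮ).IsSymmetric := fun x y => h.symm x y
  have hnorm : ‖S‖ < (1 + c)⁻¹ := by
    refine norm_lt_of_hasEigenvalue hScomp hSsymm (by positivity) fun k hk0 hev => ?_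
    obtain ⟨v, hv⟩ := hev.exists_hasEigenvector
    have hv1 : T (v : H) = k • (v : H) := congrArg Subtype.val hv.apply_eq_smul
    have hv0 : (v : H) ≠ 0 := fun h0 => hv.2 (Subtype.ext h0)
    exact h.norm_eigenvalue_lt hc hk0 hv1 hv0 v.2
  have h1 : (inner ℂ u (T u)).re ≤ ‖u‖ * ‖T u‖ := re_inner_le_norm (𝕜 := ℂ) u (T u)
  have h2 : ‖T u‖ ≤ ‖S‖ * ‖u‖ := S.le_opNorm ⟨u, hu⟩
  have h3 : 0 < ‖u‖ := norm_pos_iff.2 hu0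
  calc _ ≤ ‖u‖ * ‖T u‖ := h1
    _ ≤ ‖u‖ * (‖S‖ * ‖u‖) := by gcongr
    _ = ‖S‖ * ‖u‖ ^ 2 := by ring
    _ < _ := by gcongr

/-- The spectral theorem for the compact symmetric operator `T`, read through the correspondence of
eigenspaces; injectivity of `T` removes the eigenvalue `0`. -/
theorem orthogonal_spectralSubspace_univ (h : IsShiftedInverse A T) (hT : IsCompactOperator T) :
    (spectralSubspace A Set.univ)ᗮ = ⊥ := by
  have h1 := ContinuousLinearMap.orthogonalComplement_iSup_eigenspaces_eq_bot hT
    (fun x y => h.symm x y)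
  rw [← h1]
  congr 1
  apply le_antisymm
  · refine iSup_le fun c => ?_
    by_cases hc : (c : ℝ) < 0
    · rw [h.eigenspace_eq_bot_of_neg hc]; exact bot_le
    refine le_trans ?_ (le_iSup _ ((1 + ((c : ℝ) : ℂ))⁻¹))
    intro u hu
    rw [Module.End.mem_eigenspace_iff]
    refine h.apply_of_mem_eigenspace ?_ hu
    exact_mod_cast (by linarith : (0 : ℝ) < 1 + c).ne'
  · refine iSup_le fun k => ?_
    intro u hu
    rw [Module.End.mem_eigenspace_iff] at hu
    by_cases hu0 : u = 0
    · rw [hu0]; exact zero_mem _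
    have hk : k ≠ 0 := by
      rintro rfl
      rw [zero_smul] at hu
      exact hu0 (h.eq_zero_of_apply_eq_zero hu)
    have hmem := h.mem_eigenspace_of_apply hk hu
    obtain ⟨_, h2⟩ := h.eigenvalue_real_nonneg hmem hu0
    rw [← h2] at hmem
    exact eigenspace_le_spectralSubspace (Set.mem_univ _) hmem

end IsShiftedInverse

end ShiftedInverse

/-! ### Enumeration and counting of eigenvalues -/

section Counting

/-- An infinite family of positive multiplicities with locally finite support, bounded below,
can be enumerated in nondecreasing order. -/
theorem exists_monotone_enumeration (n : ℝ → ℕ) (hfin : ∀ c : ℝ, {x | x ≤ c ∧ n x ≠ 0}.Finite)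
    (hinf : {x | n x ≠ 0}.Infinite) :
    ∃ a : ℕ → ℝ, Monotone a ∧ Tendsto a atTop atTop ∧
      ∀ x : ℝ, {j : ℕ | a j = x}.Finite ∧ {j : ℕ | a j = x}.ncard = n x := by
  classical
  let S := {x : ℝ | n x ≠ 0}
  -- One point per value and per unit of multiplicity, ordered lexicographically. Initial segments
  -- are finite and there is no largest element, so the order type is that of `ℕ`.
  let ι := Σₗ x : S, Fin (n x)
  have hIic : ∀ i : ι, (Set.Iic i).Finite := by
    intro i
    have h1 : {x : S | (x : ℝ) ≤ (ofLex i).1}.Finite := by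
      refine Set.Finite.of_finite_image (f := Subtype.val) ?_ Subtype.val_injective.injOn
      refine (hfin (ofLex i).1).subset ?_
      rintro _ ⟨x, hx, rfl⟩
      exact ⟨hx, x.2⟩
    refine (h1.biUnion fun x _ =>
      Set.finite_range fun k : Fin (n x) => (toLex ⟨x, k⟩ : ι)).subset ?_
    intro j hj
    have hj' : j ≤ i := hj
    simp only [Set.mem_iUnion]
    refine ⟨(ofLex j).1, ?_, (ofLex j).2, rfl⟩
    change ((ofLex j).1 : ℝ) ≤ (ofLex i).1
    rcases (Sigma.Lex.le_def).1 hj' with h | ⟨h, _⟩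
    · exact (show ((ofLex j).1 : ℝ) < (ofLex i).1 from h).le
    · exact (congrArg Subtype.val h).le
  have hinfι : Infinite ι := by
    have : Infinite S := hinf.to_subtype
    refine Infinite.of_injective
      (fun x : S => (toLex ⟨x, ⟨0, Nat.pos_of_ne_zero x.2⟩⟩ : ι)) fun x y hxy => ?_
    exact congrArg (fun i : ι => (ofLex i).1) hxy
  let _ : LocallyFiniteOrder ι := LocallyFiniteOrder.ofFiniteIcc fun i j =>
    (hIic j).subset Set.Icc_subset_Iic_self
  let _ : SuccOrder ι := LinearLocallyFiniteOrder.succOrder ι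
  let _ : PredOrder ι := LinearLocallyFiniteOrder.predOrder ι
  have : NoMaxOrder ι := ⟨fun i => by
    by_contra hc
    have hle : ∀ j, j ≤ i := fun j => not_lt.1 fun h => hc ⟨j, h⟩
    have : (Set.univ : Set ι).Finite := (hIic i).subset fun j _ => hle j
    exact Set.infinite_univ this⟩
  have hbot : ∃ b : ι, ∀ i, b ≤ i := by
    obtain ⟨i⟩ : Nonempty ι := inferInstance
    obtain ⟨b, hb, hb'⟩ := Set.exists_min_image (Set.Iic i) id (hIic i) ⟨i, le_refl i⟩
    refine ⟨b, fun j => ?_⟩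
    rcases le_total j i with h | h
    · exact hb' j h
    · exact le_trans hb h
  obtain ⟨b, hb⟩ := hbot
  let _ : OrderBot ι := { bot := b, bot_le := hb }
  let e : ι ≃o ℕ := orderIsoNatOfLinearSuccPredArch
  have hmono : Monotone fun j : ℕ => ((ofLex (e.symm j)).1 : ℝ) := by
    intro j k hjk
    rcases (Sigma.Lex.le_def).1 (e.symm.monotone hjk) with h | ⟨h, _⟩
    · exact (show ((ofLex (e.symm j)).1 : ℝ) < (ofLex (e.symm k)).1 from h).le
    · exact (congrArg Subtype.val h).le
  have hfib : ∀ (x : S), {j : ℕ | ((ofLex (e.symm j)).1 : ℝ) = x} =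
      Set.range fun k : Fin (n x) => e (toLex ⟨x, k⟩) := by
    intro x
    ext j
    simp only [Set.mem_ofPred_eq, Set.mem_range]
    constructor
    · intro hj
      have hj' : (ofLex (e.symm j)).1 = x := Subtype.ext hj
      obtain ⟨⟨y, k⟩, hk⟩ : ∃ s : Σ x : S, Fin (n x), s = ofLex (e.symm j) := ⟨_, rfl⟩
      rw [← hk] at hj'
      simp only at hj'
      subst hj'
      refine ⟨k, ?_⟩
      rw [hk, toLex_ofLex, OrderIso.apply_symm_apply]
    · rintro ⟨k, rfl⟩
      rw [OrderIso.symm_apply_apply]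
      rfl
  have hinj : ∀ x : S, Function.Injective fun k : Fin (n x) => e (toLex ⟨x, k⟩) := by
    intro x k l hkl
    have := toLex.injective (e.injective hkl)
    simpa using this
  have hfibfin : ∀ x : ℝ, {j : ℕ | ((ofLex (e.symm j)).1 : ℝ) = x}.Finite ∧
      {j : ℕ | ((ofLex (e.symm j)).1 : ℝ) = x}.ncard = n x := by
    intro x
    by_cases hx : n x = 0
    · have : {j : ℕ | ((ofLex (e.symm j)).1 : ℝ) = x} = ∅ := by
        rw [Set.eq_empty_iff_forall_notMem]
        intro j hj
        exact (ofLex (e.symm j)).1.2 (by rw [hj, hx])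
      rw [this, hx]; simp
    · have := hfib ⟨x, hx⟩
      simp only at this
      rw [this]
      refine ⟨Set.finite_range _, ?_⟩
      rw [← Set.image_univ, Set.ncard_image_of_injective _ (hinj ⟨x, hx⟩), Set.ncard_univ]
      simp
  refine ⟨fun j => (ofLex (e.symm j)).1, hmono, ?_, hfibfin⟩
  refine hmono.tendsto_atTop_atTop fun c => ?_
  by_contra hc
  push Not at hc
  have : (Set.univ : Set ℕ) ⊆ ⋃ x ∈ {x | x ≤ c ∧ n x ≠ 0},
      {j : ℕ | ((ofLex (e.symm j)).1 : ℝ) = x} := by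
    intro j _
    simp only [Set.mem_iUnion]
    exact ⟨_, ⟨(hc j).le, (ofLex (e.symm j)).1.2⟩, rfl⟩
  exact Set.infinite_univ (((hfin c).biUnion fun x _ => (hfibfin x).1).subset this)

variable {H : Type*} [NormedAddCommGroup H] [InnerProductSpace ℂ H]
variable {A : H →ₗ.[ℂ] H} {T : H →L[ℂ] H}

theorem IsEigenvalueSequence.finite_le {a : ℕ → ℝ} (ha : IsEigenvalueSequence A a) (c : ℝ) :
    {k : ℕ | a k ≤ c}.Finite := by
  obtain ⟨N, hN⟩ := (ha.tendsto.eventually_gt_atTop c).exists_forall_of_atTop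
  refine (Set.finite_lt_nat N).subset fun k hk => ?_
  by_contra h
  exact absurd hk (not_le.2 (hN k (not_lt.1 h)))

theorem IsEigenvalueSequence.finrank_eigenspace {a : ℕ → ℝ} (ha : IsEigenvalueSequence A a)
    (c : ℝ) : Module.finrank ℂ (eigenspace A (c : ℂ)) = {k : ℕ | a k = c}.ncard := by
  rw [ha.multiplicity]
  congr 1
  ext k
  simp

theorem IsEigenvalueSequence.eigenspace_ne_bot {a : ℕ → ℝ} (ha : IsEigenvalueSequence A a)
    (k : ℕ) : eigenspace A (a k : ℂ) ≠ ⊥ := by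
  intro h
  have h1 := ha.finrank_eigenspace (a k)
  rw [h, finrank_bot] at h1
  have h2 : {j : ℕ | a j = a k}.Finite := (ha.finite_le (a k)).subset fun j hj => le_of_eq hj
  exact (Set.ncard_pos h2).2 ⟨k, rfl⟩ |>.ne h1

/-- The dimension of a sum of pairwise orthogonal eigenspaces. -/
theorem IsShiftedInverse.finrank_iSup_finset (h : IsShiftedInverse A T) (s : Finset ℝ)
    (hfin : ∀ c : ℝ, FiniteDimensional ℂ (eigenspace A (c : ℂ))) :
    Module.finrank ℂ (⨆ c : s, eigenspace A ((c : ℝ) : ℂ) : Submodule ℂ H) =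
      ∑ c ∈ s, Module.finrank ℂ (eigenspace A (c : ℂ)) := by
  classical
  have hind : iSupIndep fun c : s => eigenspace A ((c : ℝ) : ℂ) :=
    h.orthogonalFamily.independent.comp Subtype.val_injective
  rw [Submodule.iSup_eq_range_dfinsupp_lsum,
    LinearMap.finrank_range_of_inj hind.dfinsupp_lsum_injective, ← Finset.sum_coe_sort s]
  exact Module.finrank_directSum (R := ℂ) fun c : s => eigenspace A ((c : ℝ) : ℂ)

/-- Translates dimensions into numbers of indices. Only the finitely many values of `a` up to `c`
have nonzero eigenspaces; the indices are then grouped by value. -/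
theorem IsShiftedInverse.finrank_spectralSubspace_Iic (h : IsShiftedInverse A T) {a : ℕ → ℝ}
    (ha : IsEigenvalueSequence A a) (c : ℝ) :
    Module.finrank ℂ (spectralSubspace A (Set.Iic c)) = {k : ℕ | a k ≤ c}.ncard := by
  classical
  set t := (ha.finite_le c).toFinset with ht
  have h1 : spectralSubspace A (Set.Iic c) =
      ⨆ d : (t.image a : Finset ℝ), eigenspace A ((d : ℝ) : ℂ) := by
    apply le_antisymm
    · refine iSup_le fun d => ?_
      by_cases hd : (d : ℝ) ∈ t.image a
      · exact le_iSup (fun d : (t.image a : Finset ℝ) => eigenspace A ((d : ℝ) : ℂ)) ⟨d, hd⟩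
      · have hfd := ha.finite d
        have : eigenspace A ((d : ℝ) : ℂ) = ⊥ := by
          rw [← Submodule.finrank_eq_zero (R := ℂ), ha.finrank_eigenspace]
          convert Set.ncard_empty ℕ
          rw [Set.eq_empty_iff_forall_notMem]
          intro k hk
          refine hd (Finset.mem_image.2 ⟨k, ?_, hk⟩)
          rw [ht, Set.Finite.mem_toFinset]
          exact (le_of_eq hk).trans d.2
        rw [this]; exact bot_le
    · refine iSup_le fun d => IsShiftedInverse.eigenspace_le_spectralSubspace ?_
      obtain ⟨k, hk, hk'⟩ := Finset.mem_image.1 d.2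
      rw [ht, Set.Finite.mem_toFinset] at hk
      rw [← hk']; exact hk
  rw [h1, h.finrank_iSup_finset _ fun d => ha.finite d, Set.ncard_eq_toFinset_card _ (ha.finite_le c),
    Finset.card_eq_sum_card_image a]
  refine Finset.sum_congr rfl fun d hd => ?_
  rw [ha.finrank_eigenspace, ← Set.ncard_coe_finset]
  congr 1
  ext k
  obtain ⟨l, hl, hl'⟩ := Finset.mem_image.1 hd
  rw [Set.Finite.mem_toFinset] at hl
  simp only [Set.mem_ofPred_eq, Finset.coe_filter, Set.Finite.mem_toFinset]
  constructor
  · intro hk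
    exact ⟨hk.le.trans (hl'.symm.le.trans hl), hk⟩
  · exact fun hk => hk.2

variable [CompleteSpace H]

/-- A self-adjoint operator bounded below with compact resolvent on an infinite-dimensional space
has a sequence of eigenvalues. -/
theorem IsShiftedInverse.exists_isEigenvalueSequence (h : IsShiftedInverse A T)
    (hT : IsCompactOperator T) (hH : ¬ FiniteDimensional ℂ H) :
    ∃ a : ℕ → ℝ, IsEigenvalueSequence A a := by
  have hfd : ∀ c : ℝ, FiniteDimensional ℂ (eigenspace A (c : ℂ)) := fun c => by
    have := h.finiteDimensional_spectralSubspace hT c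
    exact Submodule.finiteDimensional_of_le
      (IsShiftedInverse.eigenspace_le_spectralSubspace (Set.self_mem_Iic (a := c)))
  have hrank : ∀ c : ℝ, Module.finrank ℂ (eigenspace A (c : ℂ)) ≠ 0 ↔ eigenspace A (c : ℂ) ≠ ⊥ :=
    fun c => by
      have := hfd c
      rw [Ne, Submodule.finrank_eq_zero]
  obtain ⟨a, ha, ha', hn⟩ := exists_monotone_enumeration
    (fun c => Module.finrank ℂ (eigenspace A (c : ℂ))) (fun c => by
      have := h.finiteDimensional_spectralSubspace hT c
      -- Each eigenvalue up to `c` contributes at least one dimension to the finite-dimensional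
      -- spectral subspace, so there cannot be infinitely many.
      by_contra hinf
      obtain ⟨s, hs, hs'⟩ := Set.Infinite.exists_subset_card_eq hinf
        (Module.finrank ℂ (spectralSubspace A (Set.Iic c)) + 1)
      have h1 : (⨆ d : s, eigenspace A ((d : ℝ) : ℂ)) ≤ spectralSubspace A (Set.Iic c) :=
        iSup_le fun d => IsShiftedInverse.eigenspace_le_spectralSubspace (hs d.2).1
      have h2 := Submodule.finrank_mono h1
      rw [h.finrank_iSup_finset s hfd] at h2
      have h3 : ∑ d ∈ s, 1 ≤ ∑ d ∈ s, Module.finrank ℂ (eigenspace A (d : ℂ)) :=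
        Finset.sum_le_sum fun d hd => Nat.one_le_iff_ne_zero.2 (hs hd).2
      rw [Finset.sum_const, smul_eq_mul, mul_one, hs'] at h3
      omega) (by
      intro hfin
      -- With finitely many eigenvalues the total spectral subspace would be finite-dimensional with
      -- trivial orthogonal complement, hence all of `H`.
      have hle : spectralSubspace A Set.univ =
          ⨆ c : hfin.toFinset, eigenspace A ((c : ℝ) : ℂ) := by
        apply le_antisymm
        · refine iSup_le fun c => ?_
          by_cases hc : (c : ℝ) ∈ hfin.toFinset
          · exact le_iSup (fun c : hfin.toFinset => eigenspace A ((c : ℝ) : ℂ)) ⟨c, hc⟩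
          · rw [Set.Finite.mem_toFinset, Set.mem_ofPred_eq, hrank, not_not] at hc
            rw [hc]; exact bot_le
        · exact iSup_le fun c => IsShiftedInverse.eigenspace_le_spectralSubspace (Set.mem_univ _)
      have hfdim : FiniteDimensional ℂ (spectralSubspace A Set.univ) := by
        rw [hle]; infer_instance
      have htop : spectralSubspace A Set.univ = ⊤ := by
        rw [← Submodule.orthogonal_eq_bot_iff]
        exact h.orthogonal_spectralSubspace_univ hT
      rw [htop] at hfdim
      exact hH (Submodule.topEquiv.finiteDimensional))
  have hzero : ∀ z : ℂ, (z.re : ℂ) ≠ z → eigenspace A z = ⊥ := by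
    intro z hz
    rw [Submodule.eq_bot_iff]
    intro u hu
    by_contra hu0
    exact hz (h.eigenvalue_real_nonneg hu hu0).2
  refine ⟨a, ha, ha', fun z => ?_, fun z => ?_⟩
  · by_cases hz : (z.re : ℂ) = z
    · rw [← hz]; exact hfd _
    · rw [hzero z hz]; infer_instance
  · by_cases hz : (z.re : ℂ) = z
    · rw [← hz, ← (hn z.re).2]
      congr 1
      ext k
      simp
    · rw [hzero z hz, finrank_bot]
      symm
      convert Set.ncard_empty ℕ
      rw [Set.eq_empty_iff_forall_notMem]
      rintro k hk
      apply hz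
      rw [← show ((a k : ℝ) : ℂ) = z from hk]
      simp

end Counting

/-! ### Operators associated with quadratic forms -/

/-- An operator dominated, in a Hölder sense, by a compact operator is compact. -/
theorem isCompactOperator_of_norm_sq_le {E F G : Type*} [NormedAddCommGroup E] [NormedSpace ℂ E]
    [NormedAddCommGroup F] [NormedSpace ℂ F] [NormedAddCommGroup G] [NormedSpace ℂ G]
    [CompleteSpace G] {T : E →L[ℂ] F} {S : E →L[ℂ] G} (hT : IsCompactOperator T)
    (h : ∀ x, ‖S x‖ ^ 2 ≤ ‖x‖ * ‖T x‖) : IsCompactOperator S := by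
  have key : IsCompact (closure (S '' Metric.closedBall 0 1)) := by
    refine TotallyBounded.isCompact_of_isClosed (TotallyBounded.closure ?_) isClosed_closure
    have hTb : TotallyBounded (T '' Metric.closedBall 0 1) := by
      obtain ⟨C, hC, hC'⟩ := hT.image_closedBall_subset_compact (𝕜₁ := ℂ)
        (f := (T : E →ₗ[ℂ] F)) 1
      exact hC.totallyBounded.subset hC'
    rw [Metric.totallyBounded_iff]
    intro ε hε
    -- Points of the unit ball differ by at most `2`, so this radius gives `‖S (x - y)‖² ≤ 2 · ε² /
    -- 4 < ε²`.
    obtain ⟨t, ht, htf, hcov⟩ := Metric.finite_approx_of_totallyBounded hTb (ε ^ 2 / 4)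
      (by positivity)
    obtain ⟨t', ht', rfl⟩ := Set.subset_image_iff.1 ht
    obtain ⟨t'', ht''sub, ht''fin, ht''im⟩ := Set.exists_subset_image_finite_and.1
      ⟨T '' t', le_refl _, htf, (rfl : T '' t' = T '' t')⟩
    refine ⟨S '' t'', ht''fin.image _, ?_⟩
    rintro _ ⟨x, hx, rfl⟩
    have h1 := hcov (Set.mem_image_of_mem T hx)
    rw [ht''im] at h1
    simp only [Set.mem_iUnion, Set.mem_image, exists_prop] at h1 ⊢
    obtain ⟨_, ⟨y, hy, rfl⟩, hxy⟩ := h1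
    refine ⟨S y, ⟨y, hy, rfl⟩, ?_⟩
    rw [Metric.mem_ball, dist_eq_norm, ← map_sub] at hxy ⊢
    have h2 := h (x - y)
    have hx1 : ‖x‖ ≤ 1 := by simpa using hx
    have hy1 : ‖y‖ ≤ 1 := by simpa using ht' (ht''sub hy)
    have h3 : ‖x - y‖ ≤ 2 := (norm_sub_le x y).trans (by linarith)
    have h4 : ‖S (x - y)‖ ^ 2 < ε ^ 2 := by
      have : ‖x - y‖ * ‖T (x - y)‖ ≤ 2 * (ε ^ 2 / 4) := by gcongr
      have : 0 < ε ^ 2 := by positivity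
      linarith
    exact lt_of_pow_lt_pow_left₀ 2 hε.le h4
  exact (isCompactOperator_iff_isCompact_closure_image_closedBall (S : E →ₗ[ℂ] G) zero_lt_one).2 key

section Form

variable {H : Type*} [NormedAddCommGroup H] [InnerProductSpace ℂ H] {p : ℕ}

/-- The resolvent identity `T = R (1 - (1 + z) T)` moves compactness from an arbitrary resolvent
point `z` to `-1`. -/
theorem IsShiftedInverse.isCompactOperator {A : H →ₗ.[ℂ] H} {T : H →L[ℂ] H}
    (h : IsShiftedInverse A T)
    (hA : HasCompactResolvent A) : IsCompactOperator T := by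
  obtain ⟨z, R, ⟨_, hR⟩, hRc⟩ := hA
  have : T = R ∘L (ContinuousLinearMap.id ℂ H - (1 + z) • T) := by
    ext f
    have hg : (T f, f - T f) ∈ A.graph := by rw [h.mem_graph_iff]; simp
    obtain ⟨⟨u, hu⟩, hu1, hu2⟩ := (LinearPMap.mem_graph_iff A).1 hg
    have := hR ⟨u, hu⟩
    rw [hu2] at this
    simp only at hu1 this
    subst hu1
    simp only [ContinuousLinearMap.comp_apply, sub_apply,
      ContinuousLinearMap.id_apply, smul_apply]
    conv_lhs => rw [← this]
    congr 1
    module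
  rw [this]
  exact hRc.comp_clm _

/-- The Hilbert space `H ⊕ Hᵖ`. -/
abbrev FormAmbient (H : Type*) [NormedAddCommGroup H] [InnerProductSpace ℂ H] (p : ℕ) : Type _ :=
  WithLp 2 (H × PiLp 2 (fun _ : Fin p => H))

/-- The identification of the Hilbert space `H ⊕ Hᵖ` with `H × (Fin p → H)`. -/
def ambientMap (H : Type*) [NormedAddCommGroup H] [InnerProductSpace ℂ H] (p : ℕ) :
    FormAmbient H p →L[ℂ] H × (Fin p → H) where
  toFun x := (x.fst, fun ℓ => x.snd ℓ)
  map_add' _ _ := rfl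
  map_smul' _ _ := rfl
  cont := by fun_prop

/-- The form domain `D` with its Hilbert space structure. -/
def formSpace (D : Submodule ℂ (H × (Fin p → H))) : Submodule ℂ (FormAmbient H p) :=
  D.comap (ambientMap H p : FormAmbient H p →ₗ[ℂ] H × (Fin p → H))

/-- An element of `D` as an element of the Hilbert space `formSpace D`. -/
def formSpace.mk {D : Submodule ℂ (H × (Fin p → H))} (w : H × (Fin p → H)) (hw : w ∈ D) :
    formSpace D :=
  ⟨WithLp.toLp 2 (w.1, WithLp.toLp 2 w.2), hw⟩

/-- The embedding of the form domain into `H`. -/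
def formEmb (D : Submodule ℂ (H × (Fin p → H))) : formSpace D →L[ℂ] H :=
  (ContinuousLinearMap.fst ℂ H (Fin p → H)) ∘L (ambientMap H p) ∘L (formSpace D).subtypeL

variable {D : Submodule ℂ (H × (Fin p → H))}

theorem formEmb_mk (w : H × (Fin p → H)) (hw : w ∈ D) :
    formEmb D (formSpace.mk w hw) = w.1 := rfl

theorem formSpace_inner (x y : formSpace D) :
    inner ℂ x y = inner ℂ (formEmb D x) (formEmb D y) +
      ∑ ℓ, inner ℂ (x.1.snd ℓ) (y.1.snd ℓ) := by
  change inner ℂ x.1 y.1 = _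
  rw [WithLp.prod_inner_apply, PiLp.inner_apply]
  rfl

theorem formSpace_norm_sq (x : formSpace D) :
    ‖x‖ ^ 2 = ‖formEmb D x‖ ^ 2 + ∑ ℓ, ‖x.1.snd ℓ‖ ^ 2 := by
  change ‖x.1‖ ^ 2 = _
  rw [WithLp.prod_norm_sq_eq_of_L2, PiLp.norm_sq_eq_of_L2]
  rfl

theorem norm_formEmb_le (x : formSpace D) : ‖formEmb D x‖ ≤ ‖x‖ := by
  have h := formSpace_norm_sq x
  have h' : 0 ≤ ∑ ℓ, ‖x.1.snd ℓ‖ ^ 2 := Finset.sum_nonneg fun _ _ => by positivity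
  exact le_of_sq_le_sq (by linarith) (norm_nonneg _)

theorem formSpace_inner_self (v : formSpace D) : inner ℂ v v = ((‖v‖ ^ 2 : ℝ) : ℂ) := by
  refine (inner_self_eq_norm_sq_to_K (𝕜 := ℂ) v).trans ?_
  push_cast
  rfl

theorem formSpace_mem (x : formSpace D) : (formEmb D x, fun ℓ => x.1.snd ℓ) ∈ D := x.2

variable [CompleteSpace H]

theorem completeSpace_formSpace (hD : IsClosed (D : Set (H × (Fin p → H)))) :
    CompleteSpace (formSpace D) := by
  have : IsClosed (formSpace D : Set (FormAmbient H p)) :=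
    hD.preimage (ambientMap H p).continuous
  exact this.completeSpace_coe

variable [CompleteSpace (formSpace D)]

variable (D) in
/-- The adjoint of the embedding of the form domain. -/
def formAdj : H →L[ℂ] formSpace D :=
  ContinuousLinearMap.adjoint (𝕜 := ℂ) (E := formSpace D) (F := H) (formEmb D)

theorem inner_formAdj_right (v : formSpace D) (x : H) :
    inner ℂ v (formAdj D x) = inner ℂ (formEmb D v) x :=
  ContinuousLinearMap.adjoint_inner_right _ _ _

theorem inner_formAdj_left (x : H) (v : formSpace D) :
    inner ℂ (formAdj D x) v = inner ℂ x (formEmb D v) :=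
  ContinuousLinearMap.adjoint_inner_left _ _ _

variable (D) in
/-- The operator `(A + 1)⁻¹`, where `A` is the operator associated with the form
`∑ ℓ, ‖g ℓ‖²` on the domain `D`. -/
def formInverse : H →L[ℂ] H := formEmb D ∘L formAdj D

/-- With `J` the embedding, the operator is `J J*`. Symmetry and positivity are immediate, and `‖J‖
≤ 1` gives the upper bound. -/
theorem inner_formInverse (x y : H) :
    inner ℂ x (formInverse D y) =
      inner ℂ (formAdj D x) (formAdj D y) := by
  rw [inner_formAdj_left]; rfl

theorem re_inner_formInverse (x : H) :
    (inner ℂ x (formInverse D x)).re = ‖formAdj D x‖ ^ 2 := by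
  rw [inner_formInverse, formSpace_inner_self, Complex.ofReal_re]

theorem norm_adjoint_formEmb_le (x : H) : ‖formAdj D x‖ ≤ ‖x‖ := by
  have h1 : ‖formAdj D x‖ ^ 2 ≤ ‖formEmb D (formAdj D x)‖ * ‖x‖ := by
    rw [← re_inner_formInverse, mul_comm]
    exact re_inner_le_norm (𝕜 := ℂ) _ _
  have h2 := norm_formEmb_le (formAdj D x)
  rcases (norm_nonneg (formAdj D x)).eq_or_lt with h0 | h0
  · rw [← h0]; positivity
  · refine le_of_mul_le_mul_left ?_ h0
    nlinarith [norm_nonneg x]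

/-- The basic duality estimate between the form domain and `(A + 1)⁻¹`. -/
theorem norm_inner_sq_le_of_mem {w : H × (Fin p → H)} (hw : w ∈ D) (y : H) :
    ‖inner ℂ w.1 y‖ ^ 2 ≤
      (‖w.1‖ ^ 2 + ∑ ℓ, ‖w.2 ℓ‖ ^ 2) * (inner ℂ y (formInverse D y)).re := by
  have h1 : inner ℂ w.1 y = inner ℂ (formSpace.mk w hw) (formAdj D y) := by
    rw [inner_formAdj_right]; rfl
  have h2 : ‖w.1‖ ^ 2 + ∑ ℓ, ‖w.2 ℓ‖ ^ 2 = ‖formSpace.mk w hw‖ ^ 2 :=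
    (formSpace_norm_sq (formSpace.mk w hw)).symm
  rw [h1, h2, re_inner_formInverse, ← mul_pow]
  gcongr
  exact norm_inner_le_norm (𝕜 := ℂ) (formSpace.mk w hw) (formAdj D y)

/-- Compactness passes to smaller form domains. -/
theorem isCompactOperator_formInverse_of_le {D' : Submodule ℂ (H × (Fin p → H))}
    [CompleteSpace (formSpace D')] (hle : D' ≤ D) (hc : IsCompactOperator (formInverse D)) :
    IsCompactOperator (formInverse D') := by
  refine isCompactOperator_of_norm_sq_le hc fun x => ?_
  -- Apply the duality estimate of the larger domain to `v = J'* x`, which also lies in `D`; since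
  -- `⟪J' v, x⟫ = ‖v‖²`, it reads `‖v‖⁴ ≤ ‖v‖² ‖J* x‖²`.
  have h1 : ‖formAdj D' x‖ ≤ ‖formAdj D x‖ := by
    set v := formAdj D' x with hv
    have hmem : (formEmb D' v, fun ℓ => v.1.snd ℓ) ∈ D := hle (formSpace_mem v)
    have h2 := norm_inner_sq_le_of_mem hmem x
    have h3 : (inner ℂ (formEmb D' v) x) = ((‖v‖ ^ 2 : ℝ) : ℂ) := by
      rw [← inner_formAdj_right, ← hv, formSpace_inner_self]
    rw [re_inner_formInverse, ← formSpace_norm_sq v] at h2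
    simp only [h3, Complex.norm_real, norm_pow, norm_norm] at h2
    rcases (norm_nonneg v).eq_or_lt with h0 | h0
    · rw [← h0]; positivity
    · have h4 : ‖v‖ ^ 2 ≤ ‖formAdj D x‖ ^ 2 := by
        refine le_of_mul_le_mul_left ?_ (pow_pos h0 2)
        nlinarith
      exact le_of_sq_le_sq h4 (norm_nonneg _)
  have h2 : ‖formInverse D' x‖ ≤ ‖formAdj D' x‖ := norm_formEmb_le _
  calc ‖formInverse D' x‖ ^ 2 ≤ ‖formAdj D x‖ ^ 2 := by
        gcongr; exact h2.trans h1
    _ = (inner ℂ x (formInverse D x)).re := (re_inner_formInverse x).symm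
    _ ≤ ‖x‖ * ‖formInverse D x‖ := re_inner_le_norm (𝕜 := ℂ) _ _

variable {A : H →ₗ.[ℂ] H}

/-- Riesz representation in the form space: adding `⟪w, u⟫` to both sides, the weak equation for `A
u = f` says exactly that `(u, g)` represents `w ↦ ⟪w, u + f⟫`, that is, `J* (u + f) = (u, g)`. -/
theorem isShiftedInverse_formInverse
    (hA : ∀ u f : H, (u, f) ∈ A.graph ↔ ∃ g : Fin p → H, (u, g) ∈ D ∧
      ∀ w ∈ D, ∑ ℓ, inner ℂ (w.2 ℓ) (g ℓ) = inner ℂ w.1 f) :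
    IsShiftedInverse A (formInverse D) where
  mem_graph_iff u f := by
    rw [hA]
    constructor
    · rintro ⟨g, hg, h⟩
      have : formAdj D (u + f) = formSpace.mk (u, g) hg := by
        refine ext_inner_left ℂ fun v => ?_
        rw [inner_formAdj_right, formSpace_inner, formEmb_mk, inner_add_right]
        congr 1
        exact (h _ (formSpace_mem v)).symm
      change formEmb D (formAdj D (u + f)) = u
      rw [this, formEmb_mk]
    · intro h
      refine ⟨fun ℓ => (formAdj D (u + f)).1.snd ℓ, ?_, fun w hw => ?_⟩
      · have := formSpace_mem (formAdj D (u + f))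
        rwa [show formEmb D (formAdj D (u + f)) = u from h] at this
      · have h1 : inner ℂ (formSpace.mk w hw) (formAdj D (u + f)) =
            inner ℂ w.1 (u + f) := by
          rw [inner_formAdj_right]; rfl
        rw [formSpace_inner, formEmb_mk,
          show formEmb D (formAdj D (u + f)) = u from h, inner_add_right] at h1
        exact add_left_cancel h1
  symm x y := by
    rw [inner_formInverse, ← inner_conj_symm, inner_formInverse]
    exact inner_conj_symm (𝕜 := ℂ) (formAdj D x) (formAdj D y)
  nonneg x := by rw [re_inner_formInverse]; positivity
  le_one x := by
    rw [re_inner_formInverse]; gcongr; exact norm_adjoint_formEmb_le x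

/-- Elements of the spectral subspace of `(-∞, c]` satisfy the form bound. -/
theorem IsShiftedInverse.exists_form_le (h : IsShiftedInverse A (formInverse D)) {c : ℝ} {u : H}
    (hu : u ∈ spectralSubspace A (Set.Iic c)) :
    ∃ g : Fin p → H, (u, g) ∈ D ∧ ∑ ℓ, ‖g ℓ‖ ^ 2 ≤ c * ‖u‖ ^ 2 := by
  obtain ⟨s, f, hs, rfl⟩ := exists_sum_of_mem_spectralSubspace hu
  -- This is `y = (A + 1) u`, so `T y = u` and `J* y` is the lift of `u` to the form domain.
  set y := ∑ d ∈ s, ((1 + d : ℝ) : ℂ) • (f d : H) with hy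
  have hTy : formEmb D (formAdj D y) = ∑ d ∈ s, (f d : H) := by
    change formInverse D y = _
    rw [hy, map_sum]
    refine Finset.sum_congr rfl fun d _ => ?_
    rw [map_smul]
    simpa using h.mem_eigenspace_iff.1 (f d).2
  have hmem := formSpace_mem (formAdj D y)
  have hn := formSpace_norm_sq (formAdj D y)
  rw [hTy] at hmem hn
  refine ⟨_, hmem, ?_⟩
  have h1 : ‖formAdj D y‖ ^ 2 = ∑ d ∈ s, (1 + d) * ‖(f d : H)‖ ^ 2 := by
    rw [← re_inner_formInverse, ← h.symm]
    change (inner ℂ (formEmb D (formAdj D y)) y).re = _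
    rw [hTy, hy, h.inner_sum_smul, Complex.ofReal_re]
  have h2 : ∑ d ∈ s, (1 + d) * ‖(f d : H)‖ ^ 2 ≤ ∑ d ∈ s, (1 + c) * ‖(f d : H)‖ ^ 2 := by
    refine Finset.sum_le_sum fun d hd => ?_
    gcongr
    exact hs hd
  rw [← Finset.mul_sum, ← h.norm_sq_sum] at h2
  linarith

/-- The variational principle: a subspace on which the form is at most `c` has dimension at most
that of the spectral subspace of `(-∞, c]`. -/
theorem IsShiftedInverse.finrank_le_of_form_le (h : IsShiftedInverse A (formInverse D))
    (hc : IsCompactOperator (formInverse D)) {c : ℝ} (hc0 : 0 ≤ c) (G : Submodule ℂ H)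
    (hG : ∀ u ∈ G, ∃ g : Fin p → H, (u, g) ∈ D ∧ ∑ ℓ, ‖g ℓ‖ ^ 2 ≤ c * ‖u‖ ^ 2) :
    Module.finrank ℂ G ≤ Module.finrank ℂ (spectralSubspace A (Set.Iic c)) := by
  have hfd := h.finiteDimensional_spectralSubspace hc c
  -- A nonzero `u` killed by `P` is orthogonal to the spectral subspace, so `⟪u, T u⟫ < (1 + c)⁻¹
  -- ‖u‖²`. The duality estimate for `(u, g)` tested on `u` itself gives the opposite inequality.
  let P : G →ₗ[ℂ] spectralSubspace A (Set.Iic c) :=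
    ((spectralSubspace A (Set.Iic c)).orthogonalProjectionOnto : H →ₗ[ℂ] _).comp G.subtype
  refine LinearMap.finrank_le_finrank_of_injective (f := P) ?_
  rw [injective_iff_map_eq_zero]
  intro u hu
  by_contra hu0
  have hu0' : (u : H) ≠ 0 := fun h0 => hu0 (Subtype.ext h0)
  have hu1 : (u : H) ∈ (spectralSubspace A (Set.Iic c))ᗮ :=
    Submodule.orthogonalProjectionOnto_eq_zero_iff.1 hu
  have h1 := h.inner_lt_of_mem_orthogonal hc hc0 hu1 hu0'
  obtain ⟨g, hg, hg'⟩ := hG u u.2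
  have h2 := norm_inner_sq_le_of_mem hg (u : H)
  simp only [inner_self_eq_norm_sq_to_K] at h2
  have hn : 0 < ‖(u : H)‖ ^ 2 := by positivity
  have h3 : ‖((‖(u : H)‖ : ℂ)) ^ 2‖ = ‖(u : H)‖ ^ 2 := by simp
  have h3' : (‖(u : H)‖ ^ 2) ^ 2 ≤ (‖(u : H)‖ ^ 2 + ∑ ℓ, ‖g ℓ‖ ^ 2) *
      (inner ℂ (u : H) (formInverse D u)).re := by
    rw [← h3]; simpa using h2
  have h4 : (‖(u : H)‖ ^ 2 + ∑ ℓ, ‖g ℓ‖ ^ 2) ≤ (1 + c) * ‖(u : H)‖ ^ 2 := by linarith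
  have h5 : (‖(u : H)‖ ^ 2 + ∑ ℓ, ‖g ℓ‖ ^ 2) * (inner ℂ (u : H) (formInverse D u)).re ≤
      (1 + c) * ‖(u : H)‖ ^ 2 * (inner ℂ (u : H) (formInverse D u)).re :=
    mul_le_mul_of_nonneg_right h4 (h.nonneg _)
  have h6 : (1 + c) * ‖(u : H)‖ ^ 2 * (inner ℂ (u : H) (formInverse D u)).re <
      (1 + c) * ‖(u : H)‖ ^ 2 * ((1 + c)⁻¹ * ‖(u : H)‖ ^ 2) := by gcongr
  have h7 : (1 + c) * ‖(u : H)‖ ^ 2 * ((1 + c)⁻¹ * ‖(u : H)‖ ^ 2) = (‖(u : H)‖ ^ 2) ^ 2 := by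
    field_simp
  linarith

end Form

/-! ### Homogeneous vector fields -/

section Homogeneous

variable {W : Type*} [NormedAddCommGroup W] [NormedSpace ℝ W]
  {r : ℕ} (𝒲 : Fin r → Submodule ℝ W) [DirectSum.Decomposition 𝒲]

theorem dilation_add (t : ℝ) (v w : W) :
    dilation 𝒲 t (v + w) = dilation 𝒲 t v + dilation 𝒲 t w := by
  simp [dilation, DirectSum.decompose_add, Finset.sum_add_distrib]

theorem dilation_smul (t c : ℝ) (w : W) : dilation 𝒲 t (c • w) = c • dilation 𝒲 t w := by
  simp only [dilation, DirectSum.decompose_smul, DirectSum.smul_apply, Submodule.coe_smul,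
    Finset.smul_sum]
  exact Finset.sum_congr rfl fun i _ => smul_comm _ _ _

theorem dilation_one (w : W) : dilation 𝒲 1 w = w := by
  classical
  simp only [dilation, one_pow, one_smul]
  conv_rhs => rw [← DirectSum.sum_support_decompose 𝒲 w]
  symm
  refine Finset.sum_subset (Finset.subset_univ _) fun i _ hi => ?_
  simpa using hi

theorem decompose_dilation (t : ℝ) (w : W) (i : Fin r) :
    (DirectSum.decompose 𝒲 (dilation 𝒲 t w) i : W) =
      t ^ ((i : ℕ) + 1) • (DirectSum.decompose 𝒲 w i : W) := by
  classical
  rw [dilation, DirectSum.decompose_sum, DFinsupp.finsetSum_apply]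
  rw [AddSubmonoidClass.coe_finsetSum, Finset.sum_eq_single i]
  · rw [DirectSum.decompose_smul, DirectSum.smul_apply, Submodule.coe_smul,
      DirectSum.decompose_coe, DirectSum.of_eq_same]
  · intro j _ hj
    rw [DirectSum.decompose_smul, DirectSum.smul_apply, Submodule.coe_smul,
      DirectSum.decompose_coe, DirectSum.of_eq_of_ne _ _ _ hj.symm]
    simp
  · simp

theorem dilation_dilation (s t : ℝ) (w : W) :
    dilation 𝒲 s (dilation 𝒲 t w) = dilation 𝒲 (s * t) w := by
  conv_lhs => rw [dilation]
  simp only [decompose_dilation, smul_smul, ← mul_pow]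
  rfl

theorem dilation_inv_dilation {t : ℝ} (ht : 0 < t) (w : W) :
    dilation 𝒲 t⁻¹ (dilation 𝒲 t w) = w := by
  rw [dilation_dilation, inv_mul_cancel₀ ht.ne', dilation_one]

theorem dilation_dilation_inv {t : ℝ} (ht : 0 < t) (w : W) :
    dilation 𝒲 t (dilation 𝒲 t⁻¹ w) = w := by
  rw [dilation_dilation, mul_inv_cancel₀ ht.ne', dilation_one]

theorem tendsto_dilation_zero (w : W) : Tendsto (fun t => dilation 𝒲 t w) (𝓝[>] 0) (𝓝 0) := by
  have h1 : Continuous fun t => dilation 𝒲 t w := by unfold dilation; fun_prop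
  have h2 : dilation 𝒲 0 w = 0 := by simp [dilation]
  have := h1.tendsto 0
  rw [h2] at this
  exact this.mono_left nhdsWithin_le_nhds

/-- The first component of a vector. -/
def firstComponent : W →ₗ[ℝ] W where
  toFun w := if h : 0 < r then (DirectSum.decompose 𝒲 w ⟨0, h⟩ : W) else 0
  map_add' v w := by
    split_ifs <;> simp [DirectSum.decompose_add]
  map_smul' c w := by
    split_ifs <;> simp [DirectSum.decompose_smul, DirectSum.smul_apply]

theorem firstComponent_dilation (t : ℝ) (w : W) :
    firstComponent 𝒲 (dilation 𝒲 t w) = t • firstComponent 𝒲 w := by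
  simp only [firstComponent, LinearMap.coe_mk, AddHom.coe_mk]
  split_ifs with h
  · simp [decompose_dilation]
  · simp

/-- The eigenvalue of `h_2` on the summand of index `i` is `2 ^ (i + 1)`, which equals `2` only for
`i = 0`. -/
theorem firstComponent_eq_self {w : W} (hw : dilation 𝒲 2 w = (2 : ℝ) • w) :
    firstComponent 𝒲 w = w := by
  classical
  have h1 : ∀ i : Fin r, (i : ℕ) ≠ 0 → (DirectSum.decompose 𝒲 w i : W) = 0 := by
    intro i hi
    have h2 := decompose_dilation 𝒲 2 w i
    rw [hw, DirectSum.decompose_smul, DirectSum.smul_apply, Submodule.coe_smul] at h2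
    have h3 : ((2 : ℝ) ^ ((i : ℕ) + 1) - 2) • (DirectSum.decompose 𝒲 w i : W) = 0 := by
      rw [sub_smul, ← h2, sub_self]
    refine (smul_eq_zero.1 h3).resolve_left ?_
    have h4 : (2 : ℝ) ≤ 2 ^ (i : ℕ) := by
      calc (2 : ℝ) = 2 ^ 1 := by norm_num
        _ ≤ 2 ^ (i : ℕ) := by gcongr <;> [norm_num; omega]
    rw [pow_succ]
    intro h5
    linarith
  have h2 : ∑ i, (DirectSum.decompose 𝒲 w i : W) = w := by
    have := dilation_one 𝒲 w
    simpa [dilation] using this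
  simp only [firstComponent, LinearMap.coe_mk, AddHom.coe_mk]
  split_ifs with h
  · conv_rhs => rw [← h2]
    symm
    refine Finset.sum_eq_single _ (fun i _ hi => h1 i fun h0 => hi (Fin.ext h0)) (by simp)
  · have : IsEmpty (Fin r) := by
      rw [not_lt, Nat.le_zero] at h; subst h; infer_instance
    rw [← h2]; simp

variable {p : ℕ} {X : Fin p → VField W}

/-- Fields everywhere tangent to the hyperplanes `η = const` are closed under brackets, because `η`
is constant and annihilates their derivatives too. -/
theorem apply_generatedAlgebra_eq_zero {η : W →L[ℝ] ℝ} (hη : ∀ ℓ x, η ((X ℓ).1 x) = 0)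
    {Y : VField W} (hY : Y ∈ generatedAlgebra X) (x : W) : η (Y.1 x) = 0 := by
  have hd : ∀ (Z : VField W), (∀ x, η (Z.1 x) = 0) → ∀ x v, η (fderiv ℝ Z.1 x v) = 0 := by
    intro Z hZ x v
    have h1 : HasFDerivAt (fun y => η (Z.1 y)) (η ∘L fderiv ℝ Z.1 x) x :=
      η.hasFDerivAt.comp x (Z.differentiableAt x).hasFDerivAt
    have h2 : HasFDerivAt (fun y => η (Z.1 y)) (0 : W →L[ℝ] ℝ) x := by
      simp only [hZ]; exact hasFDerivAt_const _ _
    have := congrArg (fun L : W →L[ℝ] ℝ => L v) (h1.unique h2)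
    simpa using this
  revert x
  induction hY using LieSubalgebra.lieSpan_induction with
  | mem Z hZ => obtain ⟨ℓ, rfl⟩ := hZ; exact hη ℓ
  | zero => intro x; simp
  | add Y Z _ _ hY hZ => intro x; simp [hY x, hZ x]
  | smul c Y _ hY => intro x; simp [hY x]
  | lie Y Z _ _ hY hZ =>
    intro x
    rw [VField.bracket_apply, VectorField.lieBracket, map_sub, hd Z hZ, hd Y hY, sub_zero]

variable [FiniteDimensional ℝ W]

/-- The dilation as a continuous linear map. -/
def dilationL (t : ℝ) : W →L[ℝ] W :=
  LinearMap.toContinuousLinearMap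
    { toFun := dilation 𝒲 t
      map_add' := dilation_add 𝒲 t
      map_smul' := dilation_smul 𝒲 t }

theorem dilationL_apply (t : ℝ) (w : W) : dilationL 𝒲 t w = dilation 𝒲 t w := rfl

theorem coe_dilationL (t : ℝ) : ⇑(dilationL 𝒲 t) = dilation 𝒲 t := rfl

theorem contDiff_dilation (t : ℝ) : ContDiff ℝ ∞ (dilation 𝒲 t) := (dilationL 𝒲 t).contDiff

theorem fderiv_comp_dilation {F : Type*} [NormedAddCommGroup F] [NormedSpace ℝ F] (t : ℝ)
    {f : W → F} {x : W} (hf : DifferentiableAt ℝ f (dilation 𝒲 t x)) (v : W) :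
    fderiv ℝ (f ∘ dilation 𝒲 t) x v = fderiv ℝ f (dilation 𝒲 t x) (dilation 𝒲 t v) := by
  have h := hf.hasFDerivAt.comp x (dilationL 𝒲 t).hasFDerivAt
  exact congrArg (fun L : W →L[ℝ] F => L v) h.fderiv

variable {𝒲} in
-- Linear functionals are smooth and separate points, so testing homogeneity on them gives the
-- pointwise relation.
theorem IsHomogeneous.dilation_apply {m : ℕ} {Y : VField W} (hY : IsHomogeneous 𝒲 m Y) {t : ℝ}
    (ht : 0 < t) (x : W) : dilation 𝒲 t (Y.1 x) = t ^ m • Y.1 (dilation 𝒲 t x) := by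
  refine (SeparatingDual.eq_iff_forall_dual_eq (R := ℝ)).2 fun L => ?_
  have h := hY L L.contDiff t ht x
  rw [along, along, fderiv_comp_dilation 𝒲 t L.differentiableAt, ContinuousLinearMap.fderiv] at h
  rw [h, map_smul, smul_eq_mul]

variable {𝒲} in
theorem IsHomogeneous.along_comp_dilation {F : Type*} [NormedAddCommGroup F] [NormedSpace ℝ F]
    {m : ℕ} {Y : VField W} (hY : IsHomogeneous 𝒲 m Y) {t : ℝ} (ht : 0 < t) {f : W → F}
    (hf : Differentiable ℝ f) (x : W) :
    along Y (f ∘ dilation 𝒲 t) x = t ^ m • along Y f (dilation 𝒲 t x) := by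
  rw [along, along, fderiv_comp_dilation 𝒲 t (hf _), hY.dilation_apply ht, map_smul]

variable {𝒲} in
/-- Homogeneous vector fields of degree one are divergence free. -/
theorem IsHomogeneous.divergence_eq_zero {Y : VField W} (hY : IsHomogeneous 𝒲 1 Y) (x : W) :
    divergence Y x = 0 := by
  -- `Y = t h_t⁻¹ ∘ Y ∘ h_t`, and the trace is invariant under conjugation by `h_t`. Letting `t → 0`
  -- then gives zero.
  have h1 : ∀ t : ℝ, 0 < t → divergence Y x = t * divergence Y (dilation 𝒲 t x) := by
    intro t ht
    have hfun : Y.1 = fun y => t • dilationL 𝒲 t⁻¹ (Y.1 (dilationL 𝒲 t y)) := by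
      funext y
      have := hY.dilation_apply ht y
      rw [pow_one] at this
      rw [coe_dilationL, coe_dilationL, ← dilation_smul, ← this, dilation_inv_dilation 𝒲 ht]
    have hd : fderiv ℝ Y.1 x = t • ((dilationL 𝒲 t⁻¹) ∘L
        ((fderiv ℝ Y.1 (dilation 𝒲 t x)) ∘L (dilationL 𝒲 t))) := by
      have hd1 : HasFDerivAt (fun y => Y.1 (dilationL 𝒲 t y))
          ((fderiv ℝ Y.1 (dilation 𝒲 t x)) ∘L (dilationL 𝒲 t)) x :=
        (Y.differentiableAt (dilation 𝒲 t x)).hasFDerivAt.comp x (dilationL 𝒲 t).hasFDerivAt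
      have hd2 := (((dilationL 𝒲 t⁻¹).hasFDerivAt).comp x hd1).const_smul t
      conv_lhs => rw [hfun]
      exact hd2.fderiv
    rw [divergence, divergence, hd]
    simp only [ContinuousLinearMap.toLinearMap_smul, map_smul, smul_eq_mul,
      ContinuousLinearMap.toLinearMap_comp]
    congr 1
    rw [LinearMap.trace_comp_comm', LinearMap.comp_assoc]
    congr 1
    ext v
    simp only [LinearMap.comp_apply, ContinuousLinearMap.coe_coe, dilationL_apply]
    rw [dilation_dilation_inv 𝒲 ht]
  have h2 : Tendsto (fun t : ℝ => t * divergence Y (dilation 𝒲 t x)) (𝓝[>] 0)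
      (𝓝 (0 * divergence Y 0)) := by
    refine Tendsto.mul (tendsto_id.mono_left nhdsWithin_le_nhds) ?_
    have hc : Continuous (divergence Y) := by
      have h : Continuous fun x => fderiv ℝ Y.1 x := Y.contDiff.continuous_fderiv (by simp)
      exact (LinearMap.continuous_of_finiteDimensional
        ((LinearMap.trace ℝ W).comp (ContinuousLinearMap.coeLM ℝ))).comp h
    exact (hc.tendsto 0).comp (tendsto_dilation_zero 𝒲 x)
  rw [zero_mul] at h2
  refine tendsto_nhds_unique (tendsto_const_nhds.congr' ?_) h2
  filter_upwards [self_mem_nhdsWithin] with t ht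
  exact h1 t ht

/-- Linear functionals of weight one. -/
def IsWeightOne (η : W →L[ℝ] ℝ) : Prop := ∀ (t : ℝ) (w : W), η (dilation 𝒲 t w) = t * η w

variable {𝒲} in
-- `η ∘ Y` is invariant under dilations and continuous at the origin, to which every dilation orbit
-- tends. Plane waves are eigenfunctions of the `X_ℓ` for this reason.
theorem IsWeightOne.apply_eq {η : W →L[ℝ] ℝ} (hη : IsWeightOne 𝒲 η) {Y : VField W}
    (hY : IsHomogeneous 𝒲 1 Y) (x : W) : η (Y.1 x) = η (Y.1 0) := by
  have h1 : ∀ t : ℝ, 0 < t → η (Y.1 x) = η (Y.1 (dilation 𝒲 t x)) := by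
    intro t ht
    have := congrArg η (hY.dilation_apply ht x)
    rw [hη, pow_one, map_smul, smul_eq_mul] at this
    exact mul_left_cancel₀ ht.ne' this
  have h2 : Tendsto (fun t : ℝ => η (Y.1 (dilation 𝒲 t x))) (𝓝[>] 0) (𝓝 (η (Y.1 0))) :=
    ((η.continuous.comp Y.contDiff.continuous).tendsto 0).comp (tendsto_dilation_zero 𝒲 x)
  refine tendsto_nhds_unique (tendsto_const_nhds.congr' ?_) h2
  filter_upwards [self_mem_nhdsWithin] with t ht
  exact h1 t ht

/-- The symbol `∑ ℓ, η(X_ℓ(0))²` of the sub-Laplacian at a weight one functional. -/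
def symbol (X : Fin p → VField W) (η : W →L[ℝ] ℝ) : ℝ := ∑ ℓ, (η ((X ℓ).1 0)) ^ 2

variable {𝒲}

/-- If the symbol vanishes, every `X_ℓ` is tangent to the level sets of `η`, hence so is all of `𝔤`;
Hörmander's condition then gives `η = 0`. -/
theorem symbol_pos (hhom : ∀ ℓ, IsHomogeneous 𝒲 1 (X ℓ)) (hhor : HormanderCondition X)
    {η : W →L[ℝ] ℝ} (hη : IsWeightOne 𝒲 η) (h0 : η ≠ 0) : 0 < symbol X η := by
  have hnn : 0 ≤ symbol X η := Finset.sum_nonneg fun _ _ => sq_nonneg _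
  refine lt_of_le_of_ne hnn fun h => h0 ?_
  have h1 : ∀ ℓ, η ((X ℓ).1 0) = 0 := by
    intro ℓ
    have := (Finset.sum_eq_zero_iff_of_nonneg fun _ _ => sq_nonneg _).1 h.symm ℓ
      (Finset.mem_univ _)
    exact pow_eq_zero_iff (two_ne_zero) |>.1 this
  ext w
  obtain ⟨Y, hY, rfl⟩ := hhor w
  exact apply_generatedAlgebra_eq_zero (fun ℓ x => by rw [hη.apply_eq (hhom ℓ), h1]) hY 0

/-- Evaluation at `0` has kernel the degree-one part of `𝔥`, so two independent values exist.
Homogeneity puts them in the first summand, and a left inverse composed with the projection to that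
summand yields the weight-one functionals. -/
theorem exists_dual_pair (hcodim : 2 ≤ degOneCodim 𝒲 X) :
    ∃ (e : Fin 2 → W) (η : Fin 2 → W →L[ℝ] ℝ), (∀ i, IsWeightOne 𝒲 (η i)) ∧
      ∀ i j, η i (e j) = if i = j then 1 else 0 := by
  classical
  let ev : algebraDegOne 𝒲 X →ₗ[ℝ] W :=
    { toFun := fun Y => Y.1.1 0
      map_add' := fun _ _ => rfl
      map_smul' := fun _ _ => rfl }
  have hker : LinearMap.ker ev =
      (isotropyDegOne 𝒲 X).submoduleOf (algebraDegOne 𝒲 X) := by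
    ext Y
    rw [LinearMap.mem_ker, Submodule.submoduleOf, Submodule.mem_comap]
    constructor
    · intro h
      exact ⟨⟨Y.2.1, h⟩, Y.2.2⟩
    · intro h
      exact h.1.2
  have hrank : (2 : Cardinal) ≤ Module.rank ℝ (LinearMap.range ev) := by
    rw [← ev.quotKerEquivRange.rank_eq, hker]
    exact hcodim
  have hfr : 2 ≤ Module.finrank ℝ (LinearMap.range ev) := by
    rw [← Module.finrank_eq_rank] at hrank
    exact_mod_cast hrank
  obtain ⟨e, he⟩ : ∃ e : Fin 2 → LinearMap.range ev, LinearIndependent ℝ e := by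
    exact exists_linearIndependent_of_le_finrank hfr
  have he' : LinearIndependent ℝ fun i => (e i : W) :=
    he.map' (LinearMap.range ev).subtype (Submodule.ker_subtype _)
  have hfix : ∀ i, firstComponent 𝒲 (e i : W) = e i := by
    intro i
    obtain ⟨Y, hY⟩ := (e i).2
    refine firstComponent_eq_self 𝒲 ?_
    have hh : IsHomogeneous 𝒲 1 Y.1 := Y.2.2
    have := hh.dilation_apply (t := 2) (by norm_num) 0
    rw [pow_one] at this
    rw [← hY]
    refine this.trans ?_
    have h0 : dilation 𝒲 2 (0 : W) = 0 := by simpa using dilation_smul 𝒲 2 0 (0 : W)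
    rw [h0]
    rfl
  obtain ⟨g, hg⟩ := LinearMap.exists_leftInverse_of_injective
    (Finsupp.linearCombination ℝ fun i => (e i : W)) (LinearMap.ker_eq_bot.2 he')
  refine ⟨fun i => e i, fun i => LinearMap.toContinuousLinearMap
    ((Finsupp.lapply i).comp (g.comp (firstComponent 𝒲))), fun i t w => ?_, fun i j => ?_⟩
  · simp [firstComponent_dilation]
  · have h1 := LinearMap.congr_fun hg (Finsupp.single j 1)
    simp only [LinearMap.comp_apply, Finsupp.linearCombination_single, one_smul,
      LinearMap.id_apply] at h1
    simp only [LinearMap.coe_toContinuousLinearMap', LinearMap.comp_apply, hfix, h1,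
      Finsupp.lapply_apply, Finsupp.single_apply, eq_comm]

/-- The level sets of the symbol on weight one functionals are infinite. -/
theorem exists_injective_symbol_eq (hhom : ∀ ℓ, IsHomogeneous 𝒲 1 (X ℓ))
    (hhor : HormanderCondition X) (hcodim : 2 ≤ degOneCodim 𝒲 X) {c : ℝ} (hc : 0 < c) :
    ∃ η : ℕ → W →L[ℝ] ℝ, Function.Injective η ∧ ∀ n, IsWeightOne 𝒲 (η n) ∧ symbol X (η n) = c := by
  obtain ⟨e, η, hη, hd⟩ := exists_dual_pair hcodim
  -- Pairwise nonproportional functionals; as the symbol is quadratic, each can be rescaled to the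
  -- level `c` without creating coincidences.
  let ζ : ℕ → W →L[ℝ] ℝ := fun n => η 0 + (n : ℝ) • η 1
  have hζ : ∀ n, IsWeightOne 𝒲 (ζ n) := by
    intro n t w
    simp only [ζ, add_apply, smul_apply, smul_eq_mul, hη 0 t w, hη 1 t w]
    ring
  have hζ0 : ∀ n, ζ n (e 0) = 1 := fun n => by simp [ζ, hd]
  have hζ1 : ∀ n, ζ n (e 1) = n := fun n => by simp [ζ, hd]
  have hpos : ∀ n, 0 < symbol X (ζ n) := fun n =>
    symbol_pos hhom hhor (hζ n) fun h0 => by simpa [h0] using hζ0 n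
  let k : ℕ → ℝ := fun n => Real.sqrt (c / symbol X (ζ n))
  have hk : ∀ n, 0 < k n := fun n => Real.sqrt_pos.2 (div_pos hc (hpos n))
  refine ⟨fun n => k n • ζ n, fun m n hmn => ?_, fun n => ⟨fun t w => ?_, ?_⟩⟩
  · have h0 := congrArg (fun L : W →L[ℝ] ℝ => L (e 0)) hmn
    have h1 := congrArg (fun L : W →L[ℝ] ℝ => L (e 1)) hmn
    simp only [smul_apply, smul_eq_mul, hζ0, hζ1, mul_one] at h0 h1
    rw [h0] at h1
    exact_mod_cast mul_left_cancel₀ (hk n).ne' h1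
  · simp only [smul_apply, smul_eq_mul, hζ n t w]
    ring
  · have : symbol X (k n • ζ n) = k n ^ 2 * symbol X (ζ n) := by
      simp only [symbol, smul_apply, smul_eq_mul, mul_pow, Finset.mul_sum]
    rw [this, Real.sq_sqrt (div_pos hc (hpos n)).le, div_mul_cancel₀ _ (hpos n).ne']

end Homogeneous

/-! ### Integration by parts and weak derivatives -/

section WeakDerivatives

theorem along_mul {W : Type*} [NormedAddCommGroup W] [NormedSpace ℝ W] (Y : VField W)
    {f g : W → ℂ} (hf : Differentiable ℝ f) (hg : Differentiable ℝ g) (x : W) :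
    along Y (fun y => f y * g y) x = along Y f x * g x + f x * along Y g x := by
  have h := ((hf x).hasFDerivAt.mul (hg x).hasFDerivAt).fderiv
  rw [along]
  change fderiv ℝ (f * g) x (Y.1 x) = _
  rw [h]
  simp only [along, add_apply, smul_apply, smul_eq_mul]
  ring

theorem hasCompactSupport_along {W : Type*} [NormedAddCommGroup W] [NormedSpace ℝ W]
    (Y : VField W) {f : W → ℂ} (hf : HasCompactSupport f) : HasCompactSupport (along Y f) := by
  refine (hf.fderiv (𝕜 := ℝ)).mono fun x hx h0 => hx ?_
  simp [along, h0]

theorem tsupport_along_subset {W : Type*} [NormedAddCommGroup W] [NormedSpace ℝ W]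
    (Y : VField W) (f : W → ℂ) : tsupport (along Y f) ⊆ tsupport f := by
  refine closure_minimal ?_ isClosed_closure
  intro x hx
  refine support_fderiv_subset ℝ (f := f) fun h0 => hx ?_
  simp [along, h0]

theorem contDiff_along {W : Type*} [NormedAddCommGroup W] [NormedSpace ℝ W]
    (Y : VField W) {f : W → ℂ} (hf : ContDiff ℝ ∞ f) : ContDiff ℝ ∞ (along Y f) := by
  have h1 : ContDiff ℝ ∞ (fderiv ℝ f) := hf.fderiv_right (by simp)
  exact h1.clm_apply Y.contDiff

theorem IsTestFunction.along {W : Type*} [NormedAddCommGroup W] [NormedSpace ℝ W]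
    {Ω : Set W} {φ : W → ℂ} (hφ : IsTestFunction Ω φ) (Y : VField W) :
    IsTestFunction Ω (SubLaplacian.along Y φ) :=
  ⟨contDiff_along Y hφ.1, hasCompactSupport_along Y hφ.2.1,
    (tsupport_along_subset Y φ).trans hφ.2.2⟩

theorem IsTestFunction.conj {W : Type*} [NormedAddCommGroup W] [NormedSpace ℝ W]
    {Ω : Set W} {φ : W → ℂ} (hφ : IsTestFunction Ω φ) :
    IsTestFunction Ω fun x => starRingEnd ℂ (φ x) := by
  refine ⟨(Complex.conjCLE : ℂ →L[ℝ] ℂ).contDiff.comp hφ.1, hφ.2.1.comp_left (map_zero _), ?_⟩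
  refine (closure_mono fun x hx => ?_).trans hφ.2.2
  simpa using hx

theorem memLp_conj {W : Type*} [MeasurableSpace W] {μ : Measure W} {Ω : Set W}
    {ψ : W → ℂ} (hψ : MemLp ψ 2 (μ.restrict Ω)) :
    MemLp (fun x => starRingEnd ℂ (ψ x)) 2 (μ.restrict Ω) := hψ.star

theorem inner_toLp_eq_integral {W : Type*} [MeasurableSpace W] {μ : Measure W} {Ω : Set W}
    {ψ : W → ℂ} (hψ : MemLp ψ 2 (μ.restrict Ω)) (u : L2 μ Ω) :
    inner ℂ hψ.toLp u = ∫ x in Ω, u x * starRingEnd ℂ (ψ x) ∂μ := by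
  rw [L2.inner_def]
  refine integral_congr_ae ?_
  filter_upwards [hψ.coeFn_toLp] with x hx
  rw [hx, RCLike.inner_apply]

theorem integral_mul_eq_inner {W : Type*} [MeasurableSpace W] {μ : Measure W} {Ω : Set W}
    {ψ : W → ℂ} (hψ : MemLp ψ 2 (μ.restrict Ω)) (u : L2 μ Ω) :
    ∫ x in Ω, u x * ψ x ∂μ = inner ℂ ((memLp_conj hψ).toLp) u := by
  rw [L2.inner_def]
  refine integral_congr_ae ?_
  filter_upwards [(memLp_conj hψ).coeFn_toLp] with x hx
  rw [hx, RCLike.inner_apply, Complex.conj_conj]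

theorem continuous_integral_mul {W : Type*} [MeasurableSpace W] {μ : Measure W} {Ω : Set W}
    {ψ : W → ℂ} (hψ : MemLp ψ 2 (μ.restrict Ω)) :
    Continuous fun u : L2 μ Ω => ∫ x in Ω, u x * ψ x ∂μ := by
  simp only [integral_mul_eq_inner hψ]
  fun_prop

theorem IsTestFunction.memLp {W : Type*} [NormedAddCommGroup W] [NormedSpace ℝ W]
    [MeasurableSpace W] [BorelSpace W] {μ : Measure W} [μ.IsAddHaarMeasure] {Ω : Set W}
    {φ : W → ℂ} (hφ : IsTestFunction Ω φ) : MemLp φ 2 (μ.restrict Ω) :=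
  hφ.1.continuous.memLp_of_hasCompactSupport hφ.2.1

variable {W : Type*} [NormedAddCommGroup W] [NormedSpace ℝ W] [FiniteDimensional ℝ W]

/-- A smooth cutoff function between a compact set and an open set. -/
theorem exists_cutoff {K Ω : Set W} (hK : IsCompact K) (hΩ : IsOpen Ω) (hKΩ : K ⊆ Ω) :
    ∃ χ : W → ℝ, ContDiff ℝ ∞ χ ∧ HasCompactSupport χ ∧ tsupport χ ⊆ Ω ∧
      (∀ x ∈ K, χ =ᶠ[𝓝 x] 1) ∧ ∀ x, χ x ∈ Set.Icc (0 : ℝ) 1 := by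
  obtain ⟨L, hL, hKL, hLΩ⟩ := exists_compact_between hK hΩ hKΩ
  obtain ⟨f, h1, h0, hf⟩ := exists_contMDiffMap_one_nhds_of_subset_interior
    (n := (⊤ : ℕ∞)) (modelWithCornersSelf ℝ W) hK.isClosed hKL
  have hsupp : tsupport f ⊆ L := by
    refine closure_minimal (fun x hx => ?_) hL.isClosed
    by_contra hxL
    exact hx (h0 x hxL)
  refine ⟨f, f.contMDiff.contDiff, hL.of_isClosed_subset (isClosed_tsupport _) hsupp,
    hsupp.trans hLΩ, fun x hx => ?_, hf⟩
  exact h1.filter_mono (nhds_le_nhdsSet hx)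

variable [MeasurableSpace W] [BorelSpace W] (μ : Measure W) [μ.IsAddHaarMeasure]

theorem integral_smul_fderiv_of_hasCompactSupport {a : W → ℝ} {f : W → ℂ} (ha : ContDiff ℝ ∞ a)
    (hf : ContDiff ℝ ∞ f) (hc : HasCompactSupport f) (v : W) :
    Integrable (fun x => a x • fderiv ℝ f x v) μ ∧ Integrable (fun x => fderiv ℝ a x v • f x) μ ∧
      ∫ x, a x • fderiv ℝ f x v ∂μ = -∫ x, fderiv ℝ a x v • f x ∂μ := by
  have hfd : Continuous fun x => fderiv ℝ f x v :=
    (hf.continuous_fderiv (by simp)).clm_apply continuous_const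
  have had : Continuous fun x => fderiv ℝ a x v :=
    (ha.continuous_fderiv (by simp)).clm_apply continuous_const
  have i1 : Integrable (fun x => a x • fderiv ℝ f x v) μ := by
    refine Continuous.integrable_of_hasCompactSupport (ha.continuous.smul hfd) ?_
    refine (hc.fderiv (𝕜 := ℝ)).mono fun x hx h0 => hx ?_
    simp [h0]
  have i2 : Integrable (fun x => fderiv ℝ a x v • f x) μ := by
    refine Continuous.integrable_of_hasCompactSupport (had.smul hf.continuous) ?_
    refine hc.mono fun x hx h0 => hx ?_
    simp [h0]
  have i3 : Integrable (fun x => a x • f x) μ := by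
    refine Continuous.integrable_of_hasCompactSupport (ha.continuous.smul hf.continuous) ?_
    refine hc.mono fun x hx h0 => hx ?_
    simp [h0]
  exact ⟨i1, i2, integral_smul_fderiv_eq_neg_fderiv_smul_of_integrable i2 i1 i3
    (fun x _ => ha.differentiable (by simp) x) fun x _ => hf.differentiable (by simp) x⟩

/-- The divergence theorem for compactly supported functions. -/
theorem integral_along_add_divergence (Y : VField W) {f : W → ℂ} (hf : ContDiff ℝ ∞ f)
    (hc : HasCompactSupport f) :
    ∫ x, (along Y f x + (divergence Y x : ℂ) * f x) ∂μ = 0 := by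
  let b := Module.finBasis ℝ W
  let c : Fin (Module.finrank ℝ W) → W →L[ℝ] ℝ := fun i => LinearMap.toContinuousLinearMap (b.coord i)
  have hY1 : ∀ i, ContDiff ℝ ∞ fun x => c i (Y.1 x) := fun i => (c i).contDiff.comp Y.contDiff
  have hd : ∀ i x v, fderiv ℝ (fun x => c i (Y.1 x)) x v = c i (fderiv ℝ Y.1 x v) := by
    intro i x v
    have := ((c i).hasFDerivAt.comp x (Y.differentiableAt x).hasFDerivAt).fderiv
    exact congrArg (fun L : W →L[ℝ] ℝ => L v) this
  have h1 : ∀ x, along Y f x = ∑ i, c i (Y.1 x) • fderiv ℝ f x (b i) := by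
    intro x
    rw [along]
    conv_lhs => rw [← b.sum_repr (Y.1 x)]
    rw [map_sum]
    refine Finset.sum_congr rfl fun i _ => ?_
    rw [map_smul]
    rfl
  have h2 : ∀ x, (divergence Y x : ℂ) * f x =
      ∑ i, fderiv ℝ (fun x => c i (Y.1 x)) x (b i) • f x := by
    intro x
    rw [divergence, LinearMap.trace_eq_matrix_trace ℝ b, Matrix.trace, ← Finset.sum_smul,
      Complex.real_smul]
    congr 2
    refine Finset.sum_congr rfl fun i _ => ?_
    rw [hd, Matrix.diag_apply, LinearMap.toMatrix_apply]
    rfl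
  have h3 := fun i => integral_smul_fderiv_of_hasCompactSupport μ (hY1 i) hf hc (b i)
  simp only [h1, h2]
  rw [integral_add (integrable_finsetSum _ fun i _ => (h3 i).1)
    (integrable_finsetSum _ fun i _ => (h3 i).2.1), integral_finsetSum _ fun i _ => (h3 i).1,
    integral_finsetSum _ fun i _ => (h3 i).2.1, ← Finset.sum_add_distrib]
  refine Finset.sum_eq_zero fun i _ => ?_
  rw [(h3 i).2.2, neg_add_cancel]

/-- Integration by parts of a smooth function against a compactly supported one. -/
theorem integral_along_mul (Y : VField W) (hY : ∀ x, divergence Y x = 0) {f φ : W → ℂ}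
    (hf : ContDiff ℝ ∞ f) (hφ : ContDiff ℝ ∞ φ) (hc : HasCompactSupport φ) :
    ∫ x, along Y f x * φ x ∂μ = -∫ x, f x * along Y φ x ∂μ := by
  have h := integral_along_add_divergence μ Y (hf.mul hφ) hc.mul_left
  simp only [hY, Complex.ofReal_zero, zero_mul, add_zero] at h
  rw [integral_congr_ae (Eventually.of_forall fun x =>
    along_mul Y (hf.differentiable (by simp)) (hφ.differentiable (by simp)) x)] at h
  rw [integral_add] at h
  · exact eq_neg_of_add_eq_zero_left h
  · exact ((continuous_along Y hf).mul hφ.continuous).integrable_of_hasCompactSupport hc.mul_left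
  · exact (hf.continuous.mul (continuous_along Y hφ)).integrable_of_hasCompactSupport
      (hasCompactSupport_along Y hc).mul_left

variable (Ω : Set W)

theorem ae_eq_zero_of_forall_test {U : Set W} (hU : IsOpen U) (f : L2 μ Ω)
    (h : ∀ φ : W → ℂ, IsTestFunction U φ → ∫ x in Ω, f x * φ x ∂μ = 0) :
    ∀ᵐ x ∂μ.restrict Ω, x ∈ U → f x = 0 := by
  have hloc : LocallyIntegrable f (μ.restrict Ω) :=
    (Lp.memLp f).locallyIntegrable (by norm_num)
  refine hU.ae_eq_zero_of_integral_contDiff_smul_eq_zero (hloc.locallyIntegrableOn U) ?_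
  intro g hg hgc hgU
  have h1 : tsupport (fun x => (g x : ℂ)) ⊆ tsupport g := by
    refine closure_mono fun x hx => ?_
    simpa using hx
  have := h (fun x => (g x : ℂ)) ⟨Complex.ofRealCLM.contDiff.comp hg,
    hgc.comp_left Complex.ofReal_zero, h1.trans hgU⟩
  rw [← this]
  refine integral_congr_ae (Eventually.of_forall fun x => ?_)
  simp only [Complex.real_smul]
  ring

theorem eq_zero_of_forall_test (hΩ : IsOpen Ω) (f : L2 μ Ω)
    (h : ∀ φ : W → ℂ, IsTestFunction Ω φ → ∫ x in Ω, f x * φ x ∂μ = 0) : f = 0 := by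
  have h1 := ae_eq_zero_of_forall_test μ Ω hΩ f h
  rw [Lp.eq_zero_iff_ae_eq_zero]
  filter_upwards [h1, ae_restrict_mem hΩ.measurableSet] with x hx hx'
  exact hx hx'

variable {p : ℕ} (X : Fin p → VField W)

variable {μ Ω X} in
theorem mem_sobolev_iff (hX : ∀ ℓ x, divergence (X ℓ) x = 0)
    {w : L2 μ Ω × (Fin p → L2 μ Ω)} :
    w ∈ sobolev μ Ω X ↔ ∀ ℓ (φ : W → ℂ), IsTestFunction Ω φ →
      ∫ x in Ω, w.2 ℓ x * φ x ∂μ = -∫ x in Ω, w.1 x * along (X ℓ) φ x ∂μ := by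
  have : w ∈ sobolev μ Ω X ↔ ∀ ℓ, HasWeakDeriv μ Ω (X ℓ) w.1 (w.2 ℓ) := Iff.rfl
  rw [this]
  simp only [HasWeakDeriv, hX, Complex.ofReal_zero, zero_mul, add_zero]

variable {X} in
theorem isClosed_sobolev (hX : ∀ ℓ x, divergence (X ℓ) x = 0) :
    IsClosed (sobolev μ Ω X : Set (L2 μ Ω × (Fin p → L2 μ Ω))) := by
  have : (sobolev μ Ω X : Set (L2 μ Ω × (Fin p → L2 μ Ω))) =
      ⋂ (ℓ) (φ : W → ℂ) (_ : IsTestFunction Ω φ), {w | ∫ x in Ω, w.2 ℓ x * φ x ∂μ =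
        -∫ x in Ω, w.1 x * along (X ℓ) φ x ∂μ} := by
    ext w
    rw [SetLike.mem_coe, mem_sobolev_iff hX]
    simp only [Set.mem_iInter, Set.mem_ofPred_eq]
  rw [this]
  refine isClosed_iInter fun ℓ => isClosed_iInter fun φ => isClosed_iInter fun hφ => ?_
  refine isClosed_eq ?_ ?_
  · exact (continuous_integral_mul hφ.memLp).comp (by fun_prop)
  · exact ((continuous_integral_mul (hφ.along (X ℓ)).memLp).comp continuous_fst).neg

variable {X} in
theorem isClosed_sobolevZero (hX : ∀ ℓ x, divergence (X ℓ) x = 0) :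
    IsClosed (sobolevZero μ Ω X : Set (L2 μ Ω × (Fin p → L2 μ Ω))) :=
  (Submodule.isClosed_topologicalClosure _).inter (isClosed_sobolev μ Ω hX)

variable {X} in
/-- Smooth functions that are square integrable together with their derivatives belong to the
Sobolev space. -/
theorem smooth_mem_sobolev (hX : ∀ ℓ x, divergence (X ℓ) x = 0) {ψ : W → ℂ}
    (hψ : ContDiff ℝ ∞ ψ) (h0 : MemLp ψ 2 (μ.restrict Ω))
    (h1 : ∀ ℓ, MemLp (along (X ℓ) ψ) 2 (μ.restrict Ω)) :
    (h0.toLp, fun ℓ => (h1 ℓ).toLp) ∈ sobolev μ Ω X := by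
  rw [mem_sobolev_iff hX]
  intro ℓ φ hφ
  have e1 : ∫ x in Ω, (h1 ℓ).toLp _ x * φ x ∂μ = ∫ x, along (X ℓ) ψ x * φ x ∂μ := by
    rw [← setIntegral_eq_integral_of_forall_compl_eq_zero (s := Ω) (μ := μ)
      (f := fun x => along (X ℓ) ψ x * φ x)]
    · refine integral_congr_ae ?_
      filter_upwards [(h1 ℓ).coeFn_toLp] with x hx
      rw [hx]
    · intro x hx
      rw [image_eq_zero_of_notMem_tsupport fun h => hx (hφ.2.2 h), mul_zero]
  have e2 : ∫ x in Ω, h0.toLp _ x * along (X ℓ) φ x ∂μ = ∫ x, ψ x * along (X ℓ) φ x ∂μ := by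
    rw [← setIntegral_eq_integral_of_forall_compl_eq_zero (s := Ω) (μ := μ)
      (f := fun x => ψ x * along (X ℓ) φ x)]
    · refine integral_congr_ae ?_
      filter_upwards [h0.coeFn_toLp] with x hx
      rw [hx]
    · intro x hx
      rw [image_eq_zero_of_notMem_tsupport fun h => hx ((hφ.along (X ℓ)).2.2 h), mul_zero]
  rw [e1, e2]
  exact integral_along_mul μ (X ℓ) (hX ℓ) hψ hφ.1 hφ.2.1

variable {X} in
theorem test_mem_sobolevZero (hX : ∀ ℓ x, divergence (X ℓ) x = 0) {φ : W → ℂ}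
    (hφ : IsTestFunction Ω φ) :
    (hφ.memLp.toLp, fun ℓ => (hφ.along (X ℓ)).memLp.toLp) ∈ sobolevZero μ Ω X := by
  have hmem := smooth_mem_sobolev μ Ω hX hφ.1 hφ.memLp fun ℓ => (hφ.along (X ℓ)).memLp
  refine ⟨Submodule.le_topologicalClosure _ ⟨hmem, tsupport φ, hφ.2.1, hφ.2.2, ?_⟩, hmem⟩
  filter_upwards [hφ.memLp.coeFn_toLp] with x hx hx'
  rw [hx, image_eq_zero_of_notMem_tsupport hx']

variable {X} in
-- Density of the form domain, which makes the form graph single-valued. Proved for the smaller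
-- domain, it serves both realizations.
theorem sobolevZero_dense (hΩ : IsOpen Ω) (hX : ∀ ℓ x, divergence (X ℓ) x = 0) (f : L2 μ Ω)
    (hf : ∀ w ∈ sobolevZero μ Ω X, inner ℂ w.1 f = 0) : f = 0 := by
  refine eq_zero_of_forall_test μ Ω hΩ f fun φ hφ => ?_
  have := hf _ (test_mem_sobolevZero μ Ω hX hφ.conj)
  rw [inner_toLp_eq_integral] at this
  simpa only [Complex.conj_conj] using this

variable {X} in
/-- Uniqueness of the weak derivatives. -/
theorem sobolev_snd_unique (hΩ : IsOpen Ω) (hX : ∀ ℓ x, divergence (X ℓ) x = 0) {u : L2 μ Ω}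
    {g k : Fin p → L2 μ Ω} (hg : (u, g) ∈ sobolev μ Ω X) (hk : (u, k) ∈ sobolev μ Ω X) :
    g = k := by
  have h := sub_mem hg hk
  rw [mem_sobolev_iff hX] at h
  funext ℓ
  rw [← sub_eq_zero]
  refine eq_zero_of_forall_test μ Ω hΩ _ fun φ hφ => ?_
  refine (h ℓ φ hφ).trans ?_
  have h0 : (((u, g) - (u, k) : L2 μ Ω × (Fin p → L2 μ Ω)).1) = 0 := by simp
  rw [h0, neg_eq_zero]
  refine integral_eq_zero_of_ae ?_
  filter_upwards [Lp.coeFn_zero ℂ 2 (μ.restrict Ω)] with x hx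
  rw [hx]; simp

variable {μ Ω X} in
/-- Elements of `S¹₀(Ω)` may be integrated by parts against smooth functions that do not vanish at
the boundary. -/
theorem sobolevZero_integral_mul (hΩ : IsOpen Ω) (hX : ∀ ℓ x, divergence (X ℓ) x = 0)
    {w : L2 μ Ω × (Fin p → L2 μ Ω)} (hw : w ∈ sobolevZero μ Ω X) (ℓ : Fin p) {ψ : W → ℂ}
    (hψ : ContDiff ℝ ∞ ψ) (h0 : MemLp ψ 2 (μ.restrict Ω))
    (h1 : MemLp (along (X ℓ) ψ) 2 (μ.restrict Ω)) :
    ∫ x in Ω, w.2 ℓ x * ψ x ∂μ = -∫ x in Ω, w.1 x * along (X ℓ) ψ x ∂μ := by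
  have hcl : IsClosed {w : L2 μ Ω × (Fin p → L2 μ Ω) | ∫ x in Ω, w.2 ℓ x * ψ x ∂μ =
      -∫ x in Ω, w.1 x * along (X ℓ) ψ x ∂μ} := by
    refine isClosed_eq ?_ ?_
    · exact (continuous_integral_mul h0).comp (by fun_prop)
    · exact ((continuous_integral_mul h1).comp continuous_fst).neg
  refine closure_minimal (s := (sobolevCompact μ Ω X : Set (L2 μ Ω × (Fin p → L2 μ Ω)))) ?_ hcl
    hw.1
  rintro w ⟨hws, K, hK, hKΩ, hwK⟩
  rw [mem_sobolev_iff hX] at hws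
  -- By closedness `w` may be taken to vanish off a compact `K`. Then `χψ` is a test function that
  -- may replace `ψ`, once the weak derivatives are also known to vanish off `K`.
  obtain ⟨χ, hχ, hχc, hχΩ, hχ1, -⟩ := exists_cutoff hK hΩ hKΩ
  have hχ' : ContDiff ℝ ∞ fun x => (χ x : ℂ) := Complex.ofRealCLM.contDiff.comp hχ
  have hsupp : tsupport (fun x => (χ x : ℂ) * ψ x) ⊆ tsupport χ := by
    refine closure_mono fun x hx h0 => hx ?_
    simp [h0]
  have htest : IsTestFunction Ω fun x => (χ x : ℂ) * ψ x :=
    ⟨hχ'.mul hψ, hχc.of_isClosed_subset (isClosed_tsupport _) hsupp, hsupp.trans hχΩ⟩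
  have hg : ∀ᵐ x ∂μ.restrict Ω, x ∈ Ω \ K → w.2 ℓ x = 0 := by
    refine ae_eq_zero_of_forall_test μ Ω (hΩ.sdiff hK.isClosed) _ fun φ hφ => ?_
    rw [hws ℓ φ ⟨hφ.1, hφ.2.1, hφ.2.2.trans Set.sdiff_subset⟩, neg_eq_zero]
    refine integral_eq_zero_of_ae ?_
    filter_upwards [hwK] with x hx
    by_cases hxK : x ∈ K
    · have : along (X ℓ) φ x = 0 := by
        refine image_eq_zero_of_notMem_tsupport fun h => ?_
        exact (hφ.2.2 (tsupport_along_subset (X ℓ) φ h)).2 hxK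
      rw [this, mul_zero]; rfl
    · rw [hx hxK, zero_mul]; rfl
  have e := hws ℓ _ htest
  have e1 : ∫ x in Ω, w.2 ℓ x * ((χ x : ℂ) * ψ x) ∂μ = ∫ x in Ω, w.2 ℓ x * ψ x ∂μ := by
    refine integral_congr_ae ?_
    filter_upwards [hg, ae_restrict_mem hΩ.measurableSet] with x hx hxΩ
    by_cases hxK : x ∈ K
    · rw [(hχ1 x hxK).eq_of_nhds]; simp
    · rw [hx ⟨hxΩ, hxK⟩]; simp
  have e2 : ∫ x in Ω, w.1 x * along (X ℓ) (fun x => (χ x : ℂ) * ψ x) x ∂μ =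
      ∫ x in Ω, w.1 x * along (X ℓ) ψ x ∂μ := by
    refine integral_congr_ae ?_
    filter_upwards [hwK] with x hx
    by_cases hxK : x ∈ K
    · have : (fun x => (χ x : ℂ) * ψ x) =ᶠ[𝓝 x] ψ := by
        filter_upwards [hχ1 x hxK] with y hy
        rw [hy]; simp
      rw [along, this.fderiv_eq]; rfl
    · rw [hx hxK]; simp
  change ∫ x in Ω, w.2 ℓ x * ψ x ∂μ = -∫ x in Ω, w.1 x * along (X ℓ) ψ x ∂μ
  rw [← e1, ← e2]
  exact e

end WeakDerivatives

/-! ### Finiteness of the measure of the domain -/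

theorem inner_self_eq_ofReal {H : Type*} [NormedAddCommGroup H] [InnerProductSpace ℂ H] (x : H) :
    inner ℂ x x = ((‖x‖ ^ 2 : ℝ) : ℂ) := by
  rw [inner_self_eq_norm_sq_to_K]
  push_cast
  rfl

/-! ### Graphs of the Neumann and Dirichlet realizations -/

section Realizations

/-- The graph of `toLinearPMap` is the given subspace only when that is single-valued. For `u = 0`,
testing with `(0, g)` gives `g = 0`, so `f` is orthogonal to the dense form domain. -/
theorem mem_graph_toLinearPMap_formGraph {W : Type*} [MeasurableSpace W] {μ : Measure W}
    {Ω : Set W} {p : ℕ} {D : Submodule ℂ (L2 μ Ω × (Fin p → L2 μ Ω))}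
    (hD : ∀ f : L2 μ Ω, (∀ w ∈ D, inner ℂ w.1 f = 0) → f = 0) (u f : L2 μ Ω) :
    (u, f) ∈ (formGraph D).toLinearPMap.graph ↔ ∃ g : Fin p → L2 μ Ω, (u, g) ∈ D ∧
      ∀ w ∈ D, ∑ ℓ, inner ℂ (w.2 ℓ) (g ℓ) = inner ℂ w.1 f := by
  rw [Submodule.toLinearPMap_graph_eq]
  · rfl
  rintro ⟨u, f⟩ ⟨g, hg, h⟩ hu
  simp only at hu hg h
  subst hu
  have h1 := h _ hg
  simp only [inner_zero_left, inner_self_eq_ofReal] at h1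
  have h2 : ∑ ℓ, ‖g ℓ‖ ^ 2 = 0 := by exact_mod_cast h1
  rw [Finset.sum_eq_zero_iff_of_nonneg fun _ _ => sq_nonneg _] at h2
  have h3 : ∀ ℓ, g ℓ = 0 := fun ℓ => by simpa using h2 ℓ (Finset.mem_univ _)
  refine hD f fun w hw => ?_
  rw [← h w hw]
  simp [h3]

variable {W : Type*} [NormedAddCommGroup W] [NormedSpace ℝ W] [FiniteDimensional ℝ W]
  [MeasurableSpace W] [BorelSpace W] {μ : Measure W} [μ.IsAddHaarMeasure] {Ω : Set W}
  {p : ℕ} {X : Fin p → VField W}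

theorem mem_graph_neumann (hΩ : IsOpen Ω) (hX : ∀ ℓ x, divergence (X ℓ) x = 0) (u f : L2 μ Ω) :
    (u, f) ∈ (neumann μ Ω X).graph ↔ ∃ g : Fin p → L2 μ Ω, (u, g) ∈ sobolev μ Ω X ∧
      ∀ w ∈ sobolev μ Ω X, ∑ ℓ, inner ℂ (w.2 ℓ) (g ℓ) = inner ℂ w.1 f :=
  mem_graph_toLinearPMap_formGraph (fun f hf => sobolevZero_dense μ Ω hΩ hX f
    fun w hw => hf w hw.2) u f

theorem mem_graph_dirichlet (hΩ : IsOpen Ω) (hX : ∀ ℓ x, divergence (X ℓ) x = 0) (u f : L2 μ Ω) :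
    (u, f) ∈ (dirichlet μ Ω X).graph ↔ ∃ g : Fin p → L2 μ Ω, (u, g) ∈ sobolevZero μ Ω X ∧
      ∀ w ∈ sobolevZero μ Ω X, ∑ ℓ, inner ℂ (w.2 ℓ) (g ℓ) = inner ℂ w.1 f :=
  mem_graph_toLinearPMap_formGraph (sobolevZero_dense μ Ω hΩ hX) u f

end Realizations

/-! ### Compact operators and functions supported far out -/

section L2Norm

variable {W : Type*} [MeasurableSpace W] {μ : Measure W}

theorem norm_sq_eq_integral (u : Lp ℂ 2 μ) : ‖u‖ ^ 2 = ∫ x, ‖u x‖ ^ 2 ∂μ := by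
  have h := L2.inner_def (𝕜 := ℂ) u u
  simp only [inner_self_eq_ofReal] at h
  rw [integral_complex_ofReal] at h
  exact_mod_cast h

theorem norm_sq_toLp_eq_integral {f : W → ℂ} (hf : MemLp f 2 μ) :
    ‖hf.toLp‖ ^ 2 = ∫ x, ‖f x‖ ^ 2 ∂μ := by
  rw [norm_sq_eq_integral]
  refine integral_congr_ae ?_
  filter_upwards [hf.coeFn_toLp] with x hx
  rw [hx]

theorem integrable_norm_sq {f : W → ℂ} (hf : MemLp f 2 μ) : Integrable (fun x => ‖f x‖ ^ 2) μ :=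
  (memLp_two_iff_integrable_sq_norm hf.aestronglyMeasurable).1 hf

/-- The mass of a square integrable function far out is small. -/
theorem eventually_norm_inner_le {B : ℕ → Set W} (hBm : ∀ n, MeasurableSet (B n))
    (hB : Monotone B) (hBU : ⋃ n, B n = Set.univ) (z : Lp ℂ 2 μ) {δ : ℝ} (hδ : 0 < δ) :
    ∀ᶠ n in atTop, ∀ y : Lp ℂ 2 μ, (∀ᵐ x ∂μ, x ∈ B n → y x = 0) →
      ‖inner ℂ y z‖ ≤ δ * ‖y‖ := by
  have h1 : Tendsto (fun n => ∫ x in (B n)ᶜ, ‖z x‖ ^ 2 ∂μ) atTop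
      (𝓝 (∫ x in ⋂ n, (B n)ᶜ, ‖z x‖ ^ 2 ∂μ)) := by
    refine tendsto_setIntegral_of_antitone (fun n => (hBm n).compl) ?_ ?_
    · intro m n hmn
      exact Set.compl_subset_compl.2 (hB hmn)
    · exact ⟨0, (integrable_norm_sq (Lp.memLp z)).integrableOn⟩
  rw [← Set.compl_iUnion, hBU, Set.compl_univ, setIntegral_empty] at h1
  filter_upwards [h1.eventually_lt_const (by positivity : 0 < δ ^ 2)] with n hn y hy
  have hz : MemLp ((B n)ᶜ.indicator z) 2 μ := (Lp.memLp z).indicator (hBm n).compl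
  have e1 : inner ℂ y z = inner ℂ y hz.toLp := by
    rw [L2.inner_def, L2.inner_def]
    refine integral_congr_ae ?_
    filter_upwards [hy, hz.coeFn_toLp] with x hx hx'
    rw [hx']
    by_cases hxB : x ∈ B n
    · rw [hx hxB, inner_zero_left, inner_zero_left]
    · rw [Set.indicator_of_mem hxB]
  have e2 : ‖hz.toLp‖ ^ 2 = ∫ x in (B n)ᶜ, ‖z x‖ ^ 2 ∂μ := by
    rw [norm_sq_toLp_eq_integral, ← integral_indicator (hBm n).compl]
    refine integral_congr_ae (Eventually.of_forall fun x => ?_)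
    by_cases hxB : x ∈ (B n)ᶜ <;> simp [hxB]
  rw [e1]
  have e3 : ‖hz.toLp‖ ≤ δ := by
    rw [← e2] at hn
    exact (lt_of_pow_lt_pow_left₀ 2 hδ.le hn).le
  calc ‖inner ℂ y hz.toLp‖ ≤ ‖y‖ * ‖hz.toLp‖ := norm_inner_le_norm _ _
    _ ≤ ‖y‖ * δ := by gcongr
    _ = δ * ‖y‖ := mul_comm _ _

/-- A compact operator is small on functions supported far out. -/
theorem IsCompactOperator.exists_re_inner_le {B : ℕ → Set W} (hBm : ∀ n, MeasurableSet (B n))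
    (hB : Monotone B) (hBU : ⋃ n, B n = Set.univ) {T : Lp ℂ 2 μ →L[ℂ] Lp ℂ 2 μ}
    (hT : IsCompactOperator T) {δ : ℝ} (hδ : 0 < δ) :
    ∃ n, ∀ y : Lp ℂ 2 μ, (∀ᵐ x ∂μ, x ∈ B n → y x = 0) →
      (inner ℂ y (T y)).re ≤ δ * ‖y‖ ^ 2 := by
  obtain ⟨C, hC, hC'⟩ := hT.image_closedBall_subset_compact (𝕜₁ := ℂ)
    (f := (T : Lp ℂ 2 μ →ₗ[ℂ] Lp ℂ 2 μ)) 1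
  -- A finite `δ / 2`-net of the image of the unit ball reduces the claim to the tails of finitely
  -- many functions.
  obtain ⟨t, htf, ht⟩ := Metric.totallyBounded_iff.1 (hC.totallyBounded.subset hC') (δ / 2)
    (by positivity)
  have hev : ∀ᶠ n in atTop, ∀ z ∈ t, ∀ y : Lp ℂ 2 μ, (∀ᵐ x ∂μ, x ∈ B n → y x = 0) →
      ‖inner ℂ y z‖ ≤ δ / 2 * ‖y‖ :=
    (htf.eventually_all).2 fun z _ => eventually_norm_inner_le hBm hB hBU z (by positivity)
  obtain ⟨n, hn⟩ := hev.exists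
  refine ⟨n, fun y hy => ?_⟩
  rcases eq_or_ne y 0 with rfl | hy0
  · simp
  have hny : 0 < ‖y‖ := norm_pos_iff.2 hy0
  set k : ℂ := ((‖y‖⁻¹ : ℝ) : ℂ) with hk
  have hball : k • y ∈ Metric.closedBall (0 : Lp ℂ 2 μ) 1 := by
    rw [mem_closedBall_zero_iff, norm_smul, hk, Complex.norm_real, norm_inv, norm_norm,
      inv_mul_cancel₀ hny.ne']
  have h1 := ht (Set.mem_image_of_mem _ hball)
  simp only [Set.mem_iUnion, exists_prop, Metric.mem_ball, dist_eq_norm] at h1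
  obtain ⟨z, hz, hz'⟩ := h1
  have hTz : ‖T (k • y) - z‖ ≤ δ / 2 := hz'.le
  have h2 : (inner ℂ y (T (k • y))).re ≤ δ * ‖y‖ := by
    have e : inner ℂ y (T (k • y)) = inner ℂ y (T (k • y) - z) + inner ℂ y z := by
      rw [inner_sub_right]; ring
    calc (inner ℂ y (T (k • y))).re ≤ ‖inner ℂ y (T (k • y))‖ := Complex.re_le_norm _
      _ ≤ ‖inner ℂ y (T (k • y) - z)‖ + ‖inner ℂ y z‖ := by rw [e]; exact norm_add_le _ _
      _ ≤ ‖y‖ * (δ / 2) + δ / 2 * ‖y‖ := by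
          gcongr
          · exact (norm_inner_le_norm _ _).trans (by gcongr)
          · exact hn z hz y hy
      _ = δ * ‖y‖ := by ring
  rw [map_smul, inner_smul_right, hk, Complex.re_ofReal_mul, inv_mul_le_iff₀ hny] at h2
  linarith

end L2Norm

/-- As `δ ≤ 1 / 2`, the recursion contracts the excess over `2 A`. Iterating `n` times against the
exponential bound leaves `C L ^ k (δ L) ^ n`, which tends to zero. -/
theorem le_two_mul_of_le_add_mul {a : ℕ → ℝ} {A C L δ : ℝ} (hA : 0 ≤ A) (hC : 0 ≤ C) (hL : 0 ≤ L)
    (hδ0 : 0 ≤ δ) (hδ : δ ≤ 1 / 2) (hδL : δ * L ≤ 1 / 2) (ha : ∀ k, a k ≤ A + δ * a (k + 1))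
    (haL : ∀ k, a k ≤ C * L ^ k) (k : ℕ) : a k ≤ 2 * A := by
  have h1 : ∀ n k, a k - 2 * A ≤ δ ^ n * (a (k + n) - 2 * A) := by
    intro n
    induction n with
    | zero => intro k; simp
    | succ n ih =>
      intro k
      have h2 := ih k
      have h3 : a (k + n) - 2 * A ≤ δ * (a (k + n + 1) - 2 * A) := by
        have := ha (k + n); nlinarith
      have h4 : δ ^ n * (a (k + n) - 2 * A) ≤ δ ^ n * (δ * (a (k + n + 1) - 2 * A)) := by gcongr
      calc _ ≤ _ := h2
        _ ≤ _ := h4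
        _ = δ ^ (n + 1) * (a (k + (n + 1)) - 2 * A) := by rw [pow_succ, ← add_assoc]; ring
  have h2 : ∀ n, a k - 2 * A ≤ C * L ^ k * (1 / 2) ^ n := by
    intro n
    have h3 : δ ^ n * (a (k + n) - 2 * A) ≤ δ ^ n * (C * L ^ (k + n)) := by
      have := haL (k + n)
      gcongr; linarith
    have h4 : δ ^ n * (C * L ^ (k + n)) = C * L ^ k * (δ * L) ^ n := by
      rw [mul_pow, pow_add]; ring
    have h5 : C * L ^ k * (δ * L) ^ n ≤ C * L ^ k * (1 / 2) ^ n := by gcongr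
    linarith [h1 n k]
  have h3 : Tendsto (fun n : ℕ => C * L ^ k * (1 / 2 : ℝ) ^ n) atTop (𝓝 (C * L ^ k * 0)) :=
    (tendsto_pow_atTop_nhds_zero_of_lt_one (by norm_num) (by norm_num)).const_mul _
  rw [mul_zero] at h3
  have := ge_of_tendsto' h3 h2
  linarith

/-! ### Volume growth of the domain along dilated balls -/

section FiniteMeasure

variable {W : Type*} [NormedAddCommGroup W] [NormedSpace ℝ W] [FiniteDimensional ℝ W]
  {r : ℕ} (𝒲 : Fin r → Submodule ℝ W) [DirectSum.Decomposition 𝒲]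

/-- The smallest weight `1` dominates for `t ≤ 1`, the largest weight `r` for `t ≥ 1`. -/
theorem exists_norm_dilation_le : ∃ C : ℝ, 1 ≤ C ∧ ∀ (t : ℝ) (w : W), 0 ≤ t →
    (t ≤ 1 → ‖dilation 𝒲 t w‖ ≤ C * t * ‖w‖) ∧ (1 ≤ t → ‖dilation 𝒲 t w‖ ≤ C * t ^ r * ‖w‖) := by
  let P : Fin r → W →L[ℝ] W := fun i => LinearMap.toContinuousLinearMap
    { toFun := fun w => (DirectSum.decompose 𝒲 w i : W)
      map_add' := fun v w => by simp [DirectSum.decompose_add]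
      map_smul' := fun c w => by simp [DirectSum.decompose_smul, DirectSum.smul_apply] }
  have hP : ∀ i w, ‖(DirectSum.decompose 𝒲 w i : W)‖ ≤ ‖P i‖ * ‖w‖ := fun i w => (P i).le_opNorm w
  have key : ∀ (t : ℝ) (w : W) (s : ℝ), 0 ≤ t → 0 ≤ s → (∀ i : Fin r, t ^ ((i : ℕ) + 1) ≤ s) →
      ‖dilation 𝒲 t w‖ ≤ (1 + ∑ i, ‖P i‖) * s * ‖w‖ := by
    intro t w s ht hs h
    calc ‖dilation 𝒲 t w‖ ≤ ∑ i, s * (‖P i‖ * ‖w‖) := by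
          refine (norm_sum_le _ _).trans (Finset.sum_le_sum fun i _ => ?_)
          rw [norm_smul, Real.norm_of_nonneg (pow_nonneg ht _)]
          exact mul_le_mul (h i) (hP i w) (norm_nonneg _) hs
      _ = (∑ i, ‖P i‖) * s * ‖w‖ := by
          rw [← Finset.mul_sum, ← Finset.sum_mul]; ring
      _ ≤ _ := by gcongr; linarith
  have hnn : 0 ≤ ∑ i, ‖P i‖ := Finset.sum_nonneg fun i _ => norm_nonneg (P i)
  refine ⟨1 + ∑ i, ‖P i‖, by linarith, fun t w ht => ⟨fun h1 => ?_, fun h1 => ?_⟩⟩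
  · refine key t w t ht ht fun i => ?_
    rw [pow_succ]
    exact mul_le_of_le_one_left ht (pow_le_one₀ ht h1)
  · refine key t w (t ^ r) ht (by positivity) fun i => ?_
    exact pow_le_pow_right₀ h1 i.2

variable [MeasurableSpace W] [BorelSpace W] {μ : Measure W} [μ.IsAddHaarMeasure] {Ω : Set W}
  {p : ℕ} {X : Fin p → VField W}

variable {𝒲} in
/-- If the Neumann realization has compact resolvent, then the domain has finite measure. -/
theorem measure_lt_top_of_isCompactOperator (hhom : ∀ ℓ, IsHomogeneous 𝒲 1 (X ℓ))
    [CompleteSpace (formSpace (sobolev μ Ω X))]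
    (hT : IsCompactOperator (formInverse (sobolev μ Ω X))) : μ Ω < ⊤ := by
  have hX : ∀ ℓ x, divergence (X ℓ) x = 0 := fun ℓ => (hhom ℓ).divergence_eq_zero
  obtain ⟨C₀, hC₀, hdil⟩ := exists_norm_dilation_le 𝒲
  -- With this ratio `h_{1/s}` maps the ball of radius `2` into the unit ball, so a cutoff equal to
  -- `1` on `B k` can be supported in `B (k + 1)`.
  set s : ℝ := 2 * C₀ with hs
  have hs2 : 2 ≤ s := by linarith
  have hs0 : 0 < s := by linarith
  have hs1 : s⁻¹ ≤ 1 := inv_le_one_of_one_le₀ (by linarith)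
  -- the dilated balls
  let B : ℕ → Set W := fun k => {x | ‖dilation 𝒲 (s ^ k)⁻¹ x‖ ≤ 1}
  have hsk : ∀ k : ℕ, 0 < (s ^ k)⁻¹ := fun k => by positivity
  have hsk1 : ∀ k : ℕ, (s ^ k)⁻¹ ≤ 1 := fun k => inv_le_one_of_one_le₀ (one_le_pow₀ (by linarith))
  have hBc : ∀ k, IsClosed (B k) := fun k =>
    isClosed_le (dilationL 𝒲 (s ^ k)⁻¹).continuous.norm continuous_const
  have hstep : ∀ (k : ℕ) (x : W), ‖dilation 𝒲 (s ^ k)⁻¹ x‖ ≤ 2 → x ∈ B (k + 1) := by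
    intro k x hx
    change ‖dilation 𝒲 (s ^ (k + 1))⁻¹ x‖ ≤ 1
    have : (s ^ (k + 1))⁻¹ = s⁻¹ * (s ^ k)⁻¹ := by rw [pow_succ, mul_inv, mul_comm]
    rw [this, ← dilation_dilation]
    calc _ ≤ C₀ * s⁻¹ * ‖dilation 𝒲 (s ^ k)⁻¹ x‖ := (hdil _ _ (by positivity)).1 hs1
      _ ≤ C₀ * s⁻¹ * 2 := by gcongr
      _ = 1 := by rw [hs]; field_simp
  have hBmono : Monotone B := monotone_nat_of_le_succ fun k x hx => hstep k x (le_trans hx (by norm_num))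
  have hBU : ⋃ k, B k = Set.univ := by
    rw [Set.eq_univ_iff_forall]
    intro x
    have h1 : Tendsto (fun k : ℕ => C₀ * (s⁻¹) ^ k * ‖x‖) atTop (𝓝 (C₀ * 0 * ‖x‖)) := by
      refine ((tendsto_pow_atTop_nhds_zero_of_lt_one (by positivity) ?_).const_mul C₀).mul_const _
      exact inv_lt_one_of_one_lt₀ (by linarith)
    rw [mul_zero, zero_mul] at h1
    obtain ⟨k, hk⟩ := (h1.eventually_le_const (by norm_num : (0 : ℝ) < 1)).exists
    refine Set.mem_iUnion.2 ⟨k, le_trans ((hdil _ _ (hsk k).le).1 (hsk1 k)) ?_⟩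
    rwa [← inv_pow]
  set N := Module.finrank ℝ W
  have hBsub : ∀ k : ℕ, B k ⊆ Metric.closedBall 0 (C₀ * (s ^ k) ^ r) := by
    intro k x hx
    rw [mem_closedBall_zero_iff]
    have h1 := (hdil (s ^ k) (dilation 𝒲 (s ^ k)⁻¹ x) (by positivity)).2
      (one_le_pow₀ (by linarith))
    rw [dilation_dilation_inv 𝒲 (by positivity)] at h1
    calc ‖x‖ ≤ _ := h1
      _ ≤ C₀ * (s ^ k) ^ r * 1 := by gcongr; exact hx
      _ = _ := mul_one _
  have hBcomp : ∀ k, IsCompact (B k) := fun k =>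
    (isCompact_closedBall _ _).of_isClosed_subset (hBc k) (hBsub k)
  have hBfin : ∀ k, μ (Ω ∩ B k) ≠ ⊤ := fun k =>
    ((measure_mono Set.inter_subset_right).trans_lt (hBcomp k).measure_lt_top).ne
  let m : ℕ → ℝ := fun k => μ.real (Ω ∩ B k)
  set C₁ : ℝ := μ.real (Metric.closedBall (0 : W) 1) * C₀ ^ N with hC₁
  set L : ℝ := s ^ (r * N) with hLdef
  have hL1 : 1 ≤ L := one_le_pow₀ (by linarith)
  have hm : ∀ k, m k ≤ C₁ * L ^ k := by
    intro k
    calc m k ≤ μ.real (Metric.closedBall (0 : W) (C₀ * (s ^ k) ^ r)) :=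
          measureReal_mono (Set.inter_subset_right.trans (hBsub k))
            (isCompact_closedBall _ _).measure_lt_top.ne
      _ = (C₀ * (s ^ k) ^ r) ^ N * μ.real (Metric.closedBall (0 : W) 1) := by
          rw [measureReal_def, Measure.addHaar_closedBall' μ _ (by positivity), ENNReal.toReal_mul,
            ENNReal.toReal_ofReal (by positivity)]
          rfl
      _ = C₁ * L ^ k := by
          rw [hC₁, hLdef, mul_pow, ← pow_mul, ← pow_mul, ← pow_mul,
            show k * (r * N) = r * N * k by ring]
          ring
  -- the cutoff functions
  obtain ⟨χ, hχ, hχc, hχ2, hχ1, hχI⟩ := exists_cutoff (isCompact_closedBall (0 : W) 1)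
    (Metric.isOpen_ball (x := (0 : W)) (ε := 2)) (Metric.closedBall_subset_ball (by norm_num))
  let χ' : W → ℂ := fun x => (χ x : ℂ)
  have hχ' : ContDiff ℝ ∞ χ' := Complex.ofRealCLM.contDiff.comp hχ
  have hχ'c : HasCompactSupport χ' := hχc.comp_left Complex.ofReal_zero
  have hts : tsupport χ' ⊆ Metric.ball 0 2 := by
    refine (closure_mono fun x hx => ?_).trans hχ2
    simpa [χ'] using hx
  obtain ⟨M, hM0, hM⟩ : ∃ M : ℝ, 0 ≤ M ∧ ∀ ℓ x, ‖along (X ℓ) χ' x‖ ^ 2 ≤ M := by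
    have h1 : ∀ ℓ, ∃ M : ℝ, ∀ x, ‖along (X ℓ) χ' x‖ ≤ M := fun ℓ =>
      (hasCompactSupport_along (X ℓ) hχ'c).exists_bound_of_continuous (continuous_along (X ℓ) hχ')
    choose M hM using h1
    refine ⟨∑ ℓ, M ℓ ^ 2, Finset.sum_nonneg fun _ _ => sq_nonneg _, fun ℓ x => ?_⟩
    refine le_trans ?_ (Finset.single_le_sum (fun i _ => sq_nonneg (M i)) (Finset.mem_univ ℓ))
    gcongr
    exact hM ℓ x
  -- `L` bounds the volume growth per scale, so `δ L = 1 / 2`, as the recursion requires.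
  set δ : ℝ := (2 * L)⁻¹ with hδ
  have hδ0 : 0 < δ := by positivity
  set K : ℝ := 1 + p * M with hK
  have hK1 : 1 ≤ K := by
    have : 0 ≤ (p : ℝ) * M := by positivity
    linarith
  obtain ⟨n, hn⟩ := IsCompactOperator.exists_re_inner_le (μ := μ.restrict Ω)
    (fun k => (hBc k).measurableSet) hBmono hBU hT (δ := δ / K) (by positivity)
  -- The dilated cutoff `ψ` has form norm squared at most `K m (k + 1)`: its derivatives carry a
  -- factor `s ^ (-k) ≤ 1`. For `y = ψ` restricted to the complement of `B n`, the duality estimate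
  -- reads `‖y‖⁴ ≤ K m (k + 1) · (δ / K) ‖y‖²`, and `‖y‖²` dominates the volume of `Ω` in `B k \ B
  -- n`.
  have hrec : ∀ k, m k ≤ m n + δ * m (k + 1) := by
    intro k
    let ψ : W → ℂ := χ' ∘ dilation 𝒲 (s ^ k)⁻¹
    have hψ : ContDiff ℝ ∞ ψ := hχ'.comp (contDiff_dilation 𝒲 _)
    have hψ0 : ∀ x, x ∉ B (k + 1) → ψ x = 0 := by
      intro x hx
      refine image_eq_zero_of_notMem_tsupport (f := χ') fun h => hx (hstep k x ?_)
      exact (mem_ball_zero_iff.1 (hts h)).le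
    have hψn : ∀ x, ‖ψ x‖ ^ 2 ≤ 1 := by
      intro x
      have h1 := hχI (dilation 𝒲 (s ^ k)⁻¹ x)
      have h2 : ‖ψ x‖ = χ (dilation 𝒲 (s ^ k)⁻¹ x) := by
        simp only [ψ, χ', Function.comp, Complex.norm_real]
        exact Real.norm_of_nonneg h1.1
      rw [h2]
      exact pow_le_one₀ h1.1 h1.2
    have hal : ∀ ℓ x, along (X ℓ) ψ x =
        (s ^ k)⁻¹ • along (X ℓ) χ' (dilation 𝒲 (s ^ k)⁻¹ x) := by
      intro ℓ x
      have := (hhom ℓ).along_comp_dilation (hsk k) (hχ'.differentiable (by simp)) x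
      rwa [pow_one] at this
    have hal0 : ∀ ℓ x, x ∉ B (k + 1) → along (X ℓ) ψ x = 0 := by
      intro ℓ x hx
      have : along (X ℓ) χ' (dilation 𝒲 (s ^ k)⁻¹ x) = 0 := by
        refine image_eq_zero_of_notMem_tsupport fun h => hx (hstep k x ?_)
        exact (mem_ball_zero_iff.1 (hts (tsupport_along_subset _ _ h))).le
      rw [hal, this, smul_zero]
    have haln : ∀ ℓ x, ‖along (X ℓ) ψ x‖ ^ 2 ≤ M := by
      intro ℓ x
      rw [hal, norm_smul, Real.norm_of_nonneg (hsk k).le]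
      refine le_trans ?_ (hM ℓ (dilation 𝒲 (s ^ k)⁻¹ x))
      gcongr
      exact mul_le_of_le_one_left (norm_nonneg _) (hsk1 k)
    have hψc : HasCompactSupport ψ := HasCompactSupport.intro (hBcomp (k + 1)) hψ0
    have hψL : MemLp ψ 2 (μ.restrict Ω) := hψ.continuous.memLp_of_hasCompactSupport hψc
    have hψL' : ∀ ℓ, MemLp (along (X ℓ) ψ) 2 (μ.restrict Ω) := fun ℓ =>
      (continuous_along (X ℓ) hψ).memLp_of_hasCompactSupport (hasCompactSupport_along (X ℓ) hψc)
    have hmem := smooth_mem_sobolev μ Ω hX hψ hψL hψL'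
    have hbound : ∀ (f : W → ℂ) (c : ℝ) (hf : MemLp f 2 (μ.restrict Ω)), (∀ x, ‖f x‖ ^ 2 ≤ c) →
        (∀ x, x ∉ B (k + 1) → f x = 0) → ‖hf.toLp‖ ^ 2 ≤ c * m (k + 1) := by
      intro f c hf hfc hf0
      rw [norm_sq_toLp_eq_integral]
      have h1 : ∫ x in Ω, ‖f x‖ ^ 2 ∂μ ≤
          ∫ x in Ω, (B (k + 1)).indicator (fun _ => c) x ∂μ := by
        refine integral_mono (integrable_norm_sq hf) ?_ fun x => ?_
        · refine IntegrableOn.integrable_indicator ?_ (hBc _).measurableSet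
          refine integrableOn_const ?_
          rw [Measure.restrict_apply (hBc _).measurableSet, Set.inter_comm]
          exact hBfin _
        · by_cases hx : x ∈ B (k + 1)
          · simp only [Set.indicator_of_mem hx]; exact hfc x
          · simp [Set.indicator_of_notMem hx, hf0 x hx]
      refine h1.trans (le_of_eq ?_)
      rw [integral_indicator (hBc _).measurableSet, setIntegral_const, measureReal_def,
        Measure.restrict_apply (hBc _).measurableSet, Set.inter_comm, smul_eq_mul, mul_comm]
      rfl
    have hyL : MemLp ((B n)ᶜ.indicator ψ) 2 (μ.restrict Ω) :=
      hψL.indicator (hBc n).measurableSet.compl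
    set y : L2 μ Ω := hyL.toLp with hy
    have hy0 : ∀ᵐ x ∂μ.restrict Ω, x ∈ B n → y x = 0 := by
      filter_upwards [hyL.coeFn_toLp] with x hx hxB
      rw [hy, hx, Set.indicator_of_notMem (by simpa using hxB)]
    have h1 := hn y hy0
    have h2 := norm_inner_sq_le_of_mem hmem y
    have h3 : inner ℂ hψL.toLp y = ((‖y‖ ^ 2 : ℝ) : ℂ) := by
      have e : inner ℂ hψL.toLp y = inner ℂ y y := by
        rw [L2.inner_def, L2.inner_def]
        refine integral_congr_ae ?_
        filter_upwards [hyL.coeFn_toLp, hψL.coeFn_toLp] with x hx hx'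
        rw [hx', hy, hx]
        by_cases hxB : x ∈ (B n)ᶜ
        · rw [Set.indicator_of_mem hxB]
        · rw [Set.indicator_of_notMem hxB, inner_zero_right, inner_zero_right]
      rw [e, inner_self_eq_ofReal]
    simp only [h3, Complex.norm_real, norm_pow, norm_norm] at h2
    have h4 : ‖hψL.toLp‖ ^ 2 + ∑ ℓ, ‖(hψL' ℓ).toLp‖ ^ 2 ≤ K * m (k + 1) := by
      have h5 : ∑ ℓ, ‖(hψL' ℓ).toLp‖ ^ 2 ≤ ∑ _ℓ : Fin p, M * m (k + 1) :=
        Finset.sum_le_sum fun ℓ _ => hbound _ M (hψL' ℓ) (haln ℓ) (hal0 ℓ)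
      have h6 := hbound _ 1 hψL hψn hψ0
      rw [Finset.sum_const, Finset.card_univ, Fintype.card_fin, nsmul_eq_mul] at h5
      rw [hK]
      linarith
    have hm0 : 0 ≤ m (k + 1) := measureReal_nonneg
    have h5 : ‖y‖ ^ 2 ≤ δ * m (k + 1) := by
      rcases (sq_nonneg ‖y‖).eq_or_lt with h0 | h0
      · rw [← h0]; positivity
      refine le_of_mul_le_mul_right ?_ h0
      calc ‖y‖ ^ 2 * ‖y‖ ^ 2 = (‖y‖ ^ 2) ^ 2 := by ring
        _ ≤ _ := h2
        _ ≤ (K * m (k + 1)) * (δ / K * ‖y‖ ^ 2) := by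
            refine mul_le_mul h4 h1 ?_ (by positivity)
            rw [re_inner_formInverse]; positivity
        _ = δ * m (k + 1) * ‖y‖ ^ 2 := by field_simp
    have h6 : m k ≤ m n + ‖y‖ ^ 2 := by
      have e1 : ‖y‖ ^ 2 = ∫ x in Ω, ‖(B n)ᶜ.indicator ψ x‖ ^ 2 ∂μ := norm_sq_toLp_eq_integral hyL
      have e2 : μ.real (Ω ∩ (B k \ B n)) ≤ ∫ x in Ω, ‖(B n)ᶜ.indicator ψ x‖ ^ 2 ∂μ := by
        have hmeas : MeasurableSet (B k \ B n) := (hBc k).measurableSet.diff (hBc n).measurableSet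
        have hfin' : (μ.restrict Ω) (B k \ B n) ≠ ⊤ := by
          rw [Measure.restrict_apply hmeas, Set.inter_comm]
          exact ne_top_of_le_ne_top (hBfin k)
            (measure_mono (Set.inter_subset_inter_right _ Set.sdiff_subset))
        have e3 : ∫ x in Ω, (B k \ B n).indicator (fun _ => (1 : ℝ)) x ∂μ =
            μ.real (Ω ∩ (B k \ B n)) := by
          rw [integral_indicator hmeas, setIntegral_const, measureReal_def,
            Measure.restrict_apply hmeas, Set.inter_comm, smul_eq_mul, mul_one]
          rfl
        rw [← e3]
        refine integral_mono ?_ (integrable_norm_sq hyL) fun x => ?_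
        · exact IntegrableOn.integrable_indicator (integrableOn_const hfin') hmeas
        · by_cases hx : x ∈ B k \ B n
          · have hx1 : χ (dilation 𝒲 (s ^ k)⁻¹ x) = 1 :=
              (hχ1 _ (mem_closedBall_zero_iff.2 hx.1)).eq_of_nhds
            have hx2 : x ∈ (B n)ᶜ := hx.2
            simp [Set.indicator_of_mem hx, Set.indicator_of_mem hx2, ψ, χ', hx1]
          · simp only [Set.indicator_of_notMem hx]
            positivity
      rw [e1]
      refine le_trans ?_ (add_le_add_right e2 _)
      refine le_trans (measureReal_mono ?_ ?_) (measureReal_union_le _ _)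
      · intro x hx
        by_cases hxn : x ∈ B n
        · exact Or.inl ⟨hx.1, hxn⟩
        · exact Or.inr ⟨hx.1, hx.2, hxn⟩
      · refine (measure_union_lt_top (hBfin n).lt_top ?_).ne
        exact (measure_mono (Set.inter_subset_inter_right _ Set.sdiff_subset)).trans_lt
          (hBfin k).lt_top
    linarith
  have hfinal := le_two_mul_of_le_add_mul (A := m n) (C := C₁) (L := L) (δ := δ)
    measureReal_nonneg (by positivity) (by positivity) hδ0.le
    (by rw [hδ, one_div]; exact inv_anti₀ (by norm_num) (by linarith))
    (by rw [hδ]; apply le_of_eq; field_simp) hrec hm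
  have hlim : Tendsto (fun k => μ (Ω ∩ B k)) atTop (𝓝 (μ (⋃ k, Ω ∩ B k))) :=
    tendsto_measure_iUnion_atTop fun i j hij => Set.inter_subset_inter_right _ (hBmono hij)
  rw [← Set.inter_iUnion, hBU, Set.inter_univ] at hlim
  refine lt_of_le_of_lt (le_of_tendsto' hlim fun k => ?_) (ENNReal.ofReal_lt_top (r := 2 * m n))
  rw [← ofReal_measureReal (hBfin k)]
  exact ENNReal.ofReal_le_ofReal (hfinal k)

end FiniteMeasure

/-! ### Eigenfunctions on the whole space -/

/-- A pairwise orthogonal family of nonzero vectors in a separable space is countable. -/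
theorem countable_of_pairwise_orthogonal {H ι : Type*} [NormedAddCommGroup H]
    [InnerProductSpace ℂ H] [TopologicalSpace.SeparableSpace H] {f : ι → H}
    (h0 : ∀ i, f i ≠ 0) (h : ∀ i j, i ≠ j → inner ℂ (f i) (f j) = 0) : Countable ι := by
  let e : ι → H := fun i => ((‖f i‖⁻¹ : ℝ) : ℂ) • f i
  have he : ∀ i, ‖e i‖ = 1 := by
    intro i
    rw [norm_smul, Complex.norm_real, norm_inv, norm_norm, inv_mul_cancel₀]
    exact norm_ne_zero_iff.2 (h0 i)
  have hd : ∀ i j, i ≠ j → 1 ≤ ‖e i - e j‖ := by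
    intro i j hij
    have h1 : inner ℂ (e i) (e j) = 0 := by
      rw [inner_smul_left, inner_smul_right, h i j hij]; simp
    have h2 := norm_sub_sq (𝕜 := ℂ) (e i) (e j)
    rw [h1, he, he] at h2
    simp only [map_zero, mul_zero, sub_zero] at h2
    nlinarith [norm_nonneg (e i - e j)]
  have : (Set.univ : Set ι).Countable := by
    refine Set.PairwiseDisjoint.countable_of_isOpen (s := fun i => Metric.ball (e i) (1 / 2))
      ?_ (fun _ _ => Metric.isOpen_ball) fun i _ => ⟨e i, Metric.mem_ball_self (by norm_num)⟩
    intro i _ j _ hij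
    refine Metric.ball_disjoint_ball ?_
    rw [dist_eq_norm]
    linarith [hd i j hij]
  exact Set.countable_univ_iff.1 this

theorem memLp_indicator {W : Type*} [TopologicalSpace W] [MeasurableSpace W] [BorelSpace W]
    {μ : Measure W} {Ω : Set W} (hΩ : IsOpen Ω) (u : L2 μ Ω) : MemLp (Ω.indicator u) 2 μ :=
  (memLp_indicator_iff_restrict hΩ.measurableSet).2 (Lp.memLp u)

theorem integral_indicator_mul {W : Type*} [TopologicalSpace W] [MeasurableSpace W]
    [BorelSpace W] {μ : Measure W} {Ω : Set W} (hΩ : IsOpen Ω) (u : L2 μ Ω) (φ : W → ℂ) :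
    ∫ x, Ω.indicator u x * φ x ∂μ = ∫ x in Ω, u x * φ x ∂μ := by
  rw [← integral_indicator hΩ.measurableSet]
  refine integral_congr_ae (Eventually.of_forall fun x => ?_)
  by_cases hx : x ∈ Ω <;> simp [hx]

theorem inner_restrict_toLp {W : Type*} [TopologicalSpace W] [MeasurableSpace W]
    [BorelSpace W] {μ : Measure W} {Ω : Set W} (hΩ : IsOpen Ω) {f : W → ℂ} (hf : MemLp f 2 μ)
    (u : L2 μ Ω) :
    inner ℂ (hf.restrict Ω).toLp u = ∫ x, Ω.indicator u x * starRingEnd ℂ (f x) ∂μ := by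
  rw [inner_toLp_eq_integral, integral_indicator_mul hΩ]

section WholeSpace

variable {W : Type*} [NormedAddCommGroup W] [NormedSpace ℝ W] [FiniteDimensional ℝ W]
  {r : ℕ} (𝒲 : Fin r → Submodule ℝ W) [DirectSum.Decomposition 𝒲]

/-- The dilation as a linear isomorphism. -/
def dilationEquiv {t : ℝ} (ht : 0 < t) : W ≃L[ℝ] W :=
  ContinuousLinearEquiv.equivOfInverse (dilationL 𝒲 t) (dilationL 𝒲 t⁻¹)
    (dilation_inv_dilation 𝒲 ht) (dilation_dilation_inv 𝒲 ht)

theorem IsTestFunction.comp_dilation {t : ℝ} (ht : 0 < t) {φ : W → ℂ}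
    (hφ : IsTestFunction Set.univ φ) : IsTestFunction Set.univ (φ ∘ dilation 𝒲 t) :=
  ⟨hφ.1.comp (contDiff_dilation 𝒲 t),
    hφ.2.1.comp_homeomorph (dilationEquiv 𝒲 ht).toHomeomorph, Set.subset_univ _⟩

variable [MeasurableSpace W] [BorelSpace W] (μ : Measure W) [μ.IsAddHaarMeasure]

theorem exists_map_dilation {t : ℝ} (ht : 0 < t) :
    ∃ k : ℝ, 0 < k ∧ μ.map (dilation 𝒲 t) = ENNReal.ofReal k • μ := by
  have hdet : LinearMap.det (dilationEquiv 𝒲 ht : W →ₗ[ℝ] W) ≠ 0 :=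
    (LinearEquiv.isUnit_det' (dilationEquiv 𝒲 ht).toLinearEquiv).ne_zero
  refine ⟨_, ?_, Measure.map_linearMap_addHaar_eq_smul_addHaar μ hdet⟩
  exact abs_pos.2 (inv_ne_zero hdet)

/-- The value of the Jacobian factor never matters, only that it is positive and the same for all
`F`. -/
theorem exists_integral_comp_dilation {t : ℝ} (ht : 0 < t) :
    ∃ k : ℝ, 0 < k ∧ ∀ F : W → ℂ, ∫ x, F (dilation 𝒲 t x) ∂μ = k * ∫ x, F x ∂μ := by
  obtain ⟨k, hk, hmap⟩ := exists_map_dilation 𝒲 μ ht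
  refine ⟨k, hk, fun F => ?_⟩
  have hemb : MeasurableEmbedding (dilation 𝒲 t) :=
    (dilationEquiv 𝒲 ht).toHomeomorph.measurableEmbedding
  rw [← hemb.integral_map, hmap, integral_smul_measure, ENNReal.toReal_ofReal hk.le,
    Complex.real_smul]

variable {μ} in
theorem memLp_comp_dilation {t : ℝ} (ht : 0 < t) {f : W → ℂ} (hf : MemLp f 2 μ) :
    MemLp (f ∘ dilation 𝒲 t) 2 μ := by
  obtain ⟨k, hk, hmap⟩ := exists_map_dilation 𝒲 μ ht
  have hemb : MeasurableEmbedding (dilation 𝒲 t) :=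
    (dilationEquiv 𝒲 ht).toHomeomorph.measurableEmbedding
  rw [← hemb.memLp_map_measure_iff, hmap]
  exact hf.smul_measure ENNReal.ofReal_ne_top

variable {p : ℕ} {X : Fin p → VField W}

/-- `g` is the weak derivative of `f` along the divergence-free vector field `Y` on the whole
space. -/
def HasGlobalWeakDeriv (Y : VField W) (f g : W → ℂ) : Prop :=
  ∀ φ : W → ℂ, IsTestFunction Set.univ φ → ∫ x, g x * φ x ∂μ = -∫ x, f x * along Y φ x ∂μ

variable {𝒲 μ} in
theorem HasGlobalWeakDeriv.comp_dilation {Y : VField W} (hY : IsHomogeneous 𝒲 1 Y) {f g : W → ℂ}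
    (h : HasGlobalWeakDeriv μ Y f g) {t : ℝ} (ht : 0 < t) :
    HasGlobalWeakDeriv μ Y (f ∘ dilation 𝒲 t) fun x => t * g (dilation 𝒲 t x) := by
  intro φ hφ
  obtain ⟨k, hk, hint⟩ := exists_integral_comp_dilation 𝒲 μ ht
  have ht' : 0 < t⁻¹ := inv_pos.2 ht
  have h1 := h _ (hφ.comp_dilation 𝒲 ht')
  have e1 : ∫ x, t * g (dilation 𝒲 t x) * φ x ∂μ =
      k * (t * ∫ x, g x * (φ ∘ dilation 𝒲 t⁻¹) x ∂μ) := by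
    rw [← integral_const_mul, ← hint fun x => t * (g x * (φ ∘ dilation 𝒲 t⁻¹) x)]
    refine integral_congr_ae (Eventually.of_forall fun x => ?_)
    simp only [Function.comp, dilation_inv_dilation 𝒲 ht]
    ring
  have e2 : ∫ x, (f ∘ dilation 𝒲 t) x * along Y φ x ∂μ =
      k * (t * ∫ x, f x * along Y (φ ∘ dilation 𝒲 t⁻¹) x ∂μ) := by
    rw [← integral_const_mul,
      ← hint fun x => t * (f x * along Y (φ ∘ dilation 𝒲 t⁻¹) x)]
    refine integral_congr_ae (Eventually.of_forall fun x => ?_)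
    simp only [hY.along_comp_dilation ht' (hφ.1.differentiable (by simp)),
      dilation_inv_dilation 𝒲 ht, Function.comp, pow_one, Complex.real_smul]
    have : (t : ℂ) ≠ 0 := by exact_mod_cast ht.ne'
    push_cast
    field_simp
  rw [e1, e2, h1]
  ring

variable {Ω : Set W}

variable {μ} in
theorem sobolevZero_hasGlobalWeakDeriv (hΩ : IsOpen Ω) (hX : ∀ ℓ x, divergence (X ℓ) x = 0)
    {w : L2 μ Ω × (Fin p → L2 μ Ω)} (hw : w ∈ sobolevZero μ Ω X) (ℓ : Fin p) :
    HasGlobalWeakDeriv μ (X ℓ) (Ω.indicator w.1) (Ω.indicator (w.2 ℓ)) := by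
  intro φ hφ
  rw [integral_indicator_mul hΩ, integral_indicator_mul hΩ]
  exact sobolevZero_integral_mul hΩ hX hw ℓ hφ.1
    (hφ.1.continuous.memLp_of_hasCompactSupport hφ.2.1)
    ((hφ.along (X ℓ)).1.continuous.memLp_of_hasCompactSupport (hφ.along (X ℓ)).2.1)

variable {μ} in
/-- The restriction to `Ω` of a function with square integrable weak derivatives. -/
theorem restrict_mem_sobolev (hX : ∀ ℓ x, divergence (X ℓ) x = 0)
    {f : W → ℂ} {g : Fin p → W → ℂ} (hf : MemLp f 2 μ) (hg : ∀ ℓ, MemLp (g ℓ) 2 μ)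
    (h : ∀ ℓ, HasGlobalWeakDeriv μ (X ℓ) f (g ℓ)) :
    ((hf.restrict Ω).toLp, fun ℓ => ((hg ℓ).restrict Ω).toLp) ∈ sobolev μ Ω X := by
  rw [mem_sobolev_iff hX]
  intro ℓ φ hφ
  have key : ∀ {F : W → ℂ} (hF : MemLp F 2 μ) {ψ : W → ℂ}, IsTestFunction Ω ψ →
      ∫ x in Ω, (hF.restrict Ω).toLp _ x * ψ x ∂μ = ∫ x, F x * ψ x ∂μ := by
    intro F hF ψ hψ
    rw [← setIntegral_eq_integral_of_forall_compl_eq_zero (s := Ω) (μ := μ)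
      (f := fun x => F x * ψ x)]
    · refine integral_congr_ae ?_
      filter_upwards [(hF.restrict Ω).coeFn_toLp] with x hx
      rw [hx]
    · intro x hx
      rw [image_eq_zero_of_notMem_tsupport fun h => hx (hψ.2.2 h), mul_zero]
  rw [key (hg ℓ) hφ, key hf (hφ.along (X ℓ))]
  exact h ℓ φ ⟨hφ.1, hφ.2.1, Set.subset_univ _⟩

variable {𝒲 μ} in
/-- An element of `S¹₀(Ω)` cannot be an eigenfunction of the Neumann realization with a positive
eigenvalue: its extension by zero would be a square integrable eigenfunction on the whole space,
whereas dilations would then produce uncountably many eigenvalues. -/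
theorem eq_zero_of_mem_sobolevZero_of_neumann (hhom : ∀ ℓ, IsHomogeneous 𝒲 1 (X ℓ))
    (hΩ : IsOpen Ω) {c : ℝ} (hc : c ≠ 0) {w : L2 μ Ω × (Fin p → L2 μ Ω)}
    (hw : w ∈ sobolevZero μ Ω X)
    (h : ∀ v ∈ sobolev μ Ω X, ∑ ℓ, inner ℂ (v.2 ℓ) (w.2 ℓ) = c * inner ℂ v.1 w.1) :
    w.1 = 0 := by
  have hX : ∀ ℓ x, divergence (X ℓ) x = 0 := fun ℓ => (hhom ℓ).divergence_eq_zero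
  set u : W → ℂ := Ω.indicator w.1 with hu
  set g : Fin p → W → ℂ := fun ℓ => Ω.indicator (w.2 ℓ) with hg
  have huL : MemLp u 2 μ := memLp_indicator hΩ w.1
  have hgL : ∀ ℓ, MemLp (g ℓ) 2 μ := fun ℓ => memLp_indicator hΩ (w.2 ℓ)
  have hwd : ∀ ℓ, HasGlobalWeakDeriv μ (X ℓ) u (g ℓ) := sobolevZero_hasGlobalWeakDeriv hΩ hX hw
  let I : ℝ → ℂ := fun t => ∫ x, u x * starRingEnd ℂ (u (dilation 𝒲 t x)) ∂μ
  let G : ℝ → ℂ := fun t => ∑ ℓ, ∫ x, g ℓ x * starRingEnd ℂ (g ℓ (dilation 𝒲 t x)) ∂μ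
  -- Test the Neumann equation with the restriction to `Ω` of `u ∘ h_t`, whose weak derivatives are
  -- `t g_ℓ ∘ h_t`.
  have hGI : ∀ t, 0 < t → t * G t = c * I t := by
    intro t ht
    have hf' := memLp_comp_dilation 𝒲 ht huL
    have hg' : ∀ ℓ, MemLp (fun x => (t : ℂ) * g ℓ (dilation 𝒲 t x)) 2 μ := fun ℓ =>
      (memLp_comp_dilation 𝒲 ht (hgL ℓ)).const_mul (t : ℂ)
    have hmem := restrict_mem_sobolev (Ω := Ω) hX hf' hg'
      fun ℓ => (hwd ℓ).comp_dilation (hhom ℓ) ht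
    have h1 := h _ hmem
    have h2 : inner ℂ (hf'.restrict Ω).toLp w.1 = I t := inner_restrict_toLp hΩ hf' w.1
    refine Eq.trans ?_ (h1.trans (congrArg (fun z => (c : ℂ) * z) h2))
    simp only [G, Finset.mul_sum]
    refine Finset.sum_congr rfl fun ℓ _ => ?_
    refine Eq.trans ?_ (inner_restrict_toLp hΩ (hg' ℓ) (w.2 ℓ)).symm
    rw [← integral_const_mul]
    refine integral_congr_ae (Eventually.of_forall fun x => ?_)
    simp only [map_mul, Complex.conj_ofReal, hg]
    ring
  have hconj : ∀ (t : ℝ), 0 < t → ∃ k : ℝ, 0 < k ∧ ∀ f : W → ℂ,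
      starRingEnd ℂ (∫ x, f x * starRingEnd ℂ (f (dilation 𝒲 t x)) ∂μ) =
        k * ∫ x, f x * starRingEnd ℂ (f (dilation 𝒲 t⁻¹ x)) ∂μ := by
    intro t ht
    obtain ⟨k, hk, hint⟩ := exists_integral_comp_dilation 𝒲 μ ht
    refine ⟨k, hk, fun f => ?_⟩
    rw [← hint fun x => f x * starRingEnd ℂ (f (dilation 𝒲 t⁻¹ x)), ← integral_conj]
    refine integral_congr_ae (Eventually.of_forall fun x => ?_)
    simp only [map_mul, Complex.conj_conj, dilation_inv_dilation 𝒲 ht]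
    ring
  -- Conjugating the relation at `t` gives `t G(1/t) = c I(1/t)`; the relation at `1/t` gives `t⁻¹
  -- G(1/t) = c I(1/t)`. For `t ≠ 1` both sides must vanish.
  have hI0' : ∀ t, 0 < t → t ≠ 1 → I t⁻¹ = 0 := by
    intro t ht ht1
    obtain ⟨k, hk, hk'⟩ := hconj t ht
    have e1 : starRingEnd ℂ (I t) = k * I t⁻¹ := hk' u
    have e2 : starRingEnd ℂ (G t) = k * G t⁻¹ := by
      simp only [G, map_sum, Finset.mul_sum]
      exact Finset.sum_congr rfl fun ℓ _ => hk' (g ℓ)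
    have e3 := congrArg (starRingEnd ℂ) (hGI t ht)
    rw [map_mul, map_mul, e1, e2, Complex.conj_ofReal, Complex.conj_ofReal] at e3
    have e4 := hGI t⁻¹ (inv_pos.2 ht)
    have hkc : (k : ℂ) ≠ 0 := by exact_mod_cast hk.ne'
    have htc : (t : ℂ) ≠ 0 := by exact_mod_cast ht.ne'
    have e5 : (t : ℂ) * G t⁻¹ = c * I t⁻¹ := by
      refine mul_left_cancel₀ hkc ?_
      linear_combination e3
    have e6 : ((t : ℂ) ^ 2 - 1) * G t⁻¹ = 0 := by
      push_cast at e4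
      have : (t : ℂ) * G t⁻¹ = (t : ℂ)⁻¹ * G t⁻¹ := by rw [e5, e4]
      generalize G t⁻¹ = z at this
      field_simp at this
      linear_combination this
    have e7 : ((t : ℂ) ^ 2 - 1) ≠ 0 := by
      have : t ^ 2 - 1 ≠ 0 := by
        intro h0
        have : (t - 1) * (t + 1) = 0 := by linear_combination h0
        rcases mul_eq_zero.1 this with h2 | h2
        · exact ht1 (by linarith)
        · linarith
      exact_mod_cast this
    have e8 : G t⁻¹ = 0 := (mul_eq_zero.1 e6).resolve_left e7
    rw [e8, mul_zero] at e5
    exact (mul_eq_zero.1 e5.symm).resolve_left (by exact_mod_cast hc)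
  have hI0 : ∀ t, 0 < t → t ≠ 1 → I t = 0 := by
    intro t ht ht1
    have := hI0' t⁻¹ (inv_pos.2 ht) (by simpa using ht1)
    rwa [inv_inv] at this
  by_contra hne
  have hIpos : I 1 ≠ 0 := by
    intro h0
    apply hne
    have e : I 1 = ((‖w.1‖ ^ 2 : ℝ) : ℂ) := by
      simp only [I, dilation_one]
      rw [← inner_self_eq_ofReal, L2.inner_def, ← integral_indicator hΩ.measurableSet]
      refine integral_congr_ae (Eventually.of_forall fun x => ?_)
      by_cases hx : x ∈ Ω
      · simp only [hu, Set.indicator_of_mem hx, RCLike.inner_apply]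
      · simp [hu, hx]
    rw [e] at h0
    have : ‖w.1‖ ^ 2 = 0 := by exact_mod_cast h0
    simpa using this
  -- A change of variables reduces `⟪U s, U t⟫` to a positive multiple of `I (s / t)`, so the
  -- dilates form an uncountable orthogonal family.
  let U : Set.Ioi (0 : ℝ) → Lp ℂ 2 μ := fun t => (memLp_comp_dilation 𝒲 t.2 huL).toLp
  have hU : ∀ s t : Set.Ioi (0 : ℝ), ∃ k : ℝ, 0 < k ∧
      inner ℂ (U s) (U t) = k * I ((s : ℝ) * (t : ℝ)⁻¹) := by
    intro s t
    obtain ⟨k, hk, hint⟩ := exists_integral_comp_dilation 𝒲 μ t.2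
    refine ⟨k, hk, ?_⟩
    simp only [I]
    rw [← hint fun x => u x * starRingEnd ℂ (u (dilation 𝒲 ((s : ℝ) * (t : ℝ)⁻¹) x)),
      L2.inner_def]
    refine integral_congr_ae ?_
    filter_upwards [(memLp_comp_dilation 𝒲 s.2 huL).coeFn_toLp,
      (memLp_comp_dilation 𝒲 t.2 huL).coeFn_toLp] with x h1 h2
    simp only [U]
    rw [h1, h2, RCLike.inner_apply, dilation_dilation, mul_assoc,
      inv_mul_cancel₀ (ne_of_gt t.2), mul_one]
    rfl
  have : Fact ((2 : ENNReal) ≠ ⊤) := ⟨ENNReal.ofNat_ne_top⟩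
  have hcount : Countable (Set.Ioi (0 : ℝ)) := by
    refine countable_of_pairwise_orthogonal (f := U) (fun t h0 => ?_) fun s t hst => ?_
    · obtain ⟨k, hk, h1⟩ := hU t t
      rw [h0, inner_zero_left, mul_inv_cancel₀ (ne_of_gt t.2)] at h1
      exact mul_ne_zero (by exact_mod_cast hk.ne') hIpos h1.symm
    · obtain ⟨k, hk, h1⟩ := hU s t
      rw [h1, hI0 _ (mul_pos s.2 (inv_pos.2 t.2)), mul_zero]
      intro h2
      apply hst
      apply Subtype.ext
      have ht : (0 : ℝ) < t := t.2
      exact (mul_inv_eq_one₀ ht.ne').1 h2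
  have := Set.Countable.mono (s₁ := Set.Ioi (0 : ℝ)) (Set.Subset.refl _) (Set.countable_coe_iff.1 hcount)
  have h2 := Cardinal.mk_Ioi_real 0
  have h3 := Cardinal.le_aleph0_iff_set_countable.2 this
  rw [h2] at h3
  exact absurd h3 (not_le.2 Cardinal.aleph0_lt_continuum)

end WholeSpace

/-! ### Triviality of the kernel of the Dirichlet realization -/

/-- The Lie bracket acts on functions as the commutator. -/
theorem along_bracket {W : Type*} [NormedAddCommGroup W] [NormedSpace ℝ W] (Y Z : VField W)
    {φ : W → ℂ} (hφ : ContDiff ℝ ∞ φ) (x : W) :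
    along ⁅Y, Z⁆ φ x = along Y (along Z φ) x - along Z (along Y φ) x := by
  have hd : ∀ Z : VField W, ∀ v, fderiv ℝ (along Z φ) x v =
      fderiv ℝ (fderiv ℝ φ) x v (Z.1 x) + fderiv ℝ φ x (fderiv ℝ Z.1 x v) := by
    intro Z v
    have h1 : DifferentiableAt ℝ (fderiv ℝ φ) x :=
      (hφ.fderiv_right (m := ∞) (by simp)).differentiable (by simp) x
    have h2 := (h1.hasFDerivAt.clm_apply (Z.differentiableAt x).hasFDerivAt).fderiv
    have h3 := congrArg (fun L : W →L[ℝ] ℂ => L v) h2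
    refine h3.trans ?_
    simp [add_comm]
  have hsymm : fderiv ℝ (fderiv ℝ φ) x (Y.1 x) (Z.1 x) =
      fderiv ℝ (fderiv ℝ φ) x (Z.1 x) (Y.1 x) :=
    (hφ.contDiffAt.isSymmSndFDerivAt (by simpa using ENat.LEInfty.out)) _ _
  rw [along, VField.bracket_apply, VectorField.lieBracket, map_sub]
  change _ = fderiv ℝ (along Z φ) x (Y.1 x) - fderiv ℝ (along Y φ) x (Z.1 x)
  rw [hd, hd, hsymm]
  ring

/-! ### Rescaled vector fields and their limit at the origin -/

section Rescaling

variable {W : Type*} [NormedAddCommGroup W] [NormedSpace ℝ W]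
  {r : ℕ} {𝒲 : Fin r → Submodule ℝ W} [DirectSum.Decomposition 𝒲]

/-- The rescaled field `t ^ (i + 1) • h_t⁻¹ (Y (h_t x))`, extended continuously to `t = 0` when
the components of `Y` of weight above that of `i` vanish. -/
def rescaledField (𝒲 : Fin r → Submodule ℝ W) [DirectSum.Decomposition 𝒲] (i : Fin r)
    (Y : VField W) (t : ℝ) (x : W) : W :=
  ∑ j : Fin r, t ^ ((i : ℕ) - (j : ℕ)) • (DirectSum.decompose 𝒲 (Y.1 (dilation 𝒲 t x)) j : W)

/-- Truncated subtraction gives `0 ^ 0 = 1` for every `j ≥ i`, but `Y(0) ∈ 𝒲 i` has no component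
other than the `i`-th. -/
theorem rescaledField_zero (i : Fin r) {Y : VField W} (hY : Y.1 0 ∈ 𝒲 i) (x : W) : rescaledField 𝒲 i Y 0 x = Y.1 0 := by
  have h0 : dilation 𝒲 0 x = 0 := by simp [dilation]
  rw [rescaledField, h0, Finset.sum_eq_single i]
  · rw [Nat.sub_self, pow_zero, one_smul, DirectSum.decompose_of_mem_same 𝒲 hY]
  · intro j _ hj
    rw [DirectSum.decompose_of_mem_ne 𝒲 hY hj.symm, smul_zero]
  · simp

/-- The exponents are truncated only for `j > i`, where the summands are trivial. -/
theorem rescaledField_eq (i : Fin r) (Y : VField W) (hi : ∀ j, i < j → 𝒲 j = ⊥) {t : ℝ}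
    (ht : 0 < t) (x : W) :
    rescaledField 𝒲 i Y t x = t ^ ((i : ℕ) + 1) • dilation 𝒲 t⁻¹ (Y.1 (dilation 𝒲 t x)) := by
  rw [rescaledField, dilation.eq_def 𝒲 t⁻¹, Finset.smul_sum]
  refine Finset.sum_congr rfl fun j _ => ?_
  rcases lt_or_ge i j with hj | hj
  · have : (DirectSum.decompose 𝒲 (Y.1 (dilation 𝒲 t x)) j : W) = 0 := by
      have h1 := (hi j hj).le (DirectSum.decompose 𝒲 (Y.1 (dilation 𝒲 t x)) j).2
      simpa using h1
    rw [this, smul_zero, smul_zero, smul_zero]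
  · rw [smul_smul]
    congr 1
    have h1 : (i : ℕ) + 1 = (i - j) + (j + 1) := by have : (j : ℕ) ≤ i := hj; omega
    rw [h1, pow_add, mul_assoc, ← mul_pow, mul_inv_cancel₀ ht.ne', one_pow, mul_one]

variable [FiniteDimensional ℝ W]

theorem continuous_decompose (𝒲 : Fin r → Submodule ℝ W) [DirectSum.Decomposition 𝒲]
    (j : Fin r) : Continuous fun w => (DirectSum.decompose 𝒲 w j : W) := by
  let L : W →ₗ[ℝ] W :=
    { toFun := fun w => (DirectSum.decompose 𝒲 w j : W)
      map_add' := fun v w => by simp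
      map_smul' := fun c w => by
        simp only [DirectSum.decompose_smul, DirectSum.smul_apply, Submodule.coe_smul,
          RingHom.id_apply] }
  exact L.continuous_of_finiteDimensional

theorem continuous_rescaledField (i : Fin r) (Y : VField W) :
    Continuous fun z : ℝ × W => rescaledField 𝒲 i Y z.1 z.2 := by
  have h1 : Continuous fun z : ℝ × W => dilation 𝒲 z.1 z.2 :=
    continuous_finsetSum _ fun j _ => (continuous_fst.pow _).smul
      ((continuous_decompose 𝒲 j).comp continuous_snd)
  exact continuous_finsetSum _ fun j _ => (continuous_fst.pow _).smul
      ((continuous_decompose 𝒲 j).comp (Y.contDiff.continuous.comp h1))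

end Rescaling

theorem integrable_mul_test {W : Type*} [NormedAddCommGroup W] [NormedSpace ℝ W]
    [MeasurableSpace W] [BorelSpace W] {μ : Measure W} [IsFiniteMeasureOnCompacts μ]
    {f ψ : W → ℂ} (hf : MemLp f 2 μ) (hψ : IsTestFunction Set.univ ψ) :
    Integrable (fun x => f x * ψ x) μ :=
  MemLp.integrable_mul (p := 2) (q := 2) hf
    (hψ.1.continuous.memLp_of_hasCompactSupport hψ.2.1)

/-! ### Functions annihilated by the Lie algebra -/

section Kernel

variable {W : Type*} [NormedAddCommGroup W] [NormedSpace ℝ W]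
  [MeasurableSpace W] [BorelSpace W] {μ : Measure W} [μ.IsAddHaarMeasure]
  {p : ℕ} {X : Fin p → VField W}

/-- A function annihilated by `X₁, …, X_p` is annihilated by the Lie algebra they generate. -/
theorem integral_mul_along_eq_zero {f : W → ℂ} (hf : MemLp f 2 μ)
    (h : ∀ ℓ, HasGlobalWeakDeriv μ (X ℓ) f 0) {Y : VField W} (hY : Y ∈ generatedAlgebra X)
    {φ : W → ℂ} (hφ : IsTestFunction Set.univ φ) : ∫ x, f x * along Y φ x ∂μ = 0 := by
  induction hY using LieSubalgebra.lieSpan_induction generalizing φ with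
  | mem Y hY =>
    obtain ⟨ℓ, rfl⟩ := hY
    simpa using (h ℓ φ hφ).symm
  | zero => simp [along]
  | add Y Z hY hZ h1 h2 =>
    have e : ∀ x, f x * along (Y + Z) φ x = f x * along Y φ x + f x * along Z φ x := by
      intro x; simp [along, mul_add]
    simp only [e]
    rw [integral_add (integrable_mul_test hf (hφ.along Y))
      (integrable_mul_test hf (hφ.along Z)), h1 hφ, h2 hφ, add_zero]
  | smul c Y hY h1 =>
    have e : ∀ x, f x * along (c • Y) φ x = c * (f x * along Y φ x) := by
      intro x; simp [along]; ring
    simp only [e]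
    rw [integral_const_mul, h1 hφ, mul_zero]
  | lie Y Z hY hZ h1 h2 =>
    have e : ∀ x, f x * along ⁅Y, Z⁆ φ x =
        f x * along Y (along Z φ) x - f x * along Z (along Y φ) x := by
      intro x; rw [along_bracket Y Z hφ.1, mul_sub]
    simp only [e]
    rw [integral_sub (integrable_mul_test hf ((hφ.along Z).along Y))
      (integrable_mul_test hf ((hφ.along Y).along Z)), h1 (hφ.along Z), h2 (hφ.along Y), sub_zero]

variable [FiniteDimensional ℝ W] {r : ℕ} {𝒲 : Fin r → Submodule ℝ W} [DirectSum.Decomposition 𝒲]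

/-- By homogeneity of the `X_ℓ`, the dilate `f ∘ h_t⁻¹` is also annihilated by them, hence by `Y`,
which need not be homogeneous. A change of variables moves the dilation onto `Y`. -/
theorem integral_mul_rescaledField_eq_zero (hhom : ∀ ℓ, IsHomogeneous 𝒲 1 (X ℓ)) {f : W → ℂ}
    (hf : MemLp f 2 μ) (h : ∀ ℓ, HasGlobalWeakDeriv μ (X ℓ) f 0) {Y : VField W}
    (hY : Y ∈ generatedAlgebra X) {i : Fin r} (hi : ∀ j, i < j → 𝒲 j = ⊥) {φ : W → ℂ}
    (hφ : IsTestFunction Set.univ φ) {t : ℝ} (ht : 0 < t) :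
    ∫ x, f x * fderiv ℝ φ x (rescaledField 𝒲 i Y t x) ∂μ = 0 := by
  have ht' : 0 < t⁻¹ := inv_pos.2 ht
  have h1 : ∀ ℓ, HasGlobalWeakDeriv μ (X ℓ) (f ∘ dilation 𝒲 t⁻¹) 0 := by
    intro ℓ
    have := (h ℓ).comp_dilation (hhom ℓ) ht'
    simpa [← Pi.zero_def] using this
  have h2 := integral_mul_along_eq_zero (memLp_comp_dilation 𝒲 ht' hf) h1 hY
    (hφ.comp_dilation 𝒲 ht')
  obtain ⟨k, hk, hint⟩ := exists_integral_comp_dilation 𝒲 μ ht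
  have h3 := hint fun x => (f ∘ dilation 𝒲 t⁻¹) x * along Y (φ ∘ dilation 𝒲 t⁻¹) x
  rw [h2, mul_zero] at h3
  have h4 : ∀ x, f x * fderiv ℝ φ x (rescaledField 𝒲 i Y t x) = ((t ^ ((i : ℕ) + 1) : ℝ) : ℂ) *
      ((f ∘ dilation 𝒲 t⁻¹) (dilation 𝒲 t x) *
        along Y (φ ∘ dilation 𝒲 t⁻¹) (dilation 𝒲 t x)) := by
    intro x
    rw [along, fderiv_comp_dilation 𝒲 t⁻¹ (hφ.1.differentiable (by simp) _),
      rescaledField_eq i Y hi ht, map_smul, Function.comp, dilation_inv_dilation 𝒲 ht,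
      Complex.real_smul]
    ring
  simp only [h4]
  rw [integral_const_mul, h3, mul_zero]

/-- A function annihilated by `X₁, …, X_p` is invariant in the directions of highest weight. -/
theorem integral_mul_fderiv_eq_zero (hhom : ∀ ℓ, IsHomogeneous 𝒲 1 (X ℓ))
    (hhor : HormanderCondition X) {f : W → ℂ} (hf : MemLp f 2 μ)
    (h : ∀ ℓ, HasGlobalWeakDeriv μ (X ℓ) f 0) {i : Fin r} (hi : ∀ j, i < j → 𝒲 j = ⊥) {v : W}
    (hv : v ∈ 𝒲 i) {φ : W → ℂ} (hφ : IsTestFunction Set.univ φ) :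
    ∫ x, f x * fderiv ℝ φ x v ∂μ = 0 := by
  obtain ⟨Y, hY, rfl⟩ := hhor v
  let F : ℝ → W → ℂ := fun t x => f x * fderiv ℝ φ x (rescaledField 𝒲 i Y t x)
  have hcont : Continuous fun z : ℝ × W => fderiv ℝ φ z.2 (rescaledField 𝒲 i Y z.1 z.2) :=
    ((hφ.1.continuous_fderiv (by simp)).comp continuous_snd).clm_apply
      (continuous_rescaledField i Y)
  obtain ⟨C, hC⟩ := (isCompact_Icc (a := (0 : ℝ)) (b := 1)).prod hφ.2.1.isCompact
    |>.exists_bound_of_continuousOn hcont.continuousOn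
  have hloc : IntegrableOn f (tsupport φ) μ :=
    (hf.locallyIntegrable (by norm_num)).integrableOn_isCompact hφ.2.1.isCompact
  have hbd : Integrable ((tsupport φ).indicator fun x => ‖f x‖ * C) μ :=
    (integrable_indicator_iff (isClosed_tsupport φ).measurableSet).2 (hloc.norm.mul_const C)
  -- As `t → 0` the rescaled fields tend to the constant field `v`, uniformly bounded on the support
  -- of `φ`.
  have hlim : Tendsto (fun t => ∫ x, F t x ∂μ) (𝓝[>] 0) (𝓝 (∫ x, F 0 x ∂μ)) := by
    refine tendsto_integral_filter_of_dominated_convergence _ ?_ ?_ hbd ?_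
    · refine Eventually.of_forall fun t => hf.aestronglyMeasurable.mul ?_
      exact (hcont.comp (continuous_const.prodMk continuous_id)).aestronglyMeasurable
    · have : Set.Ioc (0 : ℝ) 1 ∈ 𝓝[>] (0 : ℝ) := Ioc_mem_nhdsGT one_pos
      filter_upwards [this] with t ht
      refine Eventually.of_forall fun x => ?_
      by_cases hx : x ∈ tsupport φ
      · rw [Set.indicator_of_mem hx, norm_mul]
        exact mul_le_mul_of_nonneg_left (hC (t, x) ⟨⟨ht.1.le, ht.2⟩, hx⟩) (norm_nonneg _)
      · rw [Set.indicator_of_notMem hx]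
        have : fderiv ℝ φ x = 0 := by
          by_contra h0
          exact hx (support_fderiv_subset ℝ h0)
        simp [F, this]
    · refine Eventually.of_forall fun x => ?_
      have h1 : Continuous fun t => F t x :=
        continuous_const.mul (hcont.comp (continuous_id.prodMk continuous_const))
      exact (h1.tendsto 0).mono_left nhdsWithin_le_nhds
  have hzero : (fun t => ∫ x, F t x ∂μ) =ᶠ[𝓝[>] 0] fun _ => 0 := by
    filter_upwards [self_mem_nhdsWithin] with t ht
    exact integral_mul_rescaledField_eq_zero hhom hf h hY hi hφ ht
  have h2 := tendsto_nhds_unique (hlim.congr' hzero) tendsto_const_nhds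
  simp only [F, rescaledField_zero i hv] at h2
  exact h2

/-- A square integrable function that is invariant in some direction vanishes. -/
theorem integral_mul_eq_zero_of_integral_mul_fderiv_eq_zero {f : W → ℂ} (hf : MemLp f 2 μ)
    {v : W} (hv : v ≠ 0)
    (h : ∀ φ : W → ℂ, IsTestFunction Set.univ φ → ∫ x, f x * fderiv ℝ φ x v ∂μ = 0)
    {φ : W → ℂ} (hφ : IsTestFunction Set.univ φ) : ∫ x, f x * φ x ∂μ = 0 := by
  have hloc : LocallyIntegrable f μ := hf.locallyIntegrable (by norm_num)
  let g : W → ℂ := fun z => φ (-z)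
  have hg : ContDiff ℝ ∞ g := hφ.1.comp contDiff_neg
  have hgc : HasCompactSupport g := hφ.2.1.comp_homeomorph (Homeomorph.neg W)
  let L := ContinuousLinearMap.mul ℝ ℂ
  have htrans : ∀ y, IsTestFunction Set.univ fun x => φ (x - y) := fun y =>
    ⟨hφ.1.comp (contDiff_id.sub contDiff_const),
      hφ.2.1.comp_homeomorph (Homeomorph.subRight y), Set.subset_univ _⟩
  -- `Φ(y)` pairs `f` with the translate of `φ` by `y`; writing it as a convolution with the
  -- reflected `φ` makes it differentiable. Its derivative along `v` vanishes.
  let Φ : W → ℂ := convolution f g L μ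
  have hΦ : ∀ y, Φ y = ∫ x, f x * φ (x - y) ∂μ := by
    intro y
    simp [Φ, convolution, L, g]
  have hder : ∀ y, HasFDerivAt Φ (convolution f (fderiv ℝ g) (L.precompR W) μ y) y :=
    hgc.hasFDerivAt_convolution_right L hloc (hg.of_le (by simp))
  have hder0 : ∀ y, convolution f (fderiv ℝ g) (L.precompR W) μ y v = 0 := by
    intro y
    rw [convolution_precompR_apply L hloc (hgc.fderiv (𝕜 := ℝ)) (hg.continuous_fderiv (by simp))]
    have h1 := h _ (htrans y)
    have h2 : ∀ x, fderiv ℝ g (y - x) v = -fderiv ℝ (fun x => φ (x - y)) x v := by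
      intro x
      have hd : DifferentiableAt ℝ φ (x - y) := hφ.1.differentiable (by simp) _
      have e1 : fderiv ℝ (fun x => φ (x - y)) x = fderiv ℝ φ (x - y) := fderiv_comp_sub y
      have e2 : HasFDerivAt g (fderiv ℝ φ (x - y) ∘L (-ContinuousLinearMap.id ℝ W)) (y - x) := by
        have h3 : HasFDerivAt (fun z : W => -z) (-ContinuousLinearMap.id ℝ W) (y - x) :=
          (hasFDerivAt_id _).neg
        rw [← neg_sub y x] at hd ⊢
        exact hd.hasFDerivAt.comp (y - x) h3
      rw [e1, e2.fderiv]
      simp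
    simp only [convolution, L, ContinuousLinearMap.mul_apply', h2, mul_neg]
    rw [integral_neg, h1, neg_zero]
  have hconst : ∀ s : ℝ, Φ (s • v) = ∫ x, f x * φ x ∂μ := by
    have hd : ∀ s : ℝ, HasDerivAt (fun s : ℝ => Φ (s • v)) 0 s := by
      intro s
      have h1 : HasDerivAt (fun s : ℝ => s • v) v s := by
        simpa using (hasDerivAt_id s).smul_const v
      have := (hder (s • v)).comp_hasDerivAt s h1
      rwa [hder0] at this
    intro s
    have := is_const_of_deriv_eq_zero (fun s => (hd s).differentiableAt) (fun s => (hd s).deriv) s 0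
    rw [this, zero_smul, hΦ]
    simp
  by_contra hne
  have hφL : ∀ y, MemLp (fun x => starRingEnd ℂ (φ (x - y))) 2 μ := fun y =>
    ((htrans y).1.continuous.memLp_of_hasCompactSupport (htrans y).2.1).star
  have hnorm : ∀ y, ‖(hφL y).toLp‖ = ‖(hφL 0).toLp‖ := by
    intro y
    rw [← sq_eq_sq₀ (norm_nonneg _) (norm_nonneg _), norm_sq_toLp_eq_integral,
      norm_sq_toLp_eq_integral]
    simp only [RCLike.norm_conj, sub_zero]
    exact integral_sub_right_eq_self (fun x => ‖φ x‖ ^ 2) y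
  have hinner : ∀ y, inner ℂ (hφL y).toLp hf.toLp = Φ y := by
    intro y
    rw [hΦ, L2.inner_def]
    refine integral_congr_ae ?_
    filter_upwards [(hφL y).coeFn_toLp, hf.coeFn_toLp] with x h1 h2
    rw [h1, h2, RCLike.inner_apply, Complex.conj_conj]
  set M := ‖(hφL 0).toLp‖ with hM
  set I := ∫ x, f x * φ x ∂μ with hI
  have hIpos : 0 < ‖I‖ := norm_pos_iff.2 hne
  -- All translates have norm `M`, so this `δ` makes the pairing with a translate far out along `v`
  -- smaller than `‖I‖`, although it equals `I`.
  have hδ : 0 < ‖I‖ / (2 * (M + 1)) := by positivity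
  obtain ⟨n, hn⟩ := (eventually_norm_inner_le (μ := μ)
    (B := fun n : ℕ => Metric.closedBall (0 : W) n)
    (fun n => measurableSet_closedBall)
    (fun m n hmn => Metric.closedBall_subset_closedBall (by exact_mod_cast hmn))
    (Metric.iUnion_closedBall_nat 0) hf.toLp hδ).exists
  obtain ⟨R, hR⟩ := hφ.2.1.isCompact.isBounded.exists_norm_le
  have hvpos : 0 < ‖v‖ := norm_pos_iff.2 hv
  obtain ⟨s, hs⟩ : ∃ s : ℝ, 0 ≤ s ∧ n + R < s * ‖v‖ := by
    refine ⟨max 0 ((n + R + 1) / ‖v‖), le_max_left _ _, ?_⟩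
    have h1 := mul_le_mul_of_nonneg_right (le_max_right 0 ((n + R + 1) / ‖v‖)) hvpos.le
    rw [div_mul_cancel₀ _ hvpos.ne'] at h1
    linarith
  have h1 := hn (hφL (s • v)).toLp (by
    filter_upwards [(hφL (s • v)).coeFn_toLp] with x hx hxn
    rw [hx]
    by_contra h0
    have h2 : x - s • v ∈ tsupport φ := by
      refine subset_tsupport φ fun h3 => h0 ?_
      rw [h3, map_zero]
    have h3 := hR _ h2
    have h4 : ‖s • v‖ ≤ ‖x‖ + ‖x - s • v‖ := by
      have := norm_sub_le x (x - s • v)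
      rwa [sub_sub_cancel] at this
    rw [norm_smul, Real.norm_of_nonneg hs.1] at h4
    have h5 : ‖x‖ ≤ n := by simpa using hxn
    linarith [hs.2])
  rw [hinner, hconst, hnorm, div_mul_eq_mul_div, le_div_iff₀ (by positivity)] at h1
  have hM0 : 0 ≤ M := norm_nonneg _
  nlinarith

/-- The Dirichlet realization has trivial kernel. -/
theorem eq_zero_of_mem_sobolevZero [Nontrivial W] (hhom : ∀ ℓ, IsHomogeneous 𝒲 1 (X ℓ))
    (hhor : HormanderCondition X) {Ω : Set W} (hΩ : IsOpen Ω)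
    {u : L2 μ Ω} (hu : (u, 0) ∈ sobolevZero μ Ω X) : u = 0 := by
  classical
  have hX : ∀ ℓ x, divergence (X ℓ) x = 0 := fun ℓ => (hhom ℓ).divergence_eq_zero
  obtain ⟨i, hi0, hi⟩ : ∃ i, 𝒲 i ≠ ⊥ ∧ ∀ j, i < j → 𝒲 j = ⊥ := by
    have hex : (Finset.univ.filter fun i => 𝒲 i ≠ ⊥).Nonempty := by
      obtain ⟨w, hw⟩ := exists_ne (0 : W)
      by_contra hem
      rw [Finset.not_nonempty_iff_eq_empty, Finset.filter_eq_empty_iff] at hem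
      apply hw
      rw [← dilation_one 𝒲 w, dilation]
      refine Finset.sum_eq_zero fun j hj => ?_
      have h1 := (not_not.1 (hem hj)).le (DirectSum.decompose 𝒲 w j).2
      rw [(Submodule.mem_bot ℝ).1 h1, smul_zero]
    refine ⟨_, (Finset.mem_filter.1 (Finset.max'_mem _ hex)).2, fun j hj => ?_⟩
    by_contra hne
    exact absurd (Finset.le_max' _ j (by simpa using hne)) (not_le.2 hj)
  obtain ⟨v, hv, hv0⟩ := Submodule.exists_mem_ne_zero_of_ne_bot hi0
  have hd : ∀ ℓ, HasGlobalWeakDeriv μ (X ℓ) (Ω.indicator u) 0 := by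
    intro ℓ φ hφ
    have h1 := sobolevZero_hasGlobalWeakDeriv hΩ hX hu ℓ φ hφ
    rw [← h1, integral_indicator_mul hΩ]
    simp only [Pi.zero_apply, zero_mul, integral_zero]
    symm
    refine (integral_congr_ae ?_).trans (integral_zero _ _)
    filter_upwards [Lp.coeFn_zero ℂ 2 (μ.restrict Ω)] with x hx
    rw [hx, Pi.zero_apply, zero_mul]
  have hf := memLp_indicator hΩ u
  refine eq_zero_of_forall_test μ Ω hΩ u fun φ hφ => ?_
  rw [← integral_indicator_mul hΩ]
  exact integral_mul_eq_zero_of_integral_mul_fderiv_eq_zero hf hv0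
    (fun ψ hψ => integral_mul_fderiv_eq_zero hhom hhor hf hd hi hv hψ)
    ⟨hφ.1, hφ.2.1, Set.subset_univ _⟩

end Kernel

/-! ### Plane waves -/

/-- A linearly independent sequence leaves every finite-dimensional subspace. -/
theorem exists_notMem_of_linearIndependent {K V : Type*} [DivisionRing K] [AddCommGroup V]
    [Module K V] {v : ℕ → V} (hv : LinearIndependent K v) (F : Submodule K V)
    [FiniteDimensional K F] : ∃ n, v n ∉ F := by
  by_contra! h
  let v' : ℕ → F := fun n => ⟨v n, h n⟩
  have : LinearIndependent K v' := LinearIndependent.of_comp F.subtype hv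
  exact Infinite.not_finite (α := ℕ) this.finite

section PlaneWaves

variable {W : Type*} [NormedAddCommGroup W] [NormedSpace ℝ W]

/-- The plane wave `x ↦ exp (i η(x))`, as a character of `W`. -/
def planeWave (η : W →L[ℝ] ℝ) : Multiplicative W →* ℂ where
  toFun x := Complex.exp (Complex.I * (η x.toAdd : ℂ))
  map_one' := by simp
  map_mul' x y := by simp [mul_add, Complex.exp_add]

/-- The plane wave `x ↦ exp (i η(x))` as a function on `W`. -/
def wave (η : W →L[ℝ] ℝ) (x : W) : ℂ := Complex.exp (Complex.I * (η x : ℂ))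

theorem hasFDerivAt_wave (η : W →L[ℝ] ℝ) (x : W) :
    HasFDerivAt (wave η) (wave η x • Complex.I • Complex.ofRealCLM.comp η) x :=
  ((Complex.ofRealCLM.comp η).hasFDerivAt.const_mul Complex.I).cexp

theorem contDiff_wave (η : W →L[ℝ] ℝ) : ContDiff ℝ ∞ (wave η) :=
  (contDiff_const.mul (Complex.ofRealCLM.comp η).contDiff).cexp

theorem norm_wave (η : W →L[ℝ] ℝ) (x : W) : ‖wave η x‖ = 1 := by
  rw [wave, mul_comm, Complex.norm_exp_ofReal_mul_I]

theorem along_wave (Y : VField W) (η : W →L[ℝ] ℝ) (x : W) :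
    along Y (wave η) x = Complex.I * (η (Y.1 x) : ℂ) * wave η x := by
  rw [along, (hasFDerivAt_wave η x).fderiv]
  simp only [smul_apply, ContinuousLinearMap.comp_apply, smul_eq_mul, Complex.ofRealCLM_apply]
  ring

theorem conj_wave (η : W →L[ℝ] ℝ) (x : W) : starRingEnd ℂ (wave η x) = wave (-η) x := by
  rw [wave, wave, ← Complex.exp_conj, map_mul, Complex.conj_I, Complex.conj_ofReal]
  simp

theorem analyticAt_wave (η : W →L[ℝ] ℝ) (x : W) : AnalyticAt ℝ (wave η) x := by
  have h1 : AnalyticAt ℝ Complex.exp (Complex.I * (η x : ℂ)) :=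
    AnalyticAt.restrictScalars (𝕜' := ℂ) (Complex.differentiable_exp.analyticAt _)
  exact h1.comp (f := fun x => Complex.I * (η x : ℂ))
    (analyticAt_const.mul ((Complex.ofRealCLM.comp η).analyticAt x))

/-- The derivative at the origin recovers `η`. -/
theorem planeWave_injective : Function.Injective (planeWave : (W →L[ℝ] ℝ) → _) := by
  intro η ζ h
  have h1 : wave η = wave ζ := by
    funext x
    exact congrArg (fun f : Multiplicative W →* ℂ => f (Multiplicative.ofAdd x)) h
  have h2 := (hasFDerivAt_wave η 0).unique (h1 ▸ hasFDerivAt_wave ζ 0)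
  ext v
  have h3 := congrArg (fun L : W →L[ℝ] ℂ => L v) h2
  simpa [wave] using h3

variable [MeasurableSpace W] [BorelSpace W] {μ : Measure W} {Ω : Set W}

theorem memLp_wave (hfin : μ Ω < ⊤) (η : W →L[ℝ] ℝ) : MemLp (wave η) 2 (μ.restrict Ω) := by
  have : IsFiniteMeasure (μ.restrict Ω) := ⟨by simpa using hfin⟩
  exact MemLp.of_bound (contDiff_wave η).continuous.aestronglyMeasurable 1
    (Eventually.of_forall fun x => (norm_wave η x).le)

variable [μ.IsAddHaarMeasure]

/-- Distinct plane waves are linearly independent on every open set. -/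
theorem linearIndependent_wave (hΩ : IsOpen Ω) (hne : Ω.Nonempty) (hfin : μ Ω < ⊤) {ι : Type*}
    {η : ι → W →L[ℝ] ℝ} (hη : Function.Injective η) :
    LinearIndependent ℂ fun n => (memLp_wave hfin (η n)).toLp := by
  -- Dedekind's theorem gives independence on all of `W`. A relation holding almost everywhere on
  -- `Ω` holds on `Ω` by continuity, and on `W` by analyticity.
  have hchar := (linearIndependent_monoidHom (Multiplicative W) ℂ).comp _
    (planeWave_injective.comp hη)
  rw [linearIndependent_iff'] at hchar ⊢
  intro s g hg
  refine hchar s g ?_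
  have h1 : (fun x => ∑ n ∈ s, g n * wave (η n) x) =ᵐ[μ.restrict Ω] fun _ => 0 := by
    have e1 := Lp.coeFn_finsetSum s fun n => g n • (memLp_wave hfin (η n)).toLp
    rw [hg] at e1
    have e2 : ∀ᵐ x ∂μ.restrict Ω, ∀ n ∈ s,
        (g n • (memLp_wave hfin (η n)).toLp : L2 μ Ω) x = g n * wave (η n) x := by
      rw [eventually_all_finset]
      intro n _
      filter_upwards [Lp.coeFn_smul (g n) (memLp_wave hfin (η n)).toLp,
        (memLp_wave hfin (η n)).coeFn_toLp] with x h2 h3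
      rw [h2, Pi.smul_apply, h3, smul_eq_mul]
    filter_upwards [e1, e2, Lp.coeFn_zero ℂ 2 (μ.restrict Ω)] with x h2 h3 h4
    rw [h4, Finset.sum_apply] at h2
    rw [← Finset.sum_congr rfl h3, ← h2, Pi.zero_apply]
  have hcont : Continuous fun x => ∑ n ∈ s, g n * wave (η n) x :=
    continuous_finsetSum _ fun n _ => continuous_const.mul (contDiff_wave (η n)).continuous
  have h2 := Measure.eqOn_open_of_ae_eq h1 hΩ hcont.continuousOn continuousOn_const
  obtain ⟨z, hz⟩ := hne
  have hana : AnalyticOnNhd ℝ (fun x => ∑ n ∈ s, g n * wave (η n) x) Set.univ := fun x _ =>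
    Finset.analyticAt_fun_sum _ fun n _ => analyticAt_const.mul (analyticAt_wave (η n) x)
  have h3 := hana.eqOn_of_preconnected_of_eventuallyEq (fun x _ => analyticAt_const)
    isPreconnected_univ (Set.mem_univ z) (h2.eventuallyEq_of_mem (hΩ.mem_nhds hz))
  funext x
  rw [Finset.sum_apply]
  exact h3 (Set.mem_univ x.toAdd)

variable [FiniteDimensional ℝ W] {r : ℕ} {𝒲 : Fin r → Submodule ℝ W}
  [DirectSum.Decomposition 𝒲] {p : ℕ} {X : Fin p → VField W}

theorem wave_mem_sobolev (hhom : ∀ ℓ, IsHomogeneous 𝒲 1 (X ℓ)) (hfin : μ Ω < ⊤)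
    {η : W →L[ℝ] ℝ} (hη : IsWeightOne 𝒲 η) :
    ((memLp_wave hfin η).toLp,
      fun ℓ => (Complex.I * (η ((X ℓ).1 0) : ℂ)) • (memLp_wave hfin η).toLp) ∈ sobolev μ Ω X := by
  have hX : ∀ ℓ x, divergence (X ℓ) x = 0 := fun ℓ => (hhom ℓ).divergence_eq_zero
  have e : ∀ ℓ, along (X ℓ) (wave η) = (Complex.I * (η ((X ℓ).1 0) : ℂ)) • wave η := by
    intro ℓ
    funext x
    rw [along_wave, hη.apply_eq (hhom ℓ), Pi.smul_apply, smul_eq_mul]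
  have h1 : ∀ ℓ, MemLp (along (X ℓ) (wave η)) 2 (μ.restrict Ω) := by
    intro ℓ
    rw [e]
    exact (memLp_wave hfin η).const_smul _
  convert smooth_mem_sobolev μ Ω hX (contDiff_wave η) (memLp_wave hfin η) h1 using 3 with ℓ
  rw [← MemLp.toLp_const_smul]
  exact MemLp.toLp_congr _ _ (Eventually.of_forall fun x => (congrFun (e ℓ) x).symm)

/-- Integration by parts without boundary term, allowed because only `w` has to lie in `S¹₀(Ω)`; the
wave satisfies no boundary condition. -/
theorem inner_wave_sobolevZero (hhom : ∀ ℓ, IsHomogeneous 𝒲 1 (X ℓ)) (hΩ : IsOpen Ω)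
    (hfin : μ Ω < ⊤) {η : W →L[ℝ] ℝ} (hη : IsWeightOne 𝒲 η) {w : L2 μ Ω × (Fin p → L2 μ Ω)}
    (hw : w ∈ sobolevZero μ Ω X) (ℓ : Fin p) :
    inner ℂ (memLp_wave hfin η).toLp (w.2 ℓ) =
      Complex.I * (η ((X ℓ).1 0) : ℂ) * inner ℂ (memLp_wave hfin η).toLp w.1 := by
  have hX : ∀ ℓ x, divergence (X ℓ) x = 0 := fun ℓ => (hhom ℓ).divergence_eq_zero
  have e : ∀ x, along (X ℓ) (wave (-η)) x =
      -(Complex.I * (η ((X ℓ).1 0) : ℂ)) * wave (-η) x := by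
    intro x
    rw [along_wave, neg_apply, hη.apply_eq (hhom ℓ)]
    push_cast
    ring
  have h1 : MemLp (along (X ℓ) (wave (-η))) 2 (μ.restrict Ω) := by
    rw [funext e]
    exact (memLp_wave hfin (-η)).const_mul _
  rw [inner_toLp_eq_integral, inner_toLp_eq_integral]
  simp only [conj_wave]
  rw [sobolevZero_integral_mul hΩ hX hw ℓ (contDiff_wave (-η)) (memLp_wave hfin (-η)) h1,
    ← integral_const_mul, ← integral_neg]
  refine integral_congr_ae (Eventually.of_forall fun x => ?_)
  simp only [e]
  ring

/-- Plane waves of weight one with a given symbol leave every finite-dimensional subspace, and the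
form `∑ ℓ, ‖X_ℓ u‖² - c ‖u‖²` degenerates on them and between them and `S¹₀(Ω)`. -/
theorem exists_wave_notMem (hhom : ∀ ℓ, IsHomogeneous 𝒲 1 (X ℓ))
    (hhor : HormanderCondition X) (hcodim : 2 ≤ degOneCodim 𝒲 X) (hΩ : IsOpen Ω)
    (hne : Ω.Nonempty) (hfin : μ Ω < ⊤) {c : ℝ} (hc : 0 < c) (F : Submodule ℂ (L2 μ Ω))
    [FiniteDimensional ℂ F] :
    ∃ (E : L2 μ Ω) (g : Fin p → L2 μ Ω), (E, g) ∈ sobolev μ Ω X ∧ E ∉ F ∧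
      ∑ ℓ, inner ℂ (g ℓ) (g ℓ) = c * inner ℂ E E ∧
      ∀ w ∈ sobolevZero μ Ω X, ∑ ℓ, inner ℂ (w.2 ℓ) (g ℓ) = c * inner ℂ w.1 E := by
  obtain ⟨η, hη, hηs⟩ := exists_injective_symbol_eq hhom hhor hcodim hc
  obtain ⟨n, hn⟩ := exists_notMem_of_linearIndependent
    (linearIndependent_wave (μ := μ) hΩ hne hfin hη) F
  obtain ⟨hη1, hηc⟩ := hηs n
  have hsymbol : ∀ z : ℂ, ∑ ℓ, (Complex.I * (η n ((X ℓ).1 0) : ℂ)) *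
      (starRingEnd ℂ (Complex.I * (η n ((X ℓ).1 0) : ℂ)) * z) = c * z := by
    intro z
    rw [← hηc, symbol]
    push_cast
    rw [Finset.sum_mul]
    refine Finset.sum_congr rfl fun ℓ _ => ?_
    rw [map_mul, Complex.conj_I, Complex.conj_ofReal]
    linear_combination (-(η n ((X ℓ).1 0) : ℂ) ^ 2 * z) * Complex.I_mul_I
  refine ⟨_, _, wave_mem_sobolev hhom hfin hη1, hn, ?_, fun w hw => ?_⟩
  · simp only [inner_smul_left, inner_smul_right]
    exact hsymbol _
  · refine Eq.trans (Finset.sum_congr rfl fun ℓ _ => ?_) (hsymbol _)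
    rw [inner_smul_right, ← inner_conj_symm,
      inner_wave_sobolevZero hhom hΩ hfin hη1 hw, map_mul, inner_conj_symm]

end PlaneWaves

/-! ### The comparison of counting functions -/

/-- Adding a vector on which the form `∑ ℓ, ‖g ℓ‖² - c ‖f‖²` is degenerate does not change it. -/
theorem form_add_le {H : Type*} [NormedAddCommGroup H] [InnerProductSpace ℂ H] {p : ℕ} {c : ℝ}
    {f z : H} {gf gz : Fin p → H} (hf : ∑ ℓ, ‖gf ℓ‖ ^ 2 ≤ c * ‖f‖ ^ 2)
    (hz : ∑ ℓ, inner ℂ (gz ℓ) (gz ℓ) = c * inner ℂ z z)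
    (hzf : ∑ ℓ, inner ℂ (gf ℓ) (gz ℓ) = c * inner ℂ f z) :
    ∑ ℓ, ‖(gf + gz) ℓ‖ ^ 2 ≤ c * ‖f + z‖ ^ 2 := by
  have h1 : ∑ ℓ, ‖gz ℓ‖ ^ 2 = c * ‖z‖ ^ 2 := by
    simp only [inner_self_eq_ofReal] at hz
    exact_mod_cast hz
  have h2 : ∑ ℓ, RCLike.re (inner ℂ (gf ℓ) (gz ℓ)) = c * RCLike.re (inner ℂ f z) := by
    have := congrArg Complex.re hzf
    rw [Complex.re_sum, Complex.re_ofReal_mul] at this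
    exact this
  have h3 : ∑ ℓ, ‖(gf + gz) ℓ‖ ^ 2 = ∑ ℓ, ‖gf ℓ‖ ^ 2 + 2 * ∑ ℓ, RCLike.re (inner ℂ (gf ℓ) (gz ℓ))
      + ∑ ℓ, ‖gz ℓ‖ ^ 2 := by
    simp only [Pi.add_apply, norm_add_sq (𝕜 := ℂ), Finset.sum_add_distrib, Finset.mul_sum]
  rw [h3, norm_add_sq (𝕜 := ℂ), h1, h2]
  linarith

/-- For `Q = ∑ ‖g ℓ‖² - c ‖·‖²`: `f` has `Q ≤ 0`, `e` is isotropic and `Q`-orthogonal to `f`, and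
`m` is `Q`-orthogonal to all of `D`. So `e` is added before `m`, and `m` never needs to be compared
with `e` separately. -/
theorem exists_form_le_add {H : Type*} [NormedAddCommGroup H] [InnerProductSpace ℂ H] {p : ℕ}
    {D : Submodule ℂ (H × (Fin p → H))} {c : ℝ} {f m e : H} {gf gm ge : Fin p → H}
    (hf : (f, gf) ∈ D) (hm : (m, gm) ∈ D) (he : (e, ge) ∈ D)
    (hle : ∑ ℓ, ‖gf ℓ‖ ^ 2 ≤ c * ‖f‖ ^ 2)
    (hmD : ∀ w ∈ D, ∑ ℓ, inner ℂ (w.2 ℓ) (gm ℓ) = c * inner ℂ w.1 m)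
    (hee : ∑ ℓ, inner ℂ (ge ℓ) (ge ℓ) = c * inner ℂ e e)
    (hfe : ∑ ℓ, inner ℂ (gf ℓ) (ge ℓ) = c * inner ℂ f e) (k : ℂ) :
    ∃ g, (f + m + k • e, g) ∈ D ∧ ∑ ℓ, ‖g ℓ‖ ^ 2 ≤ c * ‖f + m + k • e‖ ^ 2 := by
  have hfE : (f + k • e, gf + k • ge) ∈ D := add_mem hf (D.smul_mem k he)
  rw [add_right_comm f m]
  refine ⟨gf + k • ge + gm, add_mem hfE hm, ?_⟩
  refine form_add_le (form_add_le hle ?_ ?_) (hmD _ hm) (hmD _ hfE)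
  · simp only [Pi.smul_apply, inner_smul_left, inner_smul_right, ← Finset.mul_sum, hee]
    ring
  · simp only [Pi.smul_apply, inner_smul_right, ← Finset.mul_sum, hfe]
    ring

/-! ### Dirichlet against Neumann -/

section Comparison

variable {W : Type*} [NormedAddCommGroup W] [NormedSpace ℝ W] [FiniteDimensional ℝ W]
  [MeasurableSpace W] [BorelSpace W] {μ : Measure W} [μ.IsAddHaarMeasure] {Ω : Set W}
  {r : ℕ} {𝒲 : Fin r → Submodule ℝ W} [DirectSum.Decomposition 𝒲]
  {p : ℕ} {X : Fin p → VField W}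

theorem isShiftedInverse_neumann [CompleteSpace (formSpace (sobolev μ Ω X))] (hΩ : IsOpen Ω)
    (hX : ∀ ℓ x, divergence (X ℓ) x = 0) :
    IsShiftedInverse (neumann μ Ω X) (formInverse (sobolev μ Ω X)) :=
  isShiftedInverse_formInverse (mem_graph_neumann hΩ hX)

theorem isShiftedInverse_dirichlet [CompleteSpace (formSpace (sobolevZero μ Ω X))] (hΩ : IsOpen Ω)
    (hX : ∀ ℓ x, divergence (X ℓ) x = 0) :
    IsShiftedInverse (dirichlet μ Ω X) (formInverse (sobolevZero μ Ω X)) :=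
  isShiftedInverse_formInverse (mem_graph_dirichlet hΩ hX)

theorem mem_eigenspace_neumann_iff (hΩ : IsOpen Ω) (hX : ∀ ℓ x, divergence (X ℓ) x = 0) {c : ℝ}
    {u : L2 μ Ω} : u ∈ eigenspace (neumann μ Ω X) (c : ℂ) ↔ ∃ g, (u, g) ∈ sobolev μ Ω X ∧
      ∀ w ∈ sobolev μ Ω X, ∑ ℓ, inner ℂ (w.2 ℓ) (g ℓ) = c * inner ℂ w.1 u := by
  have : u ∈ eigenspace (neumann μ Ω X) (c : ℂ) ↔ (u, (c : ℂ) • u) ∈ (neumann μ Ω X).graph :=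
    Iff.rfl
  rw [this, mem_graph_neumann hΩ hX]
  simp only [inner_smul_right]

variable [CompleteSpace (formSpace (sobolevZero μ Ω X))]

/-- Eigenvalues of the Dirichlet realization are positive. -/
theorem pos_of_eigenspace_dirichlet_ne_bot [Nontrivial W] (hhom : ∀ ℓ, IsHomogeneous 𝒲 1 (X ℓ))
    (hhor : HormanderCondition X) (hΩ : IsOpen Ω) {c : ℝ}
    (hc : eigenspace (dirichlet μ Ω X) (c : ℂ) ≠ ⊥) : 0 < c := by
  have hX : ∀ ℓ x, divergence (X ℓ) x = 0 := fun ℓ => (hhom ℓ).divergence_eq_zero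
  obtain ⟨u, hu, hu0⟩ := Submodule.exists_mem_ne_zero_of_ne_bot hc
  have hD := isShiftedInverse_dirichlet (μ := μ) hΩ hX
  have h0 := (hD.eigenvalue_real_nonneg hu hu0).1
  rw [Complex.ofReal_re] at h0
  refine lt_of_le_of_ne h0 fun h => hu0 ?_
  subst h
  obtain ⟨g, hg, hle⟩ := hD.exists_form_le
    (IsShiftedInverse.eigenspace_le_spectralSubspace (Set.self_mem_Iic (a := (0 : ℝ))) hu)
  rw [zero_mul] at hle
  have hg0 : g = 0 := by
    funext ℓ
    have h1 := (Finset.sum_eq_zero_iff_of_nonneg fun ℓ _ => sq_nonneg ‖g ℓ‖).1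
      (le_antisymm hle (Finset.sum_nonneg fun ℓ _ => sq_nonneg _)) ℓ (Finset.mem_univ ℓ)
    simpa using h1
  subst hg0
  exact eq_zero_of_mem_sobolevZero hhom hhor hΩ hg

variable [CompleteSpace (formSpace (sobolev μ Ω X))]

/-- For `c > 0`, the counting function of the Neumann realization exceeds that of the Dirichlet
realization by at least one more than the multiplicity of `c` as a Neumann eigenvalue. -/
theorem finrank_dirichlet_add_le (hhom : ∀ ℓ, IsHomogeneous 𝒲 1 (X ℓ))
    (hhor : HormanderCondition X) (hcodim : 2 ≤ degOneCodim 𝒲 X) (hΩ : IsOpen Ω)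
    (hne : Ω.Nonempty) (hN : IsCompactOperator (formInverse (sobolev μ Ω X)))
    (hD : IsCompactOperator (formInverse (sobolevZero μ Ω X))) {c : ℝ} (hc : 0 < c) :
    Module.finrank ℂ (spectralSubspace (dirichlet μ Ω X) (Set.Iic c)) +
        Module.finrank ℂ (eigenspace (neumann μ Ω X) (c : ℂ)) + 1 ≤
      Module.finrank ℂ (spectralSubspace (neumann μ Ω X) (Set.Iic c)) := by
  have hX : ∀ ℓ x, divergence (X ℓ) x = 0 := fun ℓ => (hhom ℓ).divergence_eq_zero
  have hTN := isShiftedInverse_neumann (μ := μ) hΩ hX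
  have hTD := isShiftedInverse_dirichlet (μ := μ) hΩ hX
  have hfin := measure_lt_top_of_isCompactOperator hhom hN
  set F := spectralSubspace (dirichlet μ Ω X) (Set.Iic c) with hF
  set M := eigenspace (neumann μ Ω X) (c : ℂ) with hM
  have hFfd : FiniteDimensional ℂ F := hTD.finiteDimensional_spectralSubspace hD c
  have hMfd : FiniteDimensional ℂ M := by
    have := hTN.finiteDimensional_spectralSubspace hN c
    exact Submodule.finiteDimensional_of_le
      (IsShiftedInverse.eigenspace_le_spectralSubspace (Set.self_mem_Iic (a := c)))
  -- By uniqueness of weak derivatives the Dirichlet and Neumann lifts of a common element coincide,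
  -- so the lift in `S¹₀(Ω)` satisfies the Neumann equation.
  have hFM : F ⊓ M = ⊥ := by
    rw [eq_bot_iff]
    rintro u ⟨huF, huM⟩
    obtain ⟨g, hg, -⟩ := hTD.exists_form_le huF
    obtain ⟨k, hk, hk'⟩ := (mem_eigenspace_neumann_iff hΩ hX).1 huM
    have hgk : g = k := sobolev_snd_unique μ Ω hΩ hX hg.2 hk
    subst hgk
    exact eq_zero_of_mem_sobolevZero_of_neumann hhom hΩ hc.ne' hg hk'
  obtain ⟨E, gE, hEmem, hn, hEE, hEf⟩ :=
    exists_wave_notMem (μ := μ) hhom hhor hcodim hΩ hne hfin hc (F ⊔ M)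
  have hG : ∀ u ∈ F ⊔ M ⊔ Submodule.span ℂ {E},
      ∃ g, (u, g) ∈ sobolev μ Ω X ∧ ∑ ℓ, ‖g ℓ‖ ^ 2 ≤ c * ‖u‖ ^ 2 := by
    intro u hu
    obtain ⟨y, hy, z, hz, rfl⟩ := Submodule.mem_sup.1 hu
    obtain ⟨f, hf, m, hm, rfl⟩ := Submodule.mem_sup.1 hy
    obtain ⟨k, rfl⟩ := Submodule.mem_span_singleton.1 hz
    obtain ⟨gf, hgf, hle⟩ := hTD.exists_form_le hf
    obtain ⟨gm, hgm, hgm'⟩ := (mem_eigenspace_neumann_iff hΩ hX).1 hm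
    exact exists_form_le_add hgf.2 hgm hEmem hle hgm' hEE (hEf _ hgf) k
  have hle := hTN.finrank_le_of_form_le hN hc.le _ hG
  refine le_trans (le_of_eq ?_) hle
  have h1 := Submodule.finrank_sup_add_finrank_inf_eq F M
  rw [hFM, finrank_bot, add_zero] at h1
  have h2 := Submodule.finrank_sup_add_finrank_inf_eq (F ⊔ M) (Submodule.span ℂ {E})
  have hE0 : E ≠ 0 := fun h => hn (h ▸ zero_mem _)
  have h3 : (F ⊔ M) ⊓ Submodule.span ℂ {E} = ⊥ := by
    rw [← disjoint_iff, Submodule.disjoint_span_singleton' hE0]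
    exact hn
  rw [h3, finrank_bot, add_zero, finrank_span_singleton hE0, h1] at h2
  exact h2.symm

end Comparison

end SubLaplacian

end

open SubLaplacian in
theorem theorem3p1 {W : Type*} [NormedAddCommGroup W] [NormedSpace ℝ W] [FiniteDimensional ℝ W]
    [MeasurableSpace W] [BorelSpace W] (μ : MeasureTheory.Measure W) [μ.IsAddHaarMeasure]
    {r : ℕ} (𝒲 : Fin r → Submodule ℝ W) [DirectSum.Decomposition 𝒲]
    {p : ℕ} (X : Fin p → SubLaplacian.VField W)
    (hhom : ∀ ℓ, SubLaplacian.IsHomogeneous 𝒲 1 (X ℓ))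
    (hhor : SubLaplacian.HormanderCondition X)
    (hcodim : 2 ≤ SubLaplacian.degOneCodim 𝒲 X)
    (Ω : Set W) (hΩ : IsOpen Ω) (hne : Ω.Nonempty)
    (hcpt : SubLaplacian.HasCompactResolvent (SubLaplacian.neumann μ Ω X)) :
    (∃ a : ℕ → ℝ, SubLaplacian.IsEigenvalueSequence (SubLaplacian.dirichlet μ Ω X) a) ∧
    (∃ b : ℕ → ℝ, SubLaplacian.IsEigenvalueSequence (SubLaplacian.neumann μ Ω X) b) ∧
    ∀ a b : ℕ → ℝ,
      SubLaplacian.IsEigenvalueSequence (SubLaplacian.dirichlet μ Ω X) a →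
      SubLaplacian.IsEigenvalueSequence (SubLaplacian.neumann μ Ω X) b →
      ∀ j : ℕ, b (j + 1) < a j := by
  have hX : ∀ ℓ x, divergence (X ℓ) x = 0 := fun ℓ => (hhom ℓ).divergence_eq_zero
  have : CompleteSpace (formSpace (sobolev μ Ω X)) :=
    completeSpace_formSpace (isClosed_sobolev μ Ω hX)
  have : CompleteSpace (formSpace (sobolevZero μ Ω X)) :=
    completeSpace_formSpace (isClosed_sobolevZero μ Ω hX)
  have : Nontrivial W := by
    obtain ⟨e, η, -, h⟩ := exists_dual_pair hcodim
    refine ⟨e 0, 0, fun h0 => ?_⟩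
    have := h 0 0
    simp [h0] at this
  have hTN := isShiftedInverse_neumann (μ := μ) hΩ hX
  have hTD := isShiftedInverse_dirichlet (μ := μ) hΩ hX
  have hN := hTN.isCompactOperator hcpt
  have hD : IsCompactOperator (formInverse (sobolevZero μ Ω X)) :=
    isCompactOperator_formInverse_of_le inf_le_right hN
  have hinf : ¬ FiniteDimensional ℂ (L2 μ Ω) := by
    intro hfd
    obtain ⟨η, hη, -⟩ := exists_injective_symbol_eq hhom hhor hcodim one_pos
    have := linearIndependent_wave (μ := μ) hΩ hne
      (measure_lt_top_of_isCompactOperator hhom hN) hη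
    exact Infinite.not_finite (α := ℕ) this.finite
  refine ⟨hTD.exists_isEigenvalueSequence hD hinf, hTN.exists_isEigenvalueSequence hN hinf, ?_⟩
  intro a b ha hb j
  -- If `c = a j ≤ b (j + 1)`, at most `j + 1` Neumann eigenvalues lie strictly below `c`, so at
  -- most `j + 1` plus the multiplicity of `c` lie below or at it. The numbering from zero gives at
  -- least `j + 1` Dirichlet ones, and the comparison at `c` is violated by one.
  by_contra! hab
  have hc := pos_of_eigenspace_dirichlet_ne_bot hhom hhor hΩ (ha.eigenspace_ne_bot j)
  have h1 := finrank_dirichlet_add_le hhom hhor hcodim hΩ hne hN hD hc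
  rw [hTD.finrank_spectralSubspace_Iic ha, hTN.finrank_spectralSubspace_Iic hb,
    hb.finrank_eigenspace] at h1
  have h2 : j + 1 ≤ {k | a k ≤ a j}.ncard := by
    have : Set.Iic j ⊆ {k | a k ≤ a j} := fun k hk => ha.mono hk
    have h3 := Set.ncard_le_ncard this (ha.finite_le _)
    rwa [Set.ncard_eq_toFinset_card', Set.toFinset_Iic, Nat.card_Iic] at h3
  have h3 : {k | b k ≤ a j}.ncard ≤ (j + 1) + {k | b k = a j}.ncard := by
    have hsub : {k | b k ≤ a j} ⊆ Set.Iio (j + 1) ∪ {k | b k = a j} := by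
      intro k hk
      by_cases hkj : k < j + 1
      · exact Or.inl hkj
      · exact Or.inr (le_antisymm hk (hab.trans (hb.mono (not_lt.1 hkj))))
    have hfin : {k | b k = a j}.Finite := (hb.finite_le (a j)).subset fun k hk => le_of_eq hk
    refine (Set.ncard_le_ncard hsub ((Set.finite_Iio _).union hfin)).trans
      ((Set.ncard_union_le _ _).trans (Nat.add_le_add_right ?_ _))
    rw [Set.ncard_eq_toFinset_card', Set.toFinset_Iio, Nat.card_Iio]
  omega
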